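/- Let $M^2$ be a connected smooth surface in Euclidean 3-space, i.e. a connected smooth 2-manifold with a smooth immersion $x : M^2 \to \mathbf{E}^3$, equipped with the induced metric. Let $T^{\perp}M^2 = \{(p,\xi) : p \in M^2,\ \xi \in \mathbf{E}^3,\ \xi \perp dx(T_pM^2)\}$ be its normal bundle, immersed in $\mathbf{E}^6 = \mathbf{E}^3 \times \mathbf{E}^3$ by $f(p,\xi) = (x(p), \xi)$ (locally $f(p,t) = (x(p), tN(p))$, where $N$ is a local smooth unit normal field along $x$), and equipped with the metric $g$ induced by $f$. Let $\tau(f) = \mathrm{trace}_g(\nabla df)$ be the tension field of $f$ and let $$\tau_2(f) = \mathrm{trace}_g(\nabla\nabla - \nabla_{\nabla})\,\tau(f)$$ be its bitension field (the curvature term of the general definition is zero, since the target is flat). Then $T^{\perp}M^2$ is tangentially biharmonic, i.e. the component of $\tau_2(f)$ tangent to the immersion $f$ vanishes at every point of $T^{\perp}M^2$, if and only if at least one of the following holds: 1. $M^2$ is minimal, i.e. its mean curvature vector field vanishes identically; 2. $M^2$ is a part of a round sphere, i.e. $x(M^2)$ is contained in a sphere of some radius $r > 0$; 3. $M^2$ is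 a part of a circular cylinder, i.e. $x(M^2)$ is contained in the set of points at some fixed distance $r > 0$ from some straight line. -/

import Mathlib

open scoped Manifold ContDiff

noncomputable section

namespace NormalBundleSurface

/-- Euclidean 3-space. -/
abbrev E3 : Type := EuclideanSpace ℝ (Fin 3)

/-- Euclidean 6-space, as the Euclidean (l2) product of two copies of 3-space. -/
abbrev E6 : Type := WithLp 2 (E3 × E3)

section LocalGeometry

/-! Geometry of a parametrized immersion `F : ℝᵐ ⊇ W → E` into a Euclidean space `E`.
Everything below is evaluated only at points of an open set `W` on which `F` is a smooth immersion,
and `W` carries the Riemannian metric induced by `F`. -/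

variable {m : ℕ} {E : Type*} [NormedAddCommGroup E] [InnerProductSpace ℝ E]

/-- The partial derivative `∂ᵢψ`. -/
def partialD (i : Fin m) (ψ : EuclideanSpace ℝ (Fin m) → E) (y : EuclideanSpace ℝ (Fin m)) : E :=
  fderiv ℝ ψ y (EuclideanSpace.single i 1)

/-- The induced metric `gᵢⱼ = ⟨∂ᵢF, ∂ⱼF⟩`. -/
def metric (F : EuclideanSpace ℝ (Fin m) → E) (y : EuclideanSpace ℝ (Fin m)) :
    Matrix (Fin m) (Fin m) ℝ :=
  Matrix.of fun i j => inner ℝ (partialD i F y) (partialD j F y)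

/-- The Christoffel symbols `Γᵏᵢⱼ` of the Levi-Civita connection of the induced metric. -/
def christoffel (F : EuclideanSpace ℝ (Fin m) → E) (k i j : Fin m)
    (y : EuclideanSpace ℝ (Fin m)) : ℝ :=
  (1 / 2) * ∑ l, (metric F y)⁻¹ k l *
    (partialD i (fun z => metric F z j l) y + partialD j (fun z => metric F z i l) y
      - partialD l (fun z => metric F z i j) y)

/-- For a section `ψ` of the (flat, trivial) bundle `F^* TE`, the `(∂ᵢ, ∂ⱼ)` entry
`∇_{∂ᵢ}∇_{∂ⱼ}ψ - ∇_{∇_{∂ᵢ}∂ⱼ}ψ` of its second covariant derivative. For `ψ = F` this is the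
`(∂ᵢ, ∂ⱼ)` entry of `∇dF`. -/
def secondCovDeriv (F ψ : EuclideanSpace ℝ (Fin m) → E) (i j : Fin m)
    (y : EuclideanSpace ℝ (Fin m)) : E :=
  partialD i (partialD j ψ) y - ∑ k, christoffel F k i j y • partialD k ψ y

/-- `trace_g (∇∇ψ - ∇_∇ψ)`, i.e. `-Δ_F ψ`, with respect to the induced metric. -/
def traceLaplacian (F ψ : EuclideanSpace ℝ (Fin m) → E) (y : EuclideanSpace ℝ (Fin m)) : E :=
  ∑ i, ∑ j, (metric F y)⁻¹ i j • secondCovDeriv F ψ i j y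

/-- The tension field `τ(F) = trace_g ∇dF`. -/
def tension (F : EuclideanSpace ℝ (Fin m) → E) : EuclideanSpace ℝ (Fin m) → E :=
  traceLaplacian F F

/-- The bitension field `τ₂(F) = -Δ_F τ(F) + trace_g R(τ(F), dF)dF`; the target is a Euclidean
space, so its curvature tensor `R` is zero and the second term is absent. -/
def bitension (F : EuclideanSpace ℝ (Fin m) → E) : EuclideanSpace ℝ (Fin m) → E :=
  traceLaplacian F (tension F)

/-- The tangent space of the immersion at `y`, as a subspace of `E`. -/
def tangentPlane (F : EuclideanSpace ℝ (Fin m) → E) (y : EuclideanSpace ℝ (Fin m)) :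
    Submodule ℝ E :=
  LinearMap.range (fderiv ℝ F y).toLinearMap

instance (F : EuclideanSpace ℝ (Fin m) → E) (y : EuclideanSpace ℝ (Fin m)) :
    FiniteDimensional ℝ (tangentPlane F y) :=
  inferInstanceAs (FiniteDimensional ℝ (LinearMap.range (fderiv ℝ F y).toLinearMap))

/-- The second fundamental form `h(∂ᵢ, ∂ⱼ)`: the normal part of `∂ᵢ∂ⱼF` (Gauss formula). -/
def secondFundamentalForm (F : EuclideanSpace ℝ (Fin m) → E) (i j : Fin m)
    (y : EuclideanSpace ℝ (Fin m)) : E :=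
  (tangentPlane F y)ᗮ.starProjection (partialD i (partialD j F) y)

/-- The mean curvature vector `H = (1/m) trace_g h`. -/
def meanCurvature (F : EuclideanSpace ℝ (Fin m) → E) (y : EuclideanSpace ℝ (Fin m)) : E :=
  (1 / (m : ℝ)) • ∑ i, ∑ j, (metric F y)⁻¹ i j • secondFundamentalForm F i j y

/-- The tangential part of the bitension field. -/
def tangentialBitension (F : EuclideanSpace ℝ (Fin m) → E) (y : EuclideanSpace ℝ (Fin m)) : E :=
  (tangentPlane F y).starProjection (bitension F y)

end LocalGeometry

section Surface

variable {M : Type*} [TopologicalSpace M] [ChartedSpace (EuclideanSpace ℝ (Fin 2)) M]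

/-- The differential `dx_p : T_pM → E³` of `x`. (As a vector space, `T_pM` is the model space.) -/
def differential (x : M → E3) (p : M) : EuclideanSpace ℝ (Fin 2) →L[ℝ] E3 :=
  mfderiv (𝓡 2) 𝓘(ℝ, E3) x p

/-- `x : M² → E³` is a smooth immersion. -/
def IsSmoothImmersion (x : M → E3) : Prop :=
  ContMDiff (𝓡 2) 𝓘(ℝ, E3) ∞ x ∧
    ∀ p : M, Function.Injective (differential x p)

/-- The immersed surface is minimal: its mean curvature vector vanishes identically
(computed in every smooth chart). -/
def IsMinimal (x : M → E3) : Prop :=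
  ∀ φ ∈ IsManifold.maximalAtlas (𝓡 2) ∞ M, ∀ u ∈ φ.target,
    meanCurvature (fun v => x (φ.symm v)) u = 0

/-- The image of the surface is contained in a round sphere. -/
def IsPartOfRoundSphere (x : M → E3) : Prop :=
  ∃ (c : E3) (r : ℝ), 0 < r ∧ ∀ p, x p ∈ Metric.sphere c r

/-- The image of the surface is contained in a circular cylinder: the set of points at distance
`r > 0` from the line through `c` with unit direction `w`. -/
def IsPartOfCircularCylinder (x : M → E3) : Prop :=
  ∃ (c w : E3) (r : ℝ), ‖w‖ = 1 ∧ 0 < r ∧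
    ∀ p, ‖(x p - c) - (inner ℝ (x p - c) w) • w‖ = r

/-- The total space of the normal bundle: pairs `(p, ξ)` with `ξ ⊥ dx(T_pM)`. -/
def normalBundle (x : M → E3) : Set (M × E3) :=
  {q | ∀ v : EuclideanSpace ℝ (Fin 2), inner ℝ (differential x q.1 v) q.2 = 0}

/-- The natural immersion `f(ξ_x) = (x, ξ_x)` of the normal bundle into `E⁶ = E³ × E³`. -/
def normalBundleMap (x : M → E3) (q : M × E3) : E6 :=
  WithLp.toLp 2 (x q.1, q.2)

/-- `N` is a smooth unit normal field along `x` on the set `V`. -/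
def IsUnitNormalOn (x : M → E3) (V : Set M) (N : M → E3) : Prop :=
  ContMDiffOn (𝓡 2) 𝓘(ℝ, E3) ∞ N V ∧ ∀ p ∈ V, ‖N p‖ = 1 ∧ (p, N p) ∈ normalBundle x

/-- The local parametrization `(u₁, u₂, t) ↦ (p, t N(p))`, `p = φ⁻¹(u₁, u₂)`, of the normal bundle
given by a chart `φ` of `M` and a unit normal field `N` on its domain. -/
def normalBundleParam (φ : OpenPartialHomeomorph M (EuclideanSpace ℝ (Fin 2))) (N : M → E3)
    (y : EuclideanSpace ℝ (Fin 3)) : M × E3 :=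
  (φ.symm !₂[y 0, y 1], y 2 • N (φ.symm !₂[y 0, y 1]))

/-- The parametrization takes values in the normal bundle. -/
theorem normalBundleParam_mem {x : M → E3}
    {φ : OpenPartialHomeomorph M (EuclideanSpace ℝ (Fin 2))} {N : M → E3}
    (hN : IsUnitNormalOn x φ.source N) {y : EuclideanSpace ℝ (Fin 3)}
    (hy : !₂[y 0, y 1] ∈ φ.target) : normalBundleParam φ N y ∈ normalBundle x := by
  intro v
  have h := (hN.2 _ (φ.map_target hy)).2 v
  simp only [normalBundleParam, inner_smul_right]
  rw [h, mul_zero]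

/-- The normal bundle, with the metric induced by `f`, is tangentially biharmonic: the tangential
part of the bitension field of `f` vanishes at every point, computed in all the local
parametrizations given by smooth charts of `M` and smooth unit normal fields on their domains (these
cover the normal bundle, since unit normal fields exist on small charts). -/
def HasTangentiallyBiharmonicNormalBundle (x : M → E3) : Prop :=
  ∀ φ ∈ IsManifold.maximalAtlas (𝓡 2) ∞ M, ∀ N : M → E3, IsUnitNormalOn x φ.source N →
    ∀ y : EuclideanSpace ℝ (Fin 3), !₂[y 0, y 1] ∈ φ.target →
      tangentialBitension (fun z => normalBundleMap x (normalBundleParam φ N z)) y = 0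

end Surface

end NormalBundleSurface

end

/-! Everything reduces to two functions on an oriented patch `(X, N)` of the surface: the trace `h`
and the determinant `K` of the shape operator `S`, with dN = -dX ∘ S. The heart of the proof is
`isTangentiallyBiharmonic_iff_pderiv`: the normal bundle of the patch is tangentially biharmonic
exactly when dh = 0 and h dK = 0.

The metric induced by (u, t) ↦ (X, tN) is I(1 + t²S²) + dt². By Cayley-Hamilton its inverse is
explicit, with determinant factor (1 - t²K)² + t²h². The Christoffel symbols are never computed:
normality of the tension field and the Codazzi symmetry determine it as (P N + t² dN(y), -t dX(y)),
where P is the trace of the second fundamental form and y is dual to the trace c of its covariant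
derivative (`lap_X_and_lap_N`). Since c is a combination of dh and h dK, the conditions dh = 0 and h
dK = 0 give y = 0 and dP = 0 along the surface, and the tangential part of the bitension vanishes.

For the converse the tangential equations are expanded in t. At t = 0 the horizontal one says S(grad
h) = -(h/4) grad h, and the vertical one, after division by t, is a second-order scalar equation.
Where h and grad h do not vanish, the other principal curvature is therefore 5h/4; integrability of
the Weingarten equations together with the vertical equation then overdetermines |grad h|² as a
function of h, which is absurd (`one_eq_zero_of_isUnit`). Hence h is locally constant. The t²
coefficient of the horizontal equation now gives 12h S(grad K) = -h² grad K, and the characteristic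
polynomial of `S` forces h dK = 0.

If h is a nonzero constant, K is constant too. Either 4K = h², the patch is umbilic and 2N + hX is
constant; or the principal curvatures are distinct constants, the Gauss equation gives K = 0
(`mul_eq_zero_of_isUnit_sub`), and N + hX moves along a straight line orthogonal to N.

To globalise, |H| is locally constant, so constant on the connected `M`. If it is nonzero, the
points x + N/h and x + 2N/h can be written through H alone, so they do not depend on the choice of
N. The set of points that are locally of spherical type is clopen, and in the other case so is the
set of points whose focal points lie locally on a given axis. -/

noncomputable section

namespace NormalBundleSurface

open TopologicalSpace
open scoped Topology

/-! ### The ring of smooth functions on an open set: derivatives, inner products, pullbacks. -/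

section

variable {m : ℕ}

section SmoothCalculus

variable {E : Type*} [NormedAddCommGroup E]

/-- Extension by zero of a function on an open set. -/
def extendZero {W : Opens (EuclideanSpace ℝ (Fin m))} (f : W → E) : EuclideanSpace ℝ (Fin m) → E :=
  Function.extend Subtype.val f 0

theorem extendZero_apply {W : Opens (EuclideanSpace ℝ (Fin m))} (f : W → E) (w : W) :
    extendZero f w = f w :=
  Subtype.val_injective.extend_apply _ _ _

theorem extendZero_of_mem {W : Opens (EuclideanSpace ℝ (Fin m))} (f : W → E)
    {y : EuclideanSpace ℝ (Fin m)} (hy : y ∈ W) : extendZero f y = f ⟨y, hy⟩ :=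
  extendZero_apply f ⟨y, hy⟩

variable (W : Opens (EuclideanSpace ℝ (Fin m)))

/-- The algebra of smooth functions on an open set. -/
def smoothSubalgebra : Subalgebra ℝ (W → ℝ) where
  carrier := {f | ContDiffOn ℝ ∞ (extendZero f) W}
  mul_mem' {f g} hf hg := (ContDiffOn.mul hf hg).congr fun y hy => by
    simp [extendZero_of_mem _ hy]
  add_mem' {f g} hf hg := (ContDiffOn.add hf hg).congr fun y hy => by
    simp [extendZero_of_mem _ hy]
  algebraMap_mem' r := (contDiffOn_const (c := r)).congr fun y hy => by
    simp [extendZero_of_mem _ hy]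

/-- The ring of smooth functions on an open set. -/
def SmoothScalar : Type := smoothSubalgebra W

instance : CommRing (SmoothScalar W) := inferInstanceAs (CommRing (smoothSubalgebra W))
instance : Algebra ℝ (SmoothScalar W) := inferInstanceAs (Algebra ℝ (smoothSubalgebra W))

/-- The module of smooth vector-valued functions on an open set. -/
def smoothSubmodule (E : Type*) [NormedAddCommGroup E] [InnerProductSpace ℝ E] :
    Submodule (smoothSubalgebra W) (W → E) where
  carrier := {f | ContDiffOn ℝ ∞ (extendZero f) W}
  zero_mem' := (contDiffOn_const (c := 0)).congr fun y hy => by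
    simp [extendZero_of_mem _ hy]
  add_mem' {f g} hf hg := (ContDiffOn.add hf hg).congr fun y hy => by
    simp [extendZero_of_mem _ hy]
  smul_mem' c f hf := (ContDiffOn.smul c.2 hf).congr fun y hy => by
    simp [extendZero_of_mem _ hy]; rfl

/-- Smooth vector-valued functions on an open set. -/
def SmoothField (E : Type*) [NormedAddCommGroup E] [InnerProductSpace ℝ E] : Type _ :=
  smoothSubmodule W E

instance [InnerProductSpace ℝ E] : AddCommGroup (SmoothField W E) := inferInstanceAs (AddCommGroup (smoothSubmodule W E))
instance [InnerProductSpace ℝ E] : Module (SmoothScalar W) (SmoothField W E) :=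
  inferInstanceAs (Module (smoothSubalgebra W) (smoothSubmodule W E))

variable {W}

namespace SmoothScalar

/-- The underlying function. -/
def toFun (f : SmoothScalar W) : W → ℝ := f.1

instance : CoeFun (SmoothScalar W) fun _ => W → ℝ := ⟨toFun⟩

theorem contDiffOn (f : SmoothScalar W) : ContDiffOn ℝ ∞ (extendZero f) W := f.2

@[ext] theorem ext {f g : SmoothScalar W} (h : ∀ w, f w = g w) : f = g := Subtype.ext (funext h)

/-- Restriction of a function which is smooth on `W`. -/
def of (f : EuclideanSpace ℝ (Fin m) → ℝ) (hf : ContDiffOn ℝ ∞ f W) : SmoothScalar W :=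
  ⟨fun w => f w, hf.congr fun _ hy => extendZero_of_mem _ hy⟩

@[simp] theorem of_apply (f : EuclideanSpace ℝ (Fin m) → ℝ) (hf : ContDiffOn ℝ ∞ f W) (w : W) :
    of f hf w = f w := rfl

/-- Evaluation at a point. -/
def eval (w : W) : SmoothScalar W →+* ℝ :=
  (Pi.evalRingHom (fun _ : W => ℝ) w).comp (smoothSubalgebra W).val.toRingHom

theorem eval_apply (w : W) (f : SmoothScalar W) : eval w f = f w := rfl

@[simp] theorem add_apply (f g : SmoothScalar W) (w : W) : (f + g) w = f w + g w := rfl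
@[simp] theorem sub_apply (f g : SmoothScalar W) (w : W) : (f - g) w = f w - g w := rfl
@[simp] theorem neg_apply (f : SmoothScalar W) (w : W) : (-f) w = -f w := rfl
@[simp] theorem mul_apply (f g : SmoothScalar W) (w : W) : (f * g) w = f w * g w := rfl
@[simp] theorem zero_apply (w : W) : (0 : SmoothScalar W) w = 0 := rfl
@[simp] theorem one_apply (w : W) : (1 : SmoothScalar W) w = 1 := rfl
@[simp] theorem pow_apply (f : SmoothScalar W) (k : ℕ) (w : W) : (f ^ k) w = f w ^ k := rfl
@[simp] theorem ofNat_apply (k : ℕ) [k.AtLeastTwo] (w : W) :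
    (ofNat(k) : SmoothScalar W) w = ofNat(k) := map_ofNat (eval w) k
@[simp] theorem algebraMap_apply (r : ℝ) (w : W) : (algebraMap ℝ (SmoothScalar W) r) w = r := rfl
@[simp] theorem sum_apply {ι : Type*} (s : Finset ι) (f : ι → SmoothScalar W) (w : W) :
    (∑ i ∈ s, f i) w = ∑ i ∈ s, f i w := map_sum (eval w) f s

/-- The ring has zero divisors, so cancellation always goes through units; this is the source of
nearly all of them. -/
theorem isUnit_of_ne_zero {f : SmoothScalar W} (hf : ∀ w, f w ≠ 0) : IsUnit f := by
  refine IsUnit.of_mul_eq_one (of (fun y => (extendZero f y)⁻¹) (f.contDiffOn.inv fun y hy => ?_)) ?_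
  · rw [extendZero_of_mem _ hy]; exact hf _
  · ext w
    simp [extendZero_apply, hf w]

theorem ne_zero_of_isUnit {f : SmoothScalar W} (hf : IsUnit f) (w : W) : f w ≠ 0 :=
  (hf.map (eval w)).ne_zero

end SmoothScalar

end SmoothCalculus

section SmoothCalculus

variable {E E' : Type*} [NormedAddCommGroup E] [InnerProductSpace ℝ E]
  [NormedAddCommGroup E'] [InnerProductSpace ℝ E'] {W : Opens (EuclideanSpace ℝ (Fin m))}

namespace SmoothField

/-- The underlying function. -/
def toFun (f : SmoothField W E) : W → E := f.1

instance : CoeFun (SmoothField W E) fun _ => W → E := ⟨toFun⟩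

theorem contDiffOn (f : SmoothField W E) : ContDiffOn ℝ ∞ (extendZero f) W := f.2

@[ext] theorem ext {f g : SmoothField W E} (h : ∀ w, f w = g w) : f = g := Subtype.ext (funext h)

/-- Restriction of a function which is smooth on `W`. -/
def of (f : EuclideanSpace ℝ (Fin m) → E) (hf : ContDiffOn ℝ ∞ f W) : SmoothField W E :=
  ⟨fun w => f w, hf.congr fun _ hy => extendZero_of_mem _ hy⟩

@[simp] theorem of_apply (f : EuclideanSpace ℝ (Fin m) → E) (hf : ContDiffOn ℝ ∞ f W) (w : W) :
    of f hf w = f w := rfl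

@[simp] theorem add_apply (f g : SmoothField W E) (w : W) : (f + g) w = f w + g w := rfl
@[simp] theorem sub_apply (f g : SmoothField W E) (w : W) : (f - g) w = f w - g w := rfl
@[simp] theorem neg_apply (f : SmoothField W E) (w : W) : (-f) w = -f w := rfl
@[simp] theorem zero_apply (w : W) : (0 : SmoothField W E) w = 0 := rfl
@[simp] theorem smul_apply (f : SmoothScalar W) (g : SmoothField W E) (w : W) :
    (f • g) w = f w • g w := rfl

/-- Evaluation at a point. -/
def eval (w : W) : SmoothField W E →+ E where
  toFun f := f w
  map_zero' := rfl
  map_add' _ _ := rfl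

@[simp] theorem sum_apply {ι : Type*} (s : Finset ι) (f : ι → SmoothField W E) (w : W) :
    (∑ i ∈ s, f i) w = ∑ i ∈ s, f i w := map_sum (eval w) f s

end SmoothField

theorem contDiffOn_partialD {f : EuclideanSpace ℝ (Fin m) → E} (hf : ContDiffOn ℝ ∞ f W)
    (i : Fin m) : ContDiffOn ℝ ∞ (partialD i f) W :=
  ((hf.fderiv_of_isOpen W.isOpen (m := ∞) (by simp)).clm_apply contDiffOn_const)

theorem partialD_congr {f g : EuclideanSpace ℝ (Fin m) → E} (h : ∀ y ∈ W, f y = g y) (i : Fin m)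
    {y : EuclideanSpace ℝ (Fin m)} (hy : y ∈ W) : partialD i f y = partialD i g y := by
  unfold partialD
  rw [Filter.EventuallyEq.fderiv_eq]
  filter_upwards [W.isOpen.mem_nhds hy] with z hz using h z hz

theorem SmoothScalar.differentiableAt (f : SmoothScalar W) (w : W) :
    DifferentiableAt ℝ (extendZero f) w :=
  (f.contDiffOn.contDiffAt (W.isOpen.mem_nhds w.2)).differentiableAt (by simp)

theorem SmoothField.differentiableAt (f : SmoothField W E) (w : W) :
    DifferentiableAt ℝ (extendZero f) w :=
  (f.contDiffOn.contDiffAt (W.isOpen.mem_nhds w.2)).differentiableAt (by simp)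

/-- The partial derivative of a smooth vector-valued function. -/
def pderivField (i : Fin m) : SmoothField W E →+ SmoothField W E where
  toFun f := .of (partialD i (extendZero f)) (contDiffOn_partialD f.contDiffOn i)
  map_zero' := by
    ext w
    have : extendZero (W := W) (0 : SmoothField W E) = fun _ => 0 := by
      unfold extendZero; exact Function.extend_const _ _
    simp [partialD, this]
  map_add' f g := by
    ext w
    simp only [SmoothField.of_apply, SmoothField.add_apply]
    rw [partialD_congr (W := W) (g := extendZero f + extendZero g) _ i w.2]
    · unfold partialD
      rw [fderiv_add (f.differentiableAt w) (g.differentiableAt w)]; rfl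
    · intro y hy; simp [extendZero_of_mem _ hy]

/-- The partial derivative of a smooth function. -/
def pderiv (i : Fin m) : Derivation ℝ (SmoothScalar W) (SmoothScalar W) :=
  Derivation.mk'
    { toFun f := .of (partialD i (extendZero f)) (contDiffOn_partialD f.contDiffOn i)
      map_add' f g := by
        ext w
        simp only [SmoothScalar.of_apply, SmoothScalar.add_apply]
        rw [partialD_congr (W := W) (g := extendZero f + extendZero g) _ i w.2]
        · unfold partialD
          rw [fderiv_add (f.differentiableAt w) (g.differentiableAt w)]; rfl
        · intro y hy; simp [extendZero_of_mem _ hy]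
      map_smul' r f := by
        ext w
        simp only [SmoothScalar.of_apply, Algebra.smul_def, SmoothScalar.mul_apply]
        rw [partialD_congr (W := W) (g := r • extendZero f) _ i w.2]
        · unfold partialD
          rw [fderiv_const_smul (f.differentiableAt w)]; rfl
        · intro y hy; simp [extendZero_of_mem _ hy] }
    fun f g => by
      ext w
      simp only [LinearMap.coe_mk, AddHom.coe_mk, SmoothScalar.of_apply, SmoothScalar.mul_apply,
        smul_eq_mul, SmoothScalar.add_apply]
      rw [partialD_congr (W := W) (g := extendZero f * extendZero g) _ i w.2]
      · unfold partialD
        rw [fderiv_mul (f.differentiableAt w) (g.differentiableAt w)]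
        simp [extendZero_apply]
      · intro y hy; simp [extendZero_of_mem _ hy]

theorem pderiv_apply (i : Fin m) (f : SmoothScalar W) (w : W) :
    pderiv i f w = partialD i (extendZero f) w := rfl

theorem pderivField_apply (i : Fin m) (f : SmoothField W E) (w : W) :
    pderivField i f w = partialD i (extendZero f) w := rfl

theorem pderiv_eq_partialD (i : Fin m) {f : SmoothScalar W} {g : EuclideanSpace ℝ (Fin m) → ℝ}
    (h : ∀ w : W, g w = f w) (w : W) : pderiv i f w = partialD i g w :=
  partialD_congr (fun y hy => by rw [extendZero_of_mem _ hy, ← h ⟨y, hy⟩]) i w.2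

theorem pderivField_eq_partialD (i : Fin m) {f : SmoothField W E}
    {g : EuclideanSpace ℝ (Fin m) → E} (h : ∀ w : W, g w = f w) (w : W) :
    pderivField i f w = partialD i g w :=
  partialD_congr (fun y hy => by rw [extendZero_of_mem _ hy, ← h ⟨y, hy⟩]) i w.2

theorem pderivField_smul (i : Fin m) (f : SmoothScalar W) (g : SmoothField W E) :
    pderivField i (f • g) = pderiv i f • g + f • pderivField i g := by
  ext w
  rw [pderivField_eq_partialD i (g := extendZero f • extendZero g)]
  · unfold partialD
    rw [fderiv_smul (f.differentiableAt w) (g.differentiableAt w)]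
    simp [extendZero_apply, pderiv_apply, pderivField_apply, partialD, add_comm]
  · intro w; simp [extendZero_apply]

theorem pderivField_comm (i j : Fin m) (f : SmoothField W E) :
    pderivField i (pderivField j f) = pderivField j (pderivField i f) := by
  ext w
  have h := f.contDiffOn.contDiffAt (W.isOpen.mem_nhds w.2)
  have hd : DifferentiableAt ℝ (fderiv ℝ (extendZero f)) w :=
    (h.fderiv_right (m := 1) (by norm_cast)).differentiableAt (by simp)
  have key : ∀ i j, pderivField i (pderivField j f) w =
      fderiv ℝ (fderiv ℝ (extendZero f)) w (EuclideanSpace.single i 1)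
        (EuclideanSpace.single j 1) := by
    intro i j
    rw [pderivField_eq_partialD i (g := partialD j (extendZero f)) (fun w => rfl)]
    unfold partialD
    rw [fderiv_clm_apply hd (differentiableAt_const _)]
    simp
  rw [key, key]
  exact (h.isSymmSndFDerivAt (by simpa using (WithTop.coe_le_coe.2 le_top : ((2 : ℕ∞) : WithTop ℕ∞) ≤ _))) _ _

/-- The pointwise inner product. -/
def innerField : SmoothField W E →ₗ[SmoothScalar W] SmoothField W E →ₗ[SmoothScalar W]
    SmoothScalar W :=
  LinearMap.mk₂ _ (fun f g => .of (fun y => inner ℝ (extendZero f y) (extendZero g y))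
      (f.contDiffOn.inner ℝ g.contDiffOn))
    (fun f g k => by ext w; simp [extendZero_apply, inner_add_left])
    (fun c f g => by ext w; simp [extendZero_apply, inner_smul_left])
    (fun f g k => by ext w; simp [extendZero_apply, inner_add_right])
    (fun c f g => by ext w; simp [extendZero_apply, inner_smul_right])

theorem innerField_apply (f g : SmoothField W E) (w : W) :
    innerField f g w = inner ℝ (f w) (g w) := by
  simp [innerField, extendZero_apply]

theorem innerField_comm (f g : SmoothField W E) : innerField f g = innerField g f := by
  ext w; simp [innerField_apply, real_inner_comm]

theorem pderiv_innerField (i : Fin m) (f g : SmoothField W E) :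
    pderiv i (innerField f g) = innerField (pderivField i f) g + innerField f (pderivField i g) := by
  ext w
  rw [pderiv_eq_partialD i (g := fun y => inner ℝ (extendZero f y) (extendZero g y))]
  · unfold partialD
    rw [fderiv_inner_apply ℝ (f.differentiableAt w) (g.differentiableAt w)]
    simp [innerField_apply, extendZero_apply, pderivField_apply, partialD, add_comm]
  · intro w; simp [innerField_apply, extendZero_apply]

/-- Postcomposition with a continuous linear map. -/
def mapField (T : E →L[ℝ] E') : SmoothField W E →ₗ[SmoothScalar W] SmoothField W E' where
  toFun f := .of (fun y => T (extendZero f y)) (T.contDiff.comp_contDiffOn f.contDiffOn)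
  map_add' f g := by ext w; simp [extendZero_apply]
  map_smul' f g := by ext w; simp [extendZero_apply]

theorem mapField_apply (T : E →L[ℝ] E') (f : SmoothField W E) (w : W) :
    mapField T f w = T (f w) := by
  simp [mapField, extendZero_apply]

theorem pderivField_mapField (T : E →L[ℝ] E') (i : Fin m) (f : SmoothField W E) :
    pderivField i (mapField T f) = mapField T (pderivField i f) := by
  ext w
  rw [pderivField_eq_partialD i (g := T ∘ extendZero f)]
  · unfold partialD
    rw [fderiv_comp _ T.differentiableAt (f.differentiableAt w)]
    simp [mapField_apply, pderivField_apply, partialD]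
  · intro w; simp [mapField_apply, extendZero_apply]

section Pullback

theorem partialD_comp_clm {m' : ℕ} (σ : EuclideanSpace ℝ (Fin m) →L[ℝ] EuclideanSpace ℝ (Fin m'))
    {f : EuclideanSpace ℝ (Fin m') → E} {y : EuclideanSpace ℝ (Fin m)}
    (hf : DifferentiableAt ℝ f (σ y)) (i : Fin m) :
    partialD i (f ∘ σ) y = fderiv ℝ f (σ y) (σ (EuclideanSpace.single i 1)) := by
  have h : fderiv ℝ (f ∘ σ) y = (fderiv ℝ f (σ y)).comp σ :=
    (hf.hasFDerivAt.comp y σ.hasFDerivAt).fderiv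
  rw [partialD, h]; rfl

variable {m' : ℕ} {W' : Opens (EuclideanSpace ℝ (Fin m'))}
  (σ : EuclideanSpace ℝ (Fin m) →L[ℝ] EuclideanSpace ℝ (Fin m'))
  (hσ : ∀ y ∈ W, σ y ∈ W')

/-- Precomposition of smooth functions with a linear map. -/
def pullback : SmoothScalar W' →+* SmoothScalar W where
  toFun f := .of (fun y => extendZero f (σ y)) (f.contDiffOn.comp σ.contDiff.contDiffOn hσ)
  map_zero' := by ext w; simp [extendZero_of_mem _ (hσ _ w.2)]
  map_one' := by ext w; simp [extendZero_of_mem _ (hσ _ w.2)]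
  map_add' f g := by ext w; simp [extendZero_of_mem _ (hσ _ w.2)]
  map_mul' f g := by ext w; simp [extendZero_of_mem _ (hσ _ w.2)]

/-- Precomposition of smooth vector-valued functions with a linear map. -/
def pullbackField : SmoothField W' E →+ SmoothField W E where
  toFun f := .of (fun y => extendZero f (σ y)) (f.contDiffOn.comp σ.contDiff.contDiffOn hσ)
  map_zero' := by ext w; simp [extendZero_of_mem _ (hσ _ w.2)]
  map_add' f g := by ext w; simp [extendZero_of_mem _ (hσ _ w.2)]

theorem pullback_apply (f : SmoothScalar W') (w : W) :
    pullback σ hσ f w = f ⟨σ w, hσ w w.2⟩ := by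
  simp [pullback, extendZero_of_mem _ (hσ _ w.2)]

theorem pullbackField_apply (f : SmoothField W' E) (w : W) :
    pullbackField σ hσ f w = f ⟨σ w, hσ w w.2⟩ := by
  simp [pullbackField, extendZero_of_mem _ (hσ _ w.2)]

theorem pullbackField_smul (f : SmoothScalar W') (g : SmoothField W' E) :
    pullbackField σ hσ (f • g) = pullback σ hσ f • pullbackField σ hσ g := by
  ext w; simp [pullbackField_apply, pullback_apply]

theorem pullback_innerField (f g : SmoothField W' E) :
    pullback σ hσ (innerField f g) = innerField (pullbackField σ hσ f) (pullbackField σ hσ g) := by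
  ext w; simp [pullbackField_apply, pullback_apply, innerField_apply]

theorem pderiv_pullback {i : Fin m} {j : Fin m'}
    (h : σ (EuclideanSpace.single i 1) = EuclideanSpace.single j 1) (f : SmoothScalar W') :
    pderiv i (pullback σ hσ f) = pullback σ hσ (pderiv j f) := by
  ext w
  rw [pderiv_eq_partialD i (g := extendZero f ∘ σ)]
  · rw [partialD_comp_clm σ (f.differentiableAt ⟨σ w, hσ w w.2⟩)]
    simp [pullback_apply, pderiv_apply, partialD, h]
  · intro w; simp [pullback_apply, extendZero_of_mem _ (hσ _ w.2)]

theorem pderivField_pullbackField {i : Fin m} {j : Fin m'}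
    (h : σ (EuclideanSpace.single i 1) = EuclideanSpace.single j 1) (f : SmoothField W' E) :
    pderivField i (pullbackField σ hσ f) = pullbackField σ hσ (pderivField j f) := by
  ext w
  rw [pderivField_eq_partialD i (g := extendZero f ∘ σ)]
  · rw [partialD_comp_clm σ (f.differentiableAt ⟨σ w, hσ w w.2⟩)]
    simp [pullbackField_apply, pderivField_apply, partialD, h]
  · intro w; simp [pullbackField_apply, extendZero_of_mem _ (hσ _ w.2)]

theorem pderivField_pullbackField_of_apply_eq_zero {i : Fin m}
    (h : σ (EuclideanSpace.single i 1) = 0) (f : SmoothField W' E) :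
    pderivField i (pullbackField σ hσ f) = 0 := by
  ext w
  rw [pderivField_eq_partialD i (g := extendZero f ∘ σ)]
  · rw [partialD_comp_clm σ (f.differentiableAt ⟨σ w, hσ w w.2⟩)]
    simp [h]
  · intro w; simp [pullbackField_apply, extendZero_of_mem _ (hσ _ w.2)]

end Pullback

end SmoothCalculus

end

local notation "⟪" a ", " b "⟫" => innerField a b
local notation "𝐝" => pderiv
local notation "𝐃" => pderivField

/-! ### The Laplacian of an induced metric, computed in the ring of smooth functions. -/

section

section Laplacian

variable {m : ℕ} {E E' : Type*} [NormedAddCommGroup E] [InnerProductSpace ℝ E]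
  [NormedAddCommGroup E'] [InnerProductSpace ℝ E'] {W : Opens (EuclideanSpace ℝ (Fin m))}

/-- The second-order operator `gⁱʲ ∂ᵢ∂ⱼ - bᵏ ∂ₖ` on functions. -/
def lapScalar (g : Matrix (Fin m) (Fin m) (SmoothScalar W)) (b : Fin m → SmoothScalar W)
    (f : SmoothScalar W) : SmoothScalar W :=
  ∑ i, ∑ j, g i j * pderiv i (pderiv j f) - ∑ k, b k * pderiv k f

/-- The second-order operator `gⁱʲ ∂ᵢ∂ⱼ - bᵏ ∂ₖ` on vector-valued functions. -/
def lapField (g : Matrix (Fin m) (Fin m) (SmoothScalar W)) (b : Fin m → SmoothScalar W)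
    (ψ : SmoothField W E) : SmoothField W E :=
  ∑ i, ∑ j, g i j • pderivField i (pderivField j ψ) - ∑ k, b k • pderivField k ψ

/-- The first-order part is a derivation, so `b` creates no cross term and may stay arbitrary;
symmetry of `g` merges the two cross terms of the second-order part. -/
theorem lapField_smul {g : Matrix (Fin m) (Fin m) (SmoothScalar W)} (hg : g.IsSymm)
    (b : Fin m → SmoothScalar W) (f : SmoothScalar W) (ψ : SmoothField W E) :
    lapField g b (f • ψ) = f • lapField g b ψ + lapScalar g b f • ψ +
      (2 : SmoothScalar W) • ∑ i, ∑ j, (g i j * pderiv i f) • pderivField j ψ := by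
  have hsymm : ∑ i, ∑ j, (g i j * pderiv j f) • pderivField i ψ =
      ∑ i, ∑ j, (g i j * pderiv i f) • pderivField j ψ := by
    rw [Finset.sum_comm]
    refine Finset.sum_congr rfl fun i _ => Finset.sum_congr rfl fun j _ => ?_
    rw [hg.apply]
  rw [two_smul]
  nth_rw 1 [← hsymm]
  simp only [lapField, lapScalar, pderivField_smul, map_add, smul_add, Finset.sum_add_distrib,
    smul_sub, sub_smul, Finset.smul_sum, Finset.sum_smul, smul_smul, mul_comm f]
  abel

theorem lapScalar_innerField {g : Matrix (Fin m) (Fin m) (SmoothScalar W)} (hg : g.IsSymm)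
    (b : Fin m → SmoothScalar W) (φ ψ : SmoothField W E) :
    lapScalar g b (innerField φ ψ) = innerField (lapField g b φ) ψ + innerField φ (lapField g b ψ) +
      2 * ∑ i, ∑ j, g i j * innerField (pderivField i φ) (pderivField j ψ) := by
  have hsymm : ∑ i, ∑ j, g i j * innerField (pderivField j φ) (pderivField i ψ) =
      ∑ i, ∑ j, g i j * innerField (pderivField i φ) (pderivField j ψ) := by
    rw [Finset.sum_comm]
    refine Finset.sum_congr rfl fun i _ => Finset.sum_congr rfl fun j _ => ?_
    rw [hg.apply]
  rw [two_mul]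
  nth_rw 1 [← hsymm]
  simp only [lapField, lapScalar, pderiv_innerField, map_add, map_sub, map_sum, map_smul,
    LinearMap.sub_apply, LinearMap.sum_apply, LinearMap.smul_apply, smul_eq_mul, mul_add, Finset.sum_add_distrib]
  abel

theorem mapField_lapField (T : E →L[ℝ] E') (g : Matrix (Fin m) (Fin m) (SmoothScalar W))
    (b : Fin m → SmoothScalar W) (ψ : SmoothField W E) :
    mapField T (lapField g b ψ) = lapField g b (mapField T ψ) := by
  simp only [lapField, map_sub, map_sum, map_smul, pderivField_mapField]

/-- The induced metric of `F`, as a matrix of smooth functions. -/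
def gram (F : SmoothField W E) : Matrix (Fin m) (Fin m) (SmoothScalar W) :=
  .of fun i j => innerField (pderivField i F) (pderivField j F)

theorem gram_apply (F : SmoothField W E) (i j : Fin m) :
    gram F i j = innerField (pderivField i F) (pderivField j F) := rfl

theorem gram_isSymm (F : SmoothField W E) : (gram F).IsSymm := by
  ext i j; simp [gram_apply, innerField_comm]

/-- The Christoffel symbols, as smooth functions. -/
def gramChristoffel (F : SmoothField W E) (k i j : Fin m) : SmoothScalar W :=
  algebraMap ℝ _ (1 / 2) * ∑ l, (gram F)⁻¹ k l *
    (pderiv i (gram F j l) + pderiv j (gram F i l) - pderiv l (gram F i j))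

/-- The contracted Christoffel symbols `gⁱʲ Γᵏᵢⱼ`. -/
def drift (F : SmoothField W E) (k : Fin m) : SmoothScalar W :=
  ∑ i, ∑ j, (gram F)⁻¹ i j * gramChristoffel F k i j

/-- For a metric induced by F, the Koszul combination ∂ᵢgⱼₗ + ∂ⱼgᵢₗ - ∂ₗgᵢⱼ collapses to 2⟨∂ᵢ∂ⱼF,
∂ₗF⟩, because second derivatives commute. -/
theorem gramChristoffel_eq (F : SmoothField W E) (k i j : Fin m) :
    gramChristoffel F k i j =
      ∑ l, (gram F)⁻¹ k l * innerField (pderivField i (pderivField j F)) (pderivField l F) := by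
  rw [gramChristoffel, Finset.mul_sum]
  refine Finset.sum_congr rfl fun l _ => ?_
  have h2 : algebraMap ℝ (SmoothScalar W) (1 / 2) * 2 = 1 := by
    rw [← map_ofNat (algebraMap ℝ (SmoothScalar W)) 2, ← map_mul]; norm_num
  simp only [gram_apply, pderiv_innerField]
  rw [pderivField_comm i l, pderivField_comm j l, pderivField_comm j i,
    innerField_comm (pderivField j F) (pderivField l (pderivField i F)),
    innerField_comm (pderivField i F) (pderivField l (pderivField j F))]
  linear_combination (gram F)⁻¹ k l *
    innerField (pderivField i (pderivField j F)) (pderivField l F) * h2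

/-- The tension field is normal. -/
theorem innerField_lapField_self (F : SmoothField W E) (hF : IsUnit (gram F).det) (n : Fin m) :
    innerField (lapField (gram F)⁻¹ (drift F) F) (pderivField n F) = 0 := by
  have key : ∀ i j, ∑ k, gramChristoffel F k i j * gram F k n =
      innerField (pderivField i (pderivField j F)) (pderivField n F) := by
    intro i j
    have h1 := Matrix.nonsing_inv_mul (gram F) hF
    have h1' : ∀ l n, ∑ k, (gram F)⁻¹ k l * gram F k n = if l = n then 1 else 0 := by
      intro l n
      have hs : ((gram F)⁻¹).IsSymm := (gram_isSymm F).inv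
      rw [← Matrix.one_apply, ← h1, Matrix.mul_apply]
      exact Finset.sum_congr rfl fun k _ => by rw [hs.apply]
    simp only [gramChristoffel_eq, Finset.sum_mul]
    rw [Finset.sum_comm]
    calc _ = ∑ l, (∑ k, (gram F)⁻¹ k l * gram F k n) *
          innerField (pderivField i (pderivField j F)) (pderivField l F) := by
          refine Finset.sum_congr rfl fun l _ => ?_
          rw [Finset.sum_mul]
          exact Finset.sum_congr rfl fun k _ => by ring
      _ = _ := by simp [h1']
  simp only [lapField, drift, map_sub, map_sum, map_smul, LinearMap.sub_apply, LinearMap.sum_apply,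
    LinearMap.smul_apply, smul_eq_mul, ← gram_apply, Finset.sum_mul]
  rw [sub_eq_zero]
  symm
  rw [Finset.sum_comm]
  refine Finset.sum_congr rfl fun i _ => ?_
  rw [Finset.sum_comm]
  refine Finset.sum_congr rfl fun j _ => ?_
  rw [← key i j, Finset.mul_sum]
  exact Finset.sum_congr rfl fun k _ => by ring

/-- Links two inverses: `metric` is inverted as a real matrix at each point, `gram` as a matrix over
the ring of smooth functions. -/
theorem eval_inv_apply {A : Matrix (Fin m) (Fin m) (SmoothScalar W)} (hA : IsUnit A.det) (w : W)
    (i j : Fin m) : (A⁻¹ i j) w = (Matrix.of fun i j => A i j w)⁻¹ i j := by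
  have h : (A.map (SmoothScalar.eval w)) * (A⁻¹.map (SmoothScalar.eval w)) = 1 := by
    rw [← Matrix.map_mul, Matrix.mul_nonsing_inv A hA]
    exact Matrix.map_one _ (map_zero _) (map_one _)
  have h' : (Matrix.of fun i j => A i j w) = A.map (SmoothScalar.eval w) := rfl
  rw [h', Matrix.inv_eq_right_inv h]; rfl

section Bridge

variable {F : EuclideanSpace ℝ (Fin m) → E} {Φ : SmoothField W E}

theorem partialD_partialD_eq {ψ : EuclideanSpace ℝ (Fin m) → E} {Ψ : SmoothField W E}
    (hψ : ∀ w : W, ψ w = Ψ w) (i j : Fin m) (w : W) :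
    partialD i (partialD j ψ) w = pderivField i (pderivField j Ψ) w :=
  (pderivField_eq_partialD i (fun w => (pderivField_eq_partialD j hψ w).symm) w).symm

theorem metric_apply_eq (hF : ∀ w : W, F w = Φ w) (w : W) (i j : Fin m) :
    metric F w i j = gram Φ i j w := by
  simp [metric, gram_apply, innerField_apply, pderivField_eq_partialD _ hF]

theorem metric_eq (hF : ∀ w : W, F w = Φ w) (w : W) :
    metric F w = Matrix.of fun i j => gram Φ i j w := by
  ext i j; exact metric_apply_eq hF w i j

theorem christoffel_eq (hF : ∀ w : W, F w = Φ w) (hΦ : IsUnit (gram Φ).det) (k i j : Fin m)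
    (w : W) : christoffel F k i j w = gramChristoffel Φ k i j w := by
  have h : ∀ i j l, partialD i (fun z => metric F z j l) w = pderiv i (gram Φ j l) w :=
    fun i j l => (pderiv_eq_partialD i (fun w => metric_apply_eq hF w j l) w).symm
  simp [christoffel, gramChristoffel, h, eval_inv_apply hΦ, metric_eq hF]

/-- Agreement on the open set `W` suffices, since all derivatives are taken at points of `W`; the
values of F and ψ elsewhere are irrelevant. -/
theorem traceLaplacian_eq (hF : ∀ w : W, F w = Φ w) (hΦ : IsUnit (gram Φ).det)
    {ψ : EuclideanSpace ℝ (Fin m) → E} {Ψ : SmoothField W E} (hψ : ∀ w : W, ψ w = Ψ w) (w : W) :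
    traceLaplacian F ψ w = lapField (gram Φ)⁻¹ (drift Φ) Ψ w := by
  simp only [traceLaplacian, secondCovDeriv, lapField, drift, SmoothField.sub_apply,
    SmoothField.sum_apply, SmoothField.smul_apply, SmoothScalar.sum_apply, SmoothScalar.mul_apply,
    partialD_partialD_eq hψ, ← pderivField_eq_partialD _ hψ, christoffel_eq hF hΦ,
    eval_inv_apply hΦ, ← metric_eq hF, smul_sub, Finset.sum_sub_distrib]
  congr 1
  simp only [Finset.smul_sum, Finset.sum_smul, smul_smul]
  symm
  rw [Finset.sum_comm]
  exact Finset.sum_congr rfl fun i _ => Finset.sum_comm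

theorem bitension_eq (hF : ∀ w : W, F w = Φ w) (hΦ : IsUnit (gram Φ).det) (w : W) :
    bitension F w = lapField (gram Φ)⁻¹ (drift Φ) (lapField (gram Φ)⁻¹ (drift Φ) Φ) w :=
  traceLaplacian_eq hF hΦ (traceLaplacian_eq hF hΦ hF) w

end Bridge

theorem mem_tangentPlane_orthogonal_iff (F : EuclideanSpace ℝ (Fin m) → E)
    (y : EuclideanSpace ℝ (Fin m)) (v : E) :
    v ∈ (tangentPlane F y)ᗮ ↔ ∀ k, inner ℝ v (partialD k F y) = 0 := by
  rw [Submodule.mem_orthogonal']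
  constructor
  · intro h k
    exact h _ ⟨_, rfl⟩
  · rintro h _ ⟨u, rfl⟩
    have hu : u = ∑ k, u k • EuclideanSpace.single k (1 : ℝ) := by
      ext k
      simp [Finset.sum_apply, Pi.single_apply]
    rw [hu]
    simp only [map_sum, map_smul, inner_sum, inner_smul_right]
    exact Finset.sum_eq_zero fun k _ => by
      have := h k
      simp only [partialD] at this
      simp [this]

theorem tangentialBitension_eq_zero_iff (F : EuclideanSpace ℝ (Fin m) → E)
    (y : EuclideanSpace ℝ (Fin m)) :
    tangentialBitension F y = 0 ↔ ∀ k, inner ℝ (bitension F y) (partialD k F y) = 0 := by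
  rw [← mem_tangentPlane_orthogonal_iff, tangentialBitension,
    Submodule.starProjection_apply_eq_zero_iff]

end Laplacian

end

/-! ### Oriented patches: shape operator, Weingarten and Codazzi equations. -/

section

theorem linearIndependent_frame {a b n : E3} (hab : LinearIndependent ℝ ![a, b]) (hn : ‖n‖ = 1)
    (ha : inner ℝ n a = 0) (hb : inner ℝ n b = 0) : LinearIndependent ℝ ![a, b, n] := by
  rw [LinearIndependent.pair_iff] at hab
  rw [Fintype.linearIndependent_iff]
  intro c hc
  simp only [Fin.sum_univ_three, Matrix.cons_val_zero, Matrix.cons_val_one, Matrix.cons_val] at hc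
  have h2 : c 2 = 0 := by
    have := congrArg (fun v => inner ℝ n v) hc
    simpa [inner_add_right, inner_smul_right, ha, hb, hn] using this
  obtain ⟨h0, h1⟩ := hab (c 0) (c 1) (by simpa [h2] using hc)
  intro i; fin_cases i <;> assumption

theorem eq_zero_of_inner_linearIndependent {v : Fin 3 → E3} (hv : LinearIndependent ℝ v) {w : E3}
    (h : ∀ i, inner ℝ w (v i) = 0) : w = 0 := by
  have hspan := hv.span_eq_top_of_card_eq_finrank (by simp)
  have : w ∈ (⊤ : Submodule ℝ E3)ᗮ := by
    rw [← hspan, Submodule.mem_orthogonal']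
    intro u hu
    induction hu using Submodule.span_induction with
    | mem x hx => obtain ⟨i, rfl⟩ := hx; exact h i
    | zero => simp
    | add x y _ _ hx hy => rw [inner_add_right, hx, hy, add_zero]
    | smul c x _ hx => rw [inner_smul_right, hx, mul_zero]
  simpa using this

theorem eq_zero_of_inner_frame {a b n w : E3} (hab : LinearIndependent ℝ ![a, b]) (hn : ‖n‖ = 1)
    (ha : inner ℝ n a = 0) (hb : inner ℝ n b = 0) (hwa : inner ℝ w a = 0) (hwb : inner ℝ w b = 0)
    (hwn : inner ℝ w n = 0) : w = 0 :=
  eq_zero_of_inner_linearIndependent (linearIndependent_frame hab hn ha hb)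
    fun i => by fin_cases i <;> assumption

/-- A smooth immersion of a plane domain into `E³` together with a smooth unit normal field. -/
structure OrientedPatch (U : Opens (EuclideanSpace ℝ (Fin 2))) where
  X : SmoothField U E3
  N : SmoothField U E3
  linearIndependent : ∀ u, LinearIndependent ℝ ![pderivField 0 X u, pderivField 1 X u]
  inner_N_N : innerField N N = 1
  inner_N_X : ∀ i, innerField N (pderivField i X) = 0

namespace OrientedPatch

variable {U : Opens (EuclideanSpace ℝ (Fin 2))} (s : OrientedPatch U)

theorem norm_N (u : U) : ‖s.N u‖ = 1 := by
  have h := congrArg (fun f => SmoothScalar.toFun f u) s.inner_N_N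
  simp only [innerField_apply, SmoothScalar.one_apply, real_inner_self_eq_norm_sq] at h
  nlinarith [norm_nonneg (s.N u)]

theorem inner_X_N (i : Fin 2) : ⟪𝐃 i s.X, s.N⟫ = 0 := by rw [innerField_comm, s.inner_N_X]

theorem eq_zero {ψ : SmoothField U E3} (h : ∀ i, ⟪ψ, 𝐃 i s.X⟫ = 0) (hN : ⟪ψ, s.N⟫ = 0) :
    ψ = 0 := by
  refine SmoothField.ext fun u => ?_
  have e : ∀ {f g : SmoothField U E3}, ⟪f, g⟫ = 0 → inner ℝ (f u) (g u) = 0 := by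
    intro f g hfg
    rw [← innerField_apply, hfg]; rfl
  exact eq_zero_of_inner_frame (s.linearIndependent u) (s.norm_N u) (e (s.inner_N_X 0))
    (e (s.inner_N_X 1)) (e (h 0)) (e (h 1)) (e hN)

theorem eq_of_inner {φ ψ : SmoothField U E3} (h : ∀ i, ⟪φ, 𝐃 i s.X⟫ = ⟪ψ, 𝐃 i s.X⟫)
    (hN : ⟪φ, s.N⟫ = ⟪ψ, s.N⟫) : φ = ψ := by
  rw [← sub_eq_zero]
  exact s.eq_zero (fun i => by simp [h i]) (by simp [hN])

theorem isUnit_det_gram : IsUnit (gram s.X).det := by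
  refine SmoothScalar.isUnit_of_ne_zero fun u h => ?_
  have hli := s.linearIndependent u
  set a := 𝐃 0 s.X u
  set b := 𝐃 1 s.X u
  simp only [Matrix.det_fin_two, gram_apply, SmoothScalar.sub_apply, SmoothScalar.mul_apply,
    innerField_apply] at h
  change inner ℝ a a * inner ℝ b b - inner ℝ a b * inner ℝ b a = 0 at h
  -- This vector is |a|² times the part of b orthogonal to a, and its squared length is |a|² times
  -- the Gram determinant.
  have hz : inner ℝ (inner ℝ a a • b - inner ℝ a b • a) (inner ℝ a a • b - inner ℝ a b • a)
      = (0 : ℝ) := by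
    simp only [inner_sub_left, inner_sub_right, inner_smul_left, inner_smul_right,
      RCLike.conj_to_real, real_inner_comm a b] at h ⊢
    linear_combination (inner ℝ a a) * h
  rw [inner_self_eq_zero] at hz
  have hli' := LinearIndependent.pair_iff.1 hli (-inner ℝ a b) (inner ℝ a a)
    (by rw [← hz]; module)
  rw [inner_self_eq_zero] at hli'
  exact hli.ne_zero 0 hli'.2

/-- The inverse of the first fundamental form. -/
def J : Matrix (Fin 2) (Fin 2) (SmoothScalar U) := (gram s.X)⁻¹

/-- The second fundamental form. -/
def II : Matrix (Fin 2) (Fin 2) (SmoothScalar U) := .of fun i j => ⟪𝐃 i (𝐃 j s.X), s.N⟫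

/-- The shape operator. -/
def S : Matrix (Fin 2) (Fin 2) (SmoothScalar U) := s.J * s.II

/-- The trace of the shape operator. -/
def h : SmoothScalar U := s.S 0 0 + s.S 1 1

/-- The Gauss curvature. -/
def K : SmoothScalar U := s.S 0 0 * s.S 1 1 - s.S 0 1 * s.S 1 0

theorem II_symm (i j : Fin 2) : s.II i j = s.II j i := by
  simp only [II, Matrix.of_apply, pderivField_comm i j]

theorem J_symm (i j : Fin 2) : s.J i j = s.J j i :=
  (gram_isSymm s.X).inv.apply j i

theorem gram_symm (i j : Fin 2) : gram s.X i j = gram s.X j i := (gram_isSymm s.X).apply j i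

theorem gram_mul_J : gram s.X * s.J = 1 := Matrix.mul_nonsing_inv _ s.isUnit_det_gram

theorem J_mul_gram : s.J * gram s.X = 1 := Matrix.nonsing_inv_mul _ s.isUnit_det_gram

theorem gram_mul_S : gram s.X * s.S = s.II := by
  rw [S, ← Matrix.mul_assoc, gram_mul_J, Matrix.one_mul]

theorem inner_DN_N (i : Fin 2) : ⟪𝐃 i s.N, s.N⟫ = 0 := by
  have h := congrArg (𝐝 i) s.inner_N_N
  rw [pderiv_innerField, innerField_comm s.N, Derivation.map_one_eq_zero] at h
  have h2 : (2 : SmoothScalar U) * ⟪𝐃 i s.N, s.N⟫ = 0 := by rw [two_mul, h]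
  ext u
  have := congrArg (fun f => SmoothScalar.toFun f u) h2
  simpa using this

theorem inner_DN_DX (i j : Fin 2) : ⟪𝐃 i s.N, 𝐃 j s.X⟫ = -s.II i j := by
  have h := congrArg (𝐝 i) (s.inner_N_X j)
  rw [pderiv_innerField, map_zero, innerField_comm s.N] at h
  exact eq_neg_of_add_eq_zero_left h

/-- The Weingarten equations. -/
theorem DN_eq (i : Fin 2) : 𝐃 i s.N = -∑ l, s.S l i • 𝐃 l s.X := by
  refine s.eq_of_inner (fun k => ?_) ?_
  · rw [inner_DN_DX, ← gram_mul_S, s.gram_mul_S, s.II_symm, ← s.gram_mul_S, Matrix.mul_apply]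
    simp only [map_neg, map_sum, map_smul, LinearMap.neg_apply, LinearMap.sum_apply,
      LinearMap.smul_apply, smul_eq_mul, ← gram_apply]
    congr 1
    exact Finset.sum_congr rfl fun l _ => by rw [s.gram_symm, mul_comm]
  · simp [inner_DN_N, inner_X_N]

/-- The covariant derivative of the second fundamental form. -/
def C (i j k : Fin 2) : SmoothScalar U := ⟪𝐃 i (𝐃 j s.X), 𝐃 k s.N⟫ - ⟪𝐃 i (𝐃 j s.N), 𝐃 k s.X⟫

/-- Derivative of the symmetry of the second fundamental form. As `C` is visibly symmetric in its
first two indices, it is totally symmetric: the Codazzi equation. -/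
theorem C_symm_right (i j k : Fin 2) : s.C i j k = s.C i k j := by
  have h : ⟪𝐃 j s.N, 𝐃 k s.X⟫ = ⟪𝐃 k s.N, 𝐃 j s.X⟫ := by
    rw [inner_DN_DX, inner_DN_DX, II_symm]
  have h' := congrArg (𝐝 i) h
  simp only [pderiv_innerField] at h'
  simp only [C, innerField_comm (𝐃 i (𝐃 _ s.X))]
  linear_combination -h'

/-- The Codazzi symmetry moves the differentiation onto the last index, so that ∂ₖS appears and the
traces over i and j below become derivatives of invariants of `S`. -/
theorem C_eq (i j k : Fin 2) : s.C i j k =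
    -∑ l, s.S l j * ⟪𝐃 i (𝐃 k s.X), 𝐃 l s.X⟫ + ∑ l, 𝐝 k (s.S l i) * gram s.X l j +
      ∑ l, s.S l i * ⟪𝐃 l (𝐃 k s.X), 𝐃 j s.X⟫ := by
  rw [C_symm_right, C, s.DN_eq j, pderivField_comm i k s.N, s.DN_eq i]
  simp only [map_neg, map_sum, map_smul, pderivField_smul, map_add, LinearMap.neg_apply,
    LinearMap.sum_apply, LinearMap.smul_apply, LinearMap.add_apply, smul_eq_mul, ← gram_apply,
    Finset.sum_add_distrib, pderivField_comm k]
  ring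

theorem SJ_symm (i j : Fin 2) : (s.S * s.J) i j = (s.S * s.J) j i := by
  have h : (s.S * s.J).transpose = s.S * s.J := by
    have h1 : s.J.transpose = s.J := (gram_isSymm s.X).inv
    have h2 : s.II.transpose = s.II := Matrix.ext fun i j => s.II_symm j i
    rw [S, Matrix.transpose_mul, Matrix.transpose_mul, h1, h2, Matrix.mul_assoc]
  exact congrFun (congrFun h j) i

theorem J_gram_apply (i j : Fin 2) :
    s.J i 0 * gram s.X 0 j + s.J i 1 * gram s.X 1 j = if i = j then 1 else 0 := by
  have h := congrFun (congrFun s.J_mul_gram i) j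
  rwa [Matrix.mul_apply, Fin.sum_univ_two, Matrix.one_apply] at h

/-- The trace of ∇ₖS is the derivative of tr S; the remaining connection terms cancel because `S *
J` is symmetric. -/
theorem sum_J_C (k : Fin 2) : ∑ i, ∑ j, s.J i j * s.C i j k = 𝐝 k s.h := by
  have e1 := s.SJ_symm 0 1
  have j00 := s.J_gram_apply 0 0
  have j01 := s.J_gram_apply 0 1
  have j10 := s.J_gram_apply 1 0
  have j11 := s.J_gram_apply 1 1
  simp only [Matrix.mul_apply, Fin.sum_univ_two] at e1
  simp only [Fin.sum_univ_two, C_eq, h, map_add, if_true, if_false, zero_ne_one,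
    one_ne_zero, s.J_symm 1 0, s.gram_symm 1 0] at *
  linear_combination (𝐝 k (s.S 0 0)) * j00 + (𝐝 k (s.S 1 0)) * j01 + (𝐝 k (s.S 0 1)) * j10 +
    (𝐝 k (s.S 1 1)) * j11 +
    (⟪𝐃 0 (𝐃 k s.X), 𝐃 1 s.X⟫ - ⟪𝐃 1 (𝐃 k s.X), 𝐃 0 s.X⟫) * e1

/-- tr(S ∇ₖS) is half the derivative of tr S² = h² - 2K. -/
theorem sum_SJ_C (k : Fin 2) :
    ∑ i, ∑ j, (s.S * s.J) i j * s.C i j k = s.h * 𝐝 k s.h - 𝐝 k s.K := by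
  have e1 := s.SJ_symm 0 1
  have j00 := s.J_gram_apply 0 0
  have j01 := s.J_gram_apply 0 1
  have j10 := s.J_gram_apply 1 0
  have j11 := s.J_gram_apply 1 1
  simp only [Matrix.mul_apply, Fin.sum_univ_two, C_eq, h, K, map_add, map_sub, if_true, if_false,
    zero_ne_one, one_ne_zero, s.J_symm 1 0, s.gram_symm 1 0, Derivation.leibniz, smul_eq_mul] at *
  linear_combination (𝐝 k (s.S 0 0) * s.S 0 0 + 𝐝 k (s.S 0 1) * s.S 1 0) * j00 +
    (𝐝 k (s.S 1 0) * s.S 0 0 + 𝐝 k (s.S 1 1) * s.S 1 0) * j01 +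
    (𝐝 k (s.S 0 0) * s.S 0 1 + 𝐝 k (s.S 0 1) * s.S 1 1) * j10 +
    (𝐝 k (s.S 1 0) * s.S 0 1 + 𝐝 k (s.S 1 1) * s.S 1 1) * j11 +
    (s.S 0 0 * ⟪𝐃 0 (𝐃 k s.X), 𝐃 1 s.X⟫ + s.S 1 0 * ⟪𝐃 1 (𝐃 k s.X), 𝐃 1 s.X⟫ -
      s.S 0 1 * ⟪𝐃 0 (𝐃 k s.X), 𝐃 0 s.X⟫ - s.S 1 1 * ⟪𝐃 1 (𝐃 k s.X), 𝐃 0 s.X⟫) * e1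

end OrientedPatch

end

/-! ### The product U × ℝ and the inverse of the metric I(1 + t²S²) + dt². -/

section

/-- The projection `(u₁, u₂, t) ↦ (u₁, u₂)`. -/
def planeProj : EuclideanSpace ℝ (Fin 3) →L[ℝ] EuclideanSpace ℝ (Fin 2) :=
  LinearMap.toContinuousLinearMap
    { toFun := fun y => !₂[y 0, y 1]
      map_add' := fun y z => by ext i; fin_cases i <;> rfl
      map_smul' := fun c y => by ext i; fin_cases i <;> rfl }

/-- The inclusion `(u₁, u₂) ↦ (u₁, u₂, 0)`. -/
def planeIncl : EuclideanSpace ℝ (Fin 2) →L[ℝ] EuclideanSpace ℝ (Fin 3) :=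
  LinearMap.toContinuousLinearMap
    { toFun := fun u => !₂[u 0, u 1, 0]
      map_add' := fun y z => by ext i; fin_cases i <;> simp
      map_smul' := fun c y => by ext i; fin_cases i <;> simp }

theorem planeProj_apply (y : EuclideanSpace ℝ (Fin 3)) : planeProj y = !₂[y 0, y 1] := rfl

theorem planeProj_planeIncl (u : EuclideanSpace ℝ (Fin 2)) : planeProj (planeIncl u) = u := by
  ext i; fin_cases i <;> rfl

theorem planeProj_single_castSucc (i : Fin 2) :
    planeProj (EuclideanSpace.single i.castSucc 1) = EuclideanSpace.single i 1 := by
  ext j; fin_cases i <;> fin_cases j <;> simp [planeProj_apply]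

theorem planeProj_single_two : planeProj (EuclideanSpace.single 2 1) = 0 := by
  ext j; fin_cases j <;> simp [planeProj_apply]

theorem planeIncl_single (i : Fin 2) :
    planeIncl (EuclideanSpace.single i 1) = EuclideanSpace.single i.castSucc 1 := by
  ext j; fin_cases i <;> fin_cases j <;> simp [planeIncl]

variable {E : Type*} [NormedAddCommGroup E] [InnerProductSpace ℝ E]

section Cylinder

variable (U : Opens (EuclideanSpace ℝ (Fin 2)))

/-- The cylinder `U × ℝ`. -/
def cylinder : Opens (EuclideanSpace ℝ (Fin 3)) :=
  ⟨planeProj ⁻¹' U, U.isOpen.preimage planeProj.continuous⟩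

variable {U}

theorem mem_cylinder {y : EuclideanSpace ℝ (Fin 3)} : y ∈ cylinder U ↔ planeProj y ∈ U := Iff.rfl

theorem planeIncl_mem_cylinder {u : EuclideanSpace ℝ (Fin 2)} (hu : u ∈ U) :
    planeIncl u ∈ cylinder U := by rwa [mem_cylinder, planeProj_planeIncl]

/-- A function on `U`, viewed as a function on `U × ℝ`. -/
def lift : SmoothScalar U →+* SmoothScalar (cylinder U) := pullback planeProj fun _ => mem_cylinder.1

/-- A vector-valued function on `U`, viewed as a function on `U × ℝ`. -/
def liftField : SmoothField U E →+ SmoothField (cylinder U) E :=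
  pullbackField planeProj fun _ => mem_cylinder.1

/-- The restriction of a function on `U × ℝ` to `U × {0}`. -/
def slice : SmoothScalar (cylinder U) →+* SmoothScalar U :=
  pullback planeIncl fun _ => planeIncl_mem_cylinder

/-- The restriction of a vector-valued function on `U × ℝ` to `U × {0}`. -/
def sliceField : SmoothField (cylinder U) E →+ SmoothField U E :=
  pullbackField planeIncl fun _ => planeIncl_mem_cylinder

@[simp] theorem slice_lift (f : SmoothScalar U) : slice (lift f) = f := by
  ext u
  rw [slice, pullback_apply, lift, pullback_apply]
  exact congrArg f.toFun (Subtype.ext (planeProj_planeIncl _))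

@[simp] theorem sliceField_liftField (f : SmoothField U E) : sliceField (liftField f) = f :=
  SmoothField.ext fun u => by
    rw [sliceField, pullbackField_apply, liftField, pullbackField_apply]
    exact congrArg f.toFun (Subtype.ext (planeProj_planeIncl _))

theorem lift_apply (f : SmoothScalar U) (w : cylinder U) : lift f w = f ⟨planeProj w, w.2⟩ :=
  pullback_apply _ _ _ _

theorem liftField_apply (f : SmoothField U E) (w : cylinder U) :
    liftField f w = f ⟨planeProj w, w.2⟩ :=
  pullbackField_apply _ _ _ _

theorem lift_inner (φ ψ : SmoothField U E) : lift ⟪φ, ψ⟫ = ⟪liftField φ, liftField ψ⟫ :=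
  pullback_innerField _ _ _ _

@[simp] theorem slice_inner (φ ψ : SmoothField (cylinder U) E) :
    slice ⟪φ, ψ⟫ = ⟪sliceField φ, sliceField ψ⟫ :=
  pullback_innerField _ _ _ _

@[simp] theorem sliceField_smul (f : SmoothScalar (cylinder U)) (ψ : SmoothField (cylinder U) E) :
    sliceField (f • ψ) = slice f • sliceField ψ :=
  pullbackField_smul _ _ _ _

@[simp] theorem pderiv_lift (i : Fin 2) (f : SmoothScalar U) :
    𝐝 i.castSucc (lift f) = lift (𝐝 i f) :=
  pderiv_pullback _ _ (planeProj_single_castSucc i) f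

@[simp] theorem pderivField_liftField (i : Fin 2) (f : SmoothField U E) :
    𝐃 i.castSucc (liftField f) = liftField (𝐃 i f) :=
  pderivField_pullbackField _ _ (planeProj_single_castSucc i) f

@[simp] theorem pderivField_two_liftField (f : SmoothField U E) : 𝐃 2 (liftField f) = 0 :=
  pderivField_pullbackField_of_apply_eq_zero _ _ planeProj_single_two f

@[simp] theorem slice_pderiv (i : Fin 2) (f : SmoothScalar (cylinder U)) :
    slice (𝐝 i.castSucc f) = 𝐝 i (slice f) :=
  (pderiv_pullback _ _ (planeIncl_single i) f).symm

@[simp] theorem sliceField_pderivField (i : Fin 2) (f : SmoothField (cylinder U) E) :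
    sliceField (𝐃 i.castSucc f) = 𝐃 i (sliceField f) :=
  (pderivField_pullbackField _ _ (planeIncl_single i) f).symm

variable (U) in
/-- The fibre coordinate on `U × ℝ`. -/
def fibreCoord : SmoothScalar (cylinder U) :=
  .of (fun y => y 2) (EuclideanSpace.proj (𝕜 := ℝ) (2 : Fin 3)).contDiff.contDiffOn

theorem fibreCoord_apply (w : cylinder U) : fibreCoord U w = w.1 2 := rfl

theorem pderiv_fibreCoord (a : Fin 3) : 𝐝 a (fibreCoord U) = if a = 2 then 1 else 0 := by
  ext w
  rw [pderiv_eq_partialD a (g := EuclideanSpace.proj (𝕜 := ℝ) (2 : Fin 3)) (fun w => rfl)]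
  rw [partialD, ContinuousLinearMap.fderiv]
  fin_cases a <;> simp

@[simp] theorem pderiv_castSucc_fibreCoord (i : Fin 2) : 𝐝 i.castSucc (fibreCoord U) = 0 := by
  rw [pderiv_fibreCoord, if_neg]; fin_cases i <;> decide

@[simp] theorem pderiv_two_fibreCoord : 𝐝 2 (fibreCoord U) = 1 := by
  rw [pderiv_fibreCoord, if_pos rfl]

@[simp] theorem slice_fibreCoord : slice (fibreCoord U) = 0 := by
  ext u
  rw [slice, pullback_apply, fibreCoord_apply]
  rfl

/-- The fibre coordinate is not a unit, but it is not a zero divisor either: on the zero section the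
t-derivative of t f is f. This makes comparison of powers of t possible. -/
theorem eq_zero_of_fibreCoord_mul {f : SmoothScalar (cylinder U)} (h : fibreCoord U * f = 0) :
    f = 0 := by
  have h' := congrArg (𝐝 2) h
  rw [Derivation.leibniz, pderiv_two_fibreCoord, map_zero] at h'
  ext w
  have e := congrArg (fun f => SmoothScalar.toFun f w) h
  have e' := congrArg (fun f => SmoothScalar.toFun f w) h'
  simp only [SmoothScalar.mul_apply, SmoothScalar.zero_apply, smul_eq_mul, mul_one,
    SmoothScalar.add_apply] at e e' ⊢
  rcases mul_eq_zero.1 e with ht | hf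
  · rwa [ht, zero_mul, zero_add] at e'
  · exact hf

end Cylinder

namespace OrientedPatch

variable {U : Opens (EuclideanSpace ℝ (Fin 2))} (s : OrientedPatch U)

theorem gram_mul_S_symm (i j : Fin 2) : (gram s.X * s.S) i j = (gram s.X * s.S) j i := by
  rw [gram_mul_S, II_symm]

theorem inner_DN_DN (i j : Fin 2) : ⟪𝐃 i s.N, 𝐃 j s.N⟫ = (gram s.X * s.S * s.S) i j := by
  rw [s.DN_eq j, gram_mul_S, Matrix.mul_apply]
  simp only [map_neg, map_sum, map_smul, inner_DN_DX, smul_eq_mul]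
  rw [← Finset.sum_neg_distrib]
  exact Finset.sum_congr rfl fun l _ => by ring

/-- The shape operator is self-adjoint for a positive definite metric, so its discriminant h² - 4K
is nonnegative and vanishes only when it is scalar. -/
theorem four_mul_K_le (u : U) : 4 * s.K u ≤ s.h u ^ 2 ∧
    (4 * s.K u = s.h u ^ 2 → s.S 0 1 u = 0 ∧ s.S 1 0 u = 0 ∧ s.S 0 0 u = s.S 1 1 u) := by
  have hsymm := congrArg (fun f => SmoothScalar.toFun f u) (s.gram_mul_S_symm 0 1)
  have hdet := SmoothScalar.ne_zero_of_isUnit s.isUnit_det_gram u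
  have hI0 : 0 ≤ gram s.X 0 0 u := by
    rw [gram_apply, innerField_apply]; exact real_inner_self_nonneg
  have hI1 : gram s.X 0 1 u ^ 2 ≤ gram s.X 0 0 u * gram s.X 1 1 u := by
    simp only [gram_apply, innerField_apply]
    have := real_inner_mul_inner_self_le (𝐃 0 s.X u) (𝐃 1 s.X u)
    nlinarith
  simp only [Matrix.det_fin_two, s.gram_symm 1 0, Matrix.mul_apply, Fin.sum_univ_two, h, K,
    SmoothScalar.add_apply, SmoothScalar.sub_apply, SmoothScalar.mul_apply] at *
  generalize gram s.X 0 0 u = e at *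
  generalize gram s.X 0 1 u = f at *
  generalize gram s.X 1 1 u = g at *
  generalize s.S 0 0 u = a at *
  generalize s.S 0 1 u = b at *
  generalize s.S 1 0 u = c at *
  generalize s.S 1 1 u = d at *
  have he : 0 < e := lt_of_le_of_ne hI0 fun h0 => hdet (by subst h0; nlinarith)
  have hD : 0 < e * g - f ^ 2 := lt_of_le_of_ne (by linarith) fun h0 => hdet (by linarith)
  -- Self-adjointness eliminates b, and e² times the discriminant becomes a sum of two terms that
  -- are nonnegative by positivity of the metric.
  have key : e ^ 2 * ((a + d) ^ 2 - 4 * (a * d - b * c)) =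
      (e * (a - d) + 2 * f * c) ^ 2 + 4 * (e * g - f ^ 2) * c ^ 2 := by
    linear_combination (4 * c * e) * hsymm
  have he2 : 0 < e ^ 2 := by positivity
  constructor
  · have : 0 ≤ e ^ 2 * ((a + d) ^ 2 - 4 * (a * d - b * c)) := by rw [key]; positivity
    linarith [nonneg_of_mul_nonneg_right this he2]
  · intro h0
    rw [h0, sub_self, mul_zero] at key
    have h1 : 0 ≤ 4 * (e * g - f ^ 2) * c ^ 2 := by positivity
    have h2 : 4 * (e * g - f ^ 2) * c ^ 2 = 0 := by nlinarith [sq_nonneg (e * (a - d) + 2 * f * c)]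
    have hc : c = 0 := by simpa [hD.ne'] using h2
    subst hc
    have h3 : a - d = 0 := by
      have : (e * (a - d)) ^ 2 = 0 := by nlinarith
      simpa [he.ne'] using this
    have had : a = d := by linarith
    subst had
    refine ⟨?_, rfl, rfl⟩
    have : e * b = 0 := by linarith
    simpa [he.ne'] using this

/-- The ratio of the determinants of the metrics of the normal bundle and the surface. -/
def detRatio : SmoothScalar (cylinder U) :=
  (1 - fibreCoord U ^ 2 * lift s.K) ^ 2 + fibreCoord U ^ 2 * lift s.h ^ 2

/-- A zero would require th = 0 and t²K = 1, hence h = 0 < K, against 4K ≤ h². -/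
theorem isUnit_detRatio : IsUnit s.detRatio := by
  refine SmoothScalar.isUnit_of_ne_zero fun w h0 => ?_
  have hK := (s.four_mul_K_le ⟨planeProj w, w.2⟩).1
  simp only [detRatio, SmoothScalar.add_apply, SmoothScalar.sub_apply, SmoothScalar.mul_apply,
    SmoothScalar.pow_apply, SmoothScalar.one_apply, lift_apply] at h0
  generalize fibreCoord U w = t at *
  generalize s.K ⟨planeProj w, w.2⟩ = k at *
  generalize s.h ⟨planeProj w, w.2⟩ = a at *
  have h1 : (t * a) ^ 2 = 0 := by nlinarith [sq_nonneg (1 - t ^ 2 * k), sq_nonneg (t * a)]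
  have h2 : (1 - t ^ 2 * k) ^ 2 = 0 := by nlinarith
  have h3 : t ^ 2 * k = 1 := by
    have := pow_eq_zero_iff (two_ne_zero) |>.1 h2
    linarith
  nlinarith [sq_nonneg t]

/-- The inverse of `detRatio`. -/
def detRatioInv : SmoothScalar (cylinder U) := (s.isUnit_detRatio.unit⁻¹ : (SmoothScalar _)ˣ)

theorem detRatio_mul_inv : s.detRatio * s.detRatioInv = 1 := s.isUnit_detRatio.mul_val_inv

/-- The horizontal block of the inverse metric of the normal bundle. -/
def γ (i j : Fin 2) : SmoothScalar (cylinder U) :=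
  s.detRatioInv * ((1 - fibreCoord U ^ 2 * lift s.K + fibreCoord U ^ 2 * lift s.h ^ 2) *
    lift (s.J i j) - fibreCoord U ^ 2 * lift s.h * lift ((s.S * s.J) i j))

theorem γ_symm (i j : Fin 2) : s.γ i j = s.γ j i := by
  rw [γ, γ, s.J_symm, s.SJ_symm]

/-- Cayley-Hamilton for the shape operator. -/
theorem S_mul_S_apply (i j : Fin 2) :
    (s.S * s.S) i j = s.h * s.S i j - s.K * (1 : Matrix (Fin 2) (Fin 2) (SmoothScalar U)) i j := by
  fin_cases i <;> fin_cases j <;> simp [Matrix.mul_apply, h, K] <;> ring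

/-- The horizontal block of the metric of the normal bundle. -/
def G (i j : Fin 2) : SmoothScalar (cylinder U) :=
  lift (gram s.X i j) + fibreCoord U ^ 2 * lift ((gram s.X * s.S * s.S) i j)

/-- By Cayley-Hamilton 1 + t²S² = α + βS with α = 1 - t²K and β = t²h. Its adjugate is (α + βh) - βS
and its determinant is `detRatio`; this is the form of `γ`. -/
theorem sum_G_γ (i j : Fin 2) : s.G i 0 * s.γ 0 j + s.G i 1 * s.γ 1 j = if i = j then 1 else 0 := by
  have e1 : ∀ i j, (gram s.X * s.S * s.S) i j = s.h * s.II i j - s.K * gram s.X i j := by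
    intro i j
    rw [Matrix.mul_assoc, Matrix.mul_apply]
    simp only [S_mul_S_apply, ← s.gram_mul_S]
    fin_cases i <;> fin_cases j <;> simp [Matrix.mul_apply, Matrix.one_apply] <;> ring
  have m1 : ∀ i j, gram s.X i 0 * s.J 0 j + gram s.X i 1 * s.J 1 j = if i = j then 1 else 0 := by
    intro i j
    have h := congrFun (congrFun s.gram_mul_J i) j
    rwa [Matrix.mul_apply, Fin.sum_univ_two, Matrix.one_apply] at h
  have m2 : ∀ i j, gram s.X i 0 * (s.S * s.J) 0 j + gram s.X i 1 * (s.S * s.J) 1 j =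
      (s.II * s.J) i j := by
    intro i j
    rw [← s.gram_mul_S, Matrix.mul_assoc, Matrix.mul_apply (M := gram s.X), Fin.sum_univ_two]
  have m3 : ∀ i j, s.II i 0 * s.J 0 j + s.II i 1 * s.J 1 j = (s.II * s.J) i j := by
    intro i j
    rw [Matrix.mul_apply, Fin.sum_univ_two]
  have m4 : ∀ i j, s.II i 0 * (s.S * s.J) 0 j + s.II i 1 * (s.S * s.J) 1 j =
      s.h * (s.II * s.J) i j - s.K * if i = j then 1 else 0 := by
    intro i j
    have : s.II * (s.S * s.J) = gram s.X * (s.S * s.S) * s.J := by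
      rw [← s.gram_mul_S]; simp only [Matrix.mul_assoc]
    rw [← Fin.sum_univ_two (f := fun l => s.II i l * (s.S * s.J) l j), ← Matrix.mul_apply, this,
      ← Matrix.mul_assoc, Matrix.mul_apply, Fin.sum_univ_two]
    simp only [e1]
    linear_combination s.h * m3 i j - s.K * m1 i j
  have l1 := congrArg lift (m1 i j)
  have l2 := congrArg lift (m2 i j)
  have l3 := congrArg lift (m3 i j)
  have l4 := congrArg lift (m4 i j)
  have hD := s.detRatio_mul_inv
  have hif : (lift (if i = j then (1 : SmoothScalar U) else 0)) = if i = j then 1 else 0 := by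
    split_ifs <;> simp
  simp only [map_add, map_mul, map_sub, hif] at l1 l2 l3 l4
  simp only [G, γ, e1, map_sub, map_mul]
  rw [detRatio] at hD
  set t := fibreCoord U
  set d : SmoothScalar (cylinder U) := if i = j then 1 else 0
  linear_combination (s.detRatioInv * (1 - t ^ 2 * lift s.K) *
      (1 - t ^ 2 * lift s.K + t ^ 2 * lift s.h ^ 2)) * l1 -
    (s.detRatioInv * (1 - t ^ 2 * lift s.K) * (t ^ 2 * lift s.h)) * l2 +
    (s.detRatioInv * t ^ 2 * lift s.h * (1 - t ^ 2 * lift s.K + t ^ 2 * lift s.h ^ 2)) * l3 -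
    (s.detRatioInv * t ^ 2 * lift s.h * (t ^ 2 * lift s.h)) * l4 + d * hD

end OrientedPatch

end

/-! ### The natural immersion of the normal bundle and its tension field. -/

section

variable {E : Type*} [NormedAddCommGroup E] [InnerProductSpace ℝ E]

theorem innerField_prod {m : ℕ} {W : Opens (EuclideanSpace ℝ (Fin m))} (φ ψ : SmoothField W E6) :
    ⟪φ, ψ⟫ = ⟪mapField (WithLp.fstL 2 ℝ E3 E3) φ, mapField (WithLp.fstL 2 ℝ E3 E3) ψ⟫ +
      ⟪mapField (WithLp.sndL 2 ℝ E3 E3) φ, mapField (WithLp.sndL 2 ℝ E3 E3) ψ⟫ := by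
  ext w
  simp [innerField_apply, mapField_apply]

namespace OrientedPatch

variable {U : Opens (EuclideanSpace ℝ (Fin 2))} (s : OrientedPatch U)

local notation "t" => fibreCoord U

/-- The natural immersion `(u, t) ↦ (X u, t N u)` of the normal bundle. -/
def bundleMap : SmoothField (cylinder U) E6 :=
  .of (fun y => WithLp.toLp 2 (extendZero s.X (planeProj y), y 2 • extendZero s.N (planeProj y)))
    (WithLp.contDiff_toLp.comp_contDiffOn
      ((s.X.contDiffOn.comp planeProj.contDiff.contDiffOn fun _ h => mem_cylinder.1 h).prodMk
        ((EuclideanSpace.proj (𝕜 := ℝ) (2 : Fin 3)).contDiff.contDiffOn.smul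
          (s.N.contDiffOn.comp planeProj.contDiff.contDiffOn fun _ h => mem_cylinder.1 h))))

theorem bundleMap_fst : mapField (WithLp.fstL 2 ℝ E3 E3) s.bundleMap = liftField s.X :=
  SmoothField.ext fun w => by
    rw [mapField_apply, liftField_apply]
    simp [bundleMap, extendZero_of_mem _ (mem_cylinder.1 w.2)]

theorem bundleMap_snd : mapField (WithLp.sndL 2 ℝ E3 E3) s.bundleMap = t • liftField s.N :=
  SmoothField.ext fun w => by
    rw [mapField_apply, SmoothField.smul_apply, liftField_apply]
    simp [bundleMap, fibreCoord_apply, extendZero_of_mem _ (mem_cylinder.1 w.2)]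

theorem gram_bundleMap_castSucc (i j : Fin 2) :
    gram s.bundleMap i.castSucc j.castSucc = s.G i j := by
  rw [gram_apply, innerField_prod]
  simp only [← pderivField_mapField, bundleMap_fst, bundleMap_snd, pderivField_smul,
    pderivField_liftField, pderiv_castSucc_fibreCoord, zero_smul, zero_add, map_smul,
    LinearMap.smul_apply, smul_eq_mul, ← lift_inner, inner_DN_DN, G, gram_apply]
  ring

theorem gram_bundleMap_two (i : Fin 2) : gram s.bundleMap i.castSucc 2 = 0 := by
  rw [gram_apply, innerField_prod]
  simp only [← pderivField_mapField, bundleMap_fst, bundleMap_snd, pderivField_smul,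
    pderivField_liftField, pderiv_castSucc_fibreCoord, zero_smul, zero_add, map_smul,
    LinearMap.smul_apply, smul_eq_mul, ← lift_inner, inner_DN_N, pderivField_two_liftField,
    pderiv_two_fibreCoord, map_zero, one_smul, smul_zero, add_zero, mul_zero]

theorem gram_bundleMap_two_two : gram s.bundleMap 2 2 = 1 := by
  rw [gram_apply, innerField_prod]
  simp only [← pderivField_mapField, bundleMap_fst, bundleMap_snd, pderivField_smul,
    zero_add, ← lift_inner, inner_N_N, pderivField_two_liftField,
    pderiv_two_fibreCoord, map_zero, one_smul, smul_zero, add_zero, map_one]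

/-- The inverse metric of the normal bundle. -/
def gramInv : Matrix (Fin 3) (Fin 3) (SmoothScalar (cylinder U)) :=
  !![s.γ 0 0, s.γ 0 1, 0; s.γ 1 0, s.γ 1 1, 0; 0, 0, 1]

theorem gram_mul_gramInv : gram s.bundleMap * s.gramInv = 1 := by
  have e2 := fun i : Fin 2 => s.gram_bundleMap_two i
  have e3 : ∀ i : Fin 2, gram s.bundleMap 2 i.castSucc = 0 := fun i => by
    rw [(gram_isSymm s.bundleMap).apply, e2]
  have e : gram s.bundleMap = !![s.G 0 0, s.G 0 1, 0; s.G 1 0, s.G 1 1, 0; 0, 0, 1] := by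
    refine Matrix.ext fun i j => ?_
    fin_cases i <;> fin_cases j
    · exact s.gram_bundleMap_castSucc 0 0
    · exact s.gram_bundleMap_castSucc 0 1
    · exact e2 0
    · exact s.gram_bundleMap_castSucc 1 0
    · exact s.gram_bundleMap_castSucc 1 1
    · exact e2 1
    · exact e3 0
    · exact e3 1
    · exact s.gram_bundleMap_two_two
  have h := s.sum_G_γ
  have h00 := h 0 0
  have h01 := h 0 1
  have h10 := h 1 0
  have h11 := h 1 1
  simp only [if_true, if_false, zero_ne_one, one_ne_zero] at h00 h01 h10 h11
  rw [e, gramInv, Matrix.mul_fin_three, h00]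
  simp [h01, h10, h11, Matrix.one_fin_three]

theorem isUnit_det_gram_bundleMap : IsUnit (gram s.bundleMap).det := by
  refine IsUnit.of_mul_eq_one s.gramInv.det ?_
  rw [← Matrix.det_mul, gram_mul_gramInv, Matrix.det_one]

theorem gram_bundleMap_inv : (gram s.bundleMap)⁻¹ = s.gramInv :=
  Matrix.inv_eq_right_inv s.gram_mul_gramInv

theorem gramInv_isSymm : s.gramInv.IsSymm := by
  rw [← gram_bundleMap_inv]; exact (gram_isSymm _).inv

theorem sum_gramInv_smul {V : Type*} [AddCommGroup V] [Module (SmoothScalar (cylinder U)) V]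
    (A : Fin 3 → Fin 3 → V) : ∑ a, ∑ b, s.gramInv a b • A a b =
      ∑ i : Fin 2, ∑ j : Fin 2, s.γ i j • A i.castSucc j.castSucc + A 2 2 := by
  simp [gramInv, Fin.sum_univ_three, Fin.sum_univ_two]

theorem sum_gramInv_mul (A : Fin 3 → Fin 3 → SmoothScalar (cylinder U)) :
    ∑ a, ∑ b, s.gramInv a b * A a b =
      ∑ i : Fin 2, ∑ j : Fin 2, s.γ i j * A i.castSucc j.castSucc + A 2 2 :=
  s.sum_gramInv_smul A

/-- The Laplacian of the normal bundle on vector-valued functions. -/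
def lap (ψ : SmoothField (cylinder U) E) : SmoothField (cylinder U) E :=
  lapField s.gramInv (drift s.bundleMap) ψ

/-- The Laplacian of the normal bundle on functions. -/
def lapS (f : SmoothScalar (cylinder U)) : SmoothScalar (cylinder U) :=
  lapScalar s.gramInv (drift s.bundleMap) f

theorem lap_smul (f : SmoothScalar (cylinder U)) (ψ : SmoothField (cylinder U) E) :
    s.lap (f • ψ) = f • s.lap ψ + s.lapS f • ψ + (2 : SmoothScalar (cylinder U)) •
      (∑ i : Fin 2, ∑ j : Fin 2, (s.γ i j * 𝐝 i.castSucc f) • 𝐃 j.castSucc ψ + 𝐝 2 f • 𝐃 2 ψ) := by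
  rw [lap, lapField_smul s.gramInv_isSymm]
  simp only [mul_smul, s.sum_gramInv_smul]
  rfl

theorem lapS_inner (φ ψ : SmoothField (cylinder U) E) :
    s.lapS ⟪φ, ψ⟫ = ⟪s.lap φ, ψ⟫ + ⟪φ, s.lap ψ⟫ + 2 *
      (∑ i : Fin 2, ∑ j : Fin 2, s.γ i j * ⟪𝐃 i.castSucc φ, 𝐃 j.castSucc ψ⟫ + ⟪𝐃 2 φ, 𝐃 2 ψ⟫) := by
  rw [lapS, lapScalar_innerField s.gramInv_isSymm, s.sum_gramInv_mul]
  rfl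

theorem lapS_zero : s.lapS 0 = 0 := by simp [lapS, lapScalar]

theorem lapS_one : s.lapS 1 = 0 := by simp [lapS, lapScalar]

theorem lap_zero : s.lap (0 : SmoothField (cylinder U) E) = 0 := by simp [lap, lapField]

theorem lap_liftField (ψ : SmoothField U E) : s.lap (liftField ψ) =
    ∑ i : Fin 2, ∑ j : Fin 2, s.γ i j • liftField (𝐃 i (𝐃 j ψ)) -
      ∑ k : Fin 2, drift s.bundleMap k.castSucc • liftField (𝐃 k ψ) := by
  rw [lap, lapField, s.sum_gramInv_smul]
  congr 1
  · simp
  · simp [Fin.sum_univ_castSucc (n := 2), Fin.last]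

/-- The trace of the second fundamental form of the surface in the metric of the normal bundle. -/
def P : SmoothScalar (cylinder U) := ∑ i : Fin 2, ∑ j : Fin 2, s.γ i j * lift (s.II i j)

/-- The trace of `C` in the metric of the normal bundle. -/
def c (k : Fin 2) : SmoothScalar (cylinder U) :=
  ∑ i : Fin 2, ∑ j : Fin 2, s.γ i j * lift (s.C i j k)

/-- The trace of the third fundamental form of the surface in the metric of the normal bundle. -/
def trIII : SmoothScalar (cylinder U) :=
  ∑ i : Fin 2, ∑ j : Fin 2, s.γ i j * lift ⟪𝐃 i s.N, 𝐃 j s.N⟫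

/-- The vector field dual to `c`. -/
def y (l : Fin 2) : SmoothScalar (cylinder U) := ∑ k : Fin 2, s.γ l k * s.c k

/-- The image of `y` under the differential of `X`. -/
def Y : SmoothField (cylinder U) E3 := ∑ l : Fin 2, s.y l • liftField (𝐃 l s.X)

/-- The image of `y` under the differential of `N`. -/
def Z : SmoothField (cylinder U) E3 := ∑ l : Fin 2, s.y l • liftField (𝐃 l s.N)

local notation "X̂" => liftField (OrientedPatch.X s)
local notation "N̂" => liftField (OrientedPatch.N s)

theorem lift_inner_N_N : ⟪N̂, N̂⟫ = 1 := by rw [← lift_inner, inner_N_N, map_one]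

theorem lift_inner_DX_N (i : Fin 2) : ⟪liftField (𝐃 i s.X), N̂⟫ = 0 := by
  rw [← lift_inner, inner_X_N, map_zero]

theorem lift_inner_N_DX (i : Fin 2) : ⟪N̂, liftField (𝐃 i s.X)⟫ = 0 := by
  rw [← lift_inner, inner_N_X, map_zero]

theorem lift_inner_DN_N (i : Fin 2) : ⟪liftField (𝐃 i s.N), N̂⟫ = 0 := by
  rw [← lift_inner, inner_DN_N, map_zero]

theorem lift_inner_N_DN (i : Fin 2) : ⟪N̂, liftField (𝐃 i s.N)⟫ = 0 := by
  rw [innerField_comm, lift_inner_DN_N]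

theorem lift_inner_DN_DX (i j : Fin 2) :
    ⟪liftField (𝐃 i s.N), liftField (𝐃 j s.X)⟫ = -lift (s.II i j) := by
  rw [← lift_inner, inner_DN_DX, map_neg]

theorem lift_inner_DX_DN (i j : Fin 2) :
    ⟪liftField (𝐃 i s.X), liftField (𝐃 j s.N)⟫ = -lift (s.II i j) := by
  rw [innerField_comm, lift_inner_DN_DX, II_symm]

theorem lift_inner_DX_DX (i j : Fin 2) :
    ⟪liftField (𝐃 i s.X), liftField (𝐃 j s.X)⟫ = lift (gram s.X i j) := by
  rw [← lift_inner, gram_apply]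

theorem eq_zero_cylinder {ψ : SmoothField (cylinder U) E3}
    (h : ∀ i, ⟪ψ, liftField (𝐃 i s.X)⟫ = 0) (hN : ⟪ψ, N̂⟫ = 0) : ψ = 0 := by
  refine SmoothField.ext fun w => ?_
  have e : ∀ {f g : SmoothField (cylinder U) E3}, ⟪f, g⟫ = 0 → inner ℝ (f w) (g w) = 0 := by
    intro f g hfg
    rw [← innerField_apply, hfg]; rfl
  have e0 := e (s.lift_inner_N_DX 0)
  have e1 := e (s.lift_inner_N_DX 1)
  have e2 := e (h 0)
  have e3 := e (h 1)
  have e4 := e hN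
  simp only [liftField_apply] at e0 e1 e2 e3 e4
  exact eq_zero_of_inner_frame (s.linearIndependent ⟨planeProj w, w.2⟩) (s.norm_N _) e0 e1 e2 e3 e4

theorem tangent_expansion {ψ : SmoothField (cylinder U) E3} (hN : ⟪ψ, N̂⟫ = 0) :
    ψ = ∑ l : Fin 2, (∑ k : Fin 2, lift (s.J l k) * ⟪ψ, liftField (𝐃 k s.X)⟫) •
      liftField (𝐃 l s.X) := by
  rw [← sub_eq_zero]
  refine s.eq_zero_cylinder (fun i => ?_) ?_
  · have h0 := congrArg lift (s.J_gram_apply 0 i)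
    have h1 := congrArg lift (s.J_gram_apply 1 i)
    simp only [map_sub, map_add, map_smul, LinearMap.sub_apply, LinearMap.add_apply,
      LinearMap.smul_apply, smul_eq_mul, lift_inner_DX_DX, Fin.sum_univ_two, s.J_symm 1 0]
    simp only [map_add, map_mul, s.J_symm 1 0] at h0 h1
    fin_cases i
    · simp at h0 h1 ⊢
      linear_combination -⟪ψ, liftField (𝐃 0 s.X)⟫ * h0 - ⟪ψ, liftField (𝐃 1 s.X)⟫ * h1
    · simp at h0 h1 ⊢
      linear_combination -⟪ψ, liftField (𝐃 0 s.X)⟫ * h0 - ⟪ψ, liftField (𝐃 1 s.X)⟫ * h1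
  · simp [hN, lift_inner_DX_N]

theorem lap_bundleMap_fst : mapField (WithLp.fstL 2 ℝ E3 E3) (s.lap s.bundleMap) = s.lap X̂ := by
  rw [lap, mapField_lapField, bundleMap_fst, lap]

theorem lap_bundleMap_snd :
    mapField (WithLp.sndL 2 ℝ E3 E3) (s.lap s.bundleMap) = s.lap (t • N̂) := by
  rw [lap, mapField_lapField, bundleMap_snd, lap]

theorem innerField_bundle_castSucc (ψ : SmoothField (cylinder U) E6) (k : Fin 2) :
    ⟪ψ, 𝐃 k.castSucc s.bundleMap⟫ =
      ⟪mapField (WithLp.fstL 2 ℝ E3 E3) ψ, liftField (𝐃 k s.X)⟫ +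
        t * ⟪mapField (WithLp.sndL 2 ℝ E3 E3) ψ, liftField (𝐃 k s.N)⟫ := by
  rw [innerField_prod]
  simp only [← pderivField_mapField, bundleMap_fst, bundleMap_snd, pderivField_smul,
    pderivField_liftField, pderiv_castSucc_fibreCoord, zero_smul, zero_add, map_smul, smul_eq_mul]

theorem innerField_bundle_two (ψ : SmoothField (cylinder U) E6) :
    ⟪ψ, 𝐃 2 s.bundleMap⟫ = ⟪mapField (WithLp.sndL 2 ℝ E3 E3) ψ, N̂⟫ := by
  rw [innerField_prod]
  simp only [← pderivField_mapField, bundleMap_fst, bundleMap_snd, pderivField_smul,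
    pderivField_two_liftField, pderiv_two_fibreCoord, map_zero, one_smul, smul_zero, add_zero,
    zero_add]

theorem innerField_lap_bundleMap (a : Fin 3) : ⟪s.lap s.bundleMap, 𝐃 a s.bundleMap⟫ = 0 := by
  have h := innerField_lapField_self s.bundleMap s.isUnit_det_gram_bundleMap a
  rwa [gram_bundleMap_inv] at h

theorem inner_lap_X_N : ⟪s.lap X̂, N̂⟫ = s.P := by
  simp only [lap_liftField, map_sub, map_sum, map_smul, LinearMap.sub_apply, LinearMap.sum_apply,
    LinearMap.smul_apply, smul_eq_mul, lift_inner_DX_N, mul_zero, Finset.sum_const_zero, sub_zero]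
  simp only [← lift_inner, P, II, Matrix.of_apply]

theorem eq_zero_of_two_mul {m : ℕ} {W : Opens (EuclideanSpace ℝ (Fin m))} {f : SmoothScalar W}
    (h : 2 * f = 0) : f = 0 := by
  ext w
  have := congrArg (fun f => SmoothScalar.toFun f w) h
  simpa using this

theorem inner_lap_N_N : ⟪s.lap N̂, N̂⟫ = -s.trIII := by
  have h := s.lapS_inner N̂ N̂
  rw [lift_inner_N_N, lapS_one, innerField_comm N̂] at h
  simp only [pderivField_liftField, pderivField_two_liftField, map_zero, add_zero,
    ← lift_inner] at h
  rw [eq_neg_iff_add_eq_zero]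
  refine eq_zero_of_two_mul ?_
  rw [trIII, h]; ring

theorem lap_fibreCoord_N : s.lap (t • N̂) = t • s.lap N̂ + s.lapS t • N̂ := by
  rw [lap_smul]
  simp

/-- The component along ∂ₜ of the fact that the tension field is normal; it replaces a computation
of Christoffel symbols. -/
theorem lapS_fibreCoord : s.lapS t = t * s.trIII := by
  have h := s.innerField_lap_bundleMap 2
  rw [innerField_bundle_two, lap_bundleMap_snd, lap_fibreCoord_N] at h
  simp only [map_add, map_smul, LinearMap.add_apply, LinearMap.smul_apply, smul_eq_mul,
    inner_lap_N_N, lift_inner_N_N] at h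
  linear_combination h

/-- The horizontal components of the fact that the tension field is normal. -/
theorem inner_lap_X_DX (k : Fin 2) :
    ⟪s.lap X̂, liftField (𝐃 k s.X)⟫ + t ^ 2 * ⟪s.lap N̂, liftField (𝐃 k s.N)⟫ = 0 := by
  have h := s.innerField_lap_bundleMap k.castSucc
  rw [innerField_bundle_castSucc, lap_bundleMap_fst, lap_bundleMap_snd, lap_fibreCoord_N] at h
  simp only [map_add, map_smul, LinearMap.add_apply, LinearMap.smul_apply, smul_eq_mul,
    lift_inner_N_DN] at h
  linear_combination h

/-- In the difference of the two inner products the unknown drift drops out, since ⟨∂ₗN, ∂ₖX⟩ =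
⟨∂ₗX, ∂ₖN⟩; the second-order terms are the trace of `C`. -/
theorem inner_lap_N_DX (k : Fin 2) :
    ⟪s.lap N̂, liftField (𝐃 k s.X)⟫ = ⟪s.lap X̂, liftField (𝐃 k s.N)⟫ - s.c k := by
  simp only [lap_liftField, map_sub, map_sum, map_smul, LinearMap.sub_apply, LinearMap.sum_apply,
    LinearMap.smul_apply, smul_eq_mul, lift_inner_DN_DX, lift_inner_DX_DN, c, C, mul_sub,
    lift_inner, Finset.sum_sub_distrib]
  ring

/-- The left side is the bundle metric applied to `y`, and `y` is `c` with its index raised by `γ`,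
the inverse of that metric. -/
theorem inner_Y_DX (k : Fin 2) :
    ⟪s.Y, liftField (𝐃 k s.X)⟫ + t ^ 2 * ⟪s.Z, liftField (𝐃 k s.N)⟫ = s.c k := by
  have h : ∑ l : Fin 2, s.y l * s.G l k = s.c k := by
    have h0 := s.sum_G_γ k 0
    have h1 := s.sum_G_γ k 1
    have hG : s.G 0 1 = s.G 1 0 := by
      simp only [G, ← inner_DN_DN, s.gram_symm 0 1, innerField_comm (𝐃 0 s.N)]
    simp only [y, Fin.sum_univ_two]
    fin_cases k
    · simp [s.γ_symm 1 0] at h0 h1 ⊢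
      linear_combination s.c 0 * h0 + s.c 1 * h1 + (-s.γ 0 1 * s.c 0 - s.γ 1 1 * s.c 1) * hG
    · simp [s.γ_symm 1 0] at h0 h1 ⊢
      linear_combination s.c 0 * h0 + s.c 1 * h1 + (s.γ 0 0 * s.c 0 + s.γ 0 1 * s.c 1) * hG
  rw [← h]
  simp only [Y, Z, map_add, map_smul, LinearMap.add_apply, LinearMap.smul_apply, smul_eq_mul,
    ← lift_inner, inner_DN_DN, G, Fin.sum_univ_two, gram_apply]
  ring

theorem inner_Z_DX (k : Fin 2) : ⟪s.Z, liftField (𝐃 k s.X)⟫ = ⟪s.Y, liftField (𝐃 k s.N)⟫ := by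
  simp only [Y, Z, map_sum, map_smul, LinearMap.sum_apply, LinearMap.smul_apply,
    lift_inner_DN_DX, lift_inner_DX_DN]

theorem inner_Y_N : ⟪s.Y, N̂⟫ = 0 := by simp [Y, lift_inner_DX_N]

theorem inner_Z_N : ⟪s.Z, N̂⟫ = 0 := by simp [Z, lift_inner_DN_N]

/-- The Laplacians of the components of the natural immersion of the normal bundle. -/
theorem lap_X_and_lap_N :
    s.lap X̂ = s.P • N̂ + t ^ 2 • s.Z ∧ s.lap N̂ = -s.Y - s.trIII • N̂ := by
  set φ := s.lap X̂ - (s.P • N̂ + t ^ 2 • s.Z) with hφ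
  set ψ := s.lap N̂ - (-s.Y - s.trIII • N̂) with hψ
  have φN : ⟪φ, N̂⟫ = 0 := by
    simp [hφ, inner_lap_X_N, lift_inner_N_N, inner_Z_N]
  have ψN : ⟪ψ, N̂⟫ = 0 := by
    simp [hψ, inner_lap_N_N, lift_inner_N_N, inner_Y_N]
  -- The claimed and the actual Laplacians satisfy the same linear equations, so their differences φ
  -- and ψ satisfy the homogeneous ones `r1` and `r2`.
  have r1 : ∀ k, ⟪φ, liftField (𝐃 k s.X)⟫ = -(t ^ 2 * ⟪ψ, liftField (𝐃 k s.N)⟫) := by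
    intro k
    have h1 := s.inner_lap_X_DX k
    simp only [hφ, hψ, map_sub, map_add, map_neg, map_smul, LinearMap.sub_apply, LinearMap.neg_apply,
      LinearMap.add_apply, LinearMap.smul_apply, smul_eq_mul, lift_inner_N_DX, lift_inner_N_DN,
      inner_Z_DX]
    linear_combination h1
  have r2 : ∀ k, ⟪ψ, liftField (𝐃 k s.X)⟫ = ⟪φ, liftField (𝐃 k s.N)⟫ := by
    intro k
    have h1 := s.inner_lap_N_DX k
    have h2 := s.inner_Y_DX k
    simp only [hφ, hψ, map_sub, map_add, map_neg, map_smul, LinearMap.sub_apply, LinearMap.neg_apply,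
      LinearMap.add_apply, LinearMap.smul_apply, smul_eq_mul, lift_inner_N_DX, lift_inner_N_DN]
    linear_combination h1 + h2
  obtain ⟨a, ha⟩ : ∃ a : Fin 2 → SmoothScalar (cylinder U),
      φ = ∑ l : Fin 2, a l • liftField (𝐃 l s.X) := ⟨_, s.tangent_expansion φN⟩
  obtain ⟨b, hb⟩ : ∃ b : Fin 2 → SmoothScalar (cylinder U),
      ψ = ∑ l : Fin 2, b l • liftField (𝐃 l s.X) := ⟨_, s.tangent_expansion ψN⟩
  have q1 : ⟪φ, φ⟫ = ∑ k : Fin 2, a k * ⟪φ, liftField (𝐃 k s.X)⟫ := by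
    nth_rw 2 [ha]; simp
  have q2 : ⟪ψ, ψ⟫ = ∑ k : Fin 2, b k * ⟪ψ, liftField (𝐃 k s.X)⟫ := by
    nth_rw 2 [hb]; simp
  -- If a and b are the tangential coordinates of φ and ψ, then `r1` and `r2` give |φ|² = t² II(a,
  -- b) and |ψ|² = -II(a, b).
  have q3 : ⟪φ, φ⟫ + t ^ 2 * ⟪ψ, ψ⟫ = 0 := by
    rw [q1, q2]
    simp only [r1, r2]
    rw [ha, hb]
    simp only [Fin.sum_univ_two, map_add, map_smul, LinearMap.add_apply, LinearMap.smul_apply,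
      smul_eq_mul, lift_inner_DX_DN, s.II_symm 1 0]
    ring
  have hφ0 : φ = 0 := SmoothField.ext fun w => by
    have h := congrArg (fun f => SmoothScalar.toFun f w) q3
    simp only [SmoothScalar.add_apply, SmoothScalar.mul_apply, SmoothScalar.pow_apply,
      innerField_apply, SmoothScalar.zero_apply] at h
    have h1 : 0 ≤ inner ℝ (φ w) (φ w) := real_inner_self_nonneg
    have h2 : 0 ≤ inner ℝ (ψ w) (ψ w) := real_inner_self_nonneg
    have h3 : inner ℝ (φ w) (φ w) = 0 := by nlinarith [sq_nonneg (t w)]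
    exact inner_self_eq_zero.1 h3
  -- On the zero section `q3` says nothing about ψ; there `r2` with φ = 0 is needed.
  have hψ0 : ψ = 0 := s.eq_zero_cylinder (fun k => by rw [r2, hφ0]; simp) ψN
  exact ⟨sub_eq_zero.1 hφ0, sub_eq_zero.1 hψ0⟩

end OrientedPatch

end

/-! ### The bitension field, the sufficient condition, and the equations on the zero section. -/

section

variable {E : Type*} [NormedAddCommGroup E] [InnerProductSpace ℝ E]

namespace OrientedPatch

variable {U : Opens (EuclideanSpace ℝ (Fin 2))} (s : OrientedPatch U)

local notation "t" => fibreCoord U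
local notation "X̂" => liftField (OrientedPatch.X s)
local notation "N̂" => liftField (OrientedPatch.N s)

theorem lap_t_smul (ψ : SmoothField (cylinder U) E) :
    s.lap (t • ψ) = t • s.lap ψ + (t * s.trIII) • ψ + (2 : SmoothScalar (cylinder U)) • 𝐃 2 ψ := by
  rw [lap_smul, lapS_fibreCoord]
  simp

theorem lap_t_sq_smul (ψ : SmoothField (cylinder U) E) :
    s.lap (t ^ 2 • ψ) = t ^ 2 • s.lap ψ + (2 + 2 * t ^ 2 * s.trIII) • ψ + (4 * t) • 𝐃 2 ψ := by
  rw [pow_two, mul_smul, lap_t_smul, lap_t_smul, pderivField_smul, pderiv_two_fibreCoord]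
  module

theorem D_two_t_sq_smul (ψ : SmoothField (cylinder U) E) :
    𝐃 2 (t ^ 2 • ψ) = (2 * t) • ψ + t ^ 2 • 𝐃 2 ψ := by
  rw [pow_two, pderivField_smul, Derivation.leibniz, pderiv_two_fibreCoord]
  simp only [smul_eq_mul, mul_one]
  module

theorem detRatio_mul_γ (i j : Fin 2) : s.detRatio * s.γ i j =
    (1 - t ^ 2 * lift s.K + t ^ 2 * lift s.h ^ 2) * lift (s.J i j) -
      t ^ 2 * lift s.h * lift ((s.S * s.J) i j) := by
  rw [γ, ← mul_assoc, detRatio_mul_inv, one_mul]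

theorem detRatio_mul_sum_γ (A : Fin 2 → Fin 2 → SmoothScalar U) :
    s.detRatio * ∑ i : Fin 2, ∑ j : Fin 2, s.γ i j * lift (A i j) =
      (1 - t ^ 2 * lift s.K + t ^ 2 * lift s.h ^ 2) * lift (∑ i, ∑ j, s.J i j * A i j) -
        t ^ 2 * lift s.h * lift (∑ i, ∑ j, (s.S * s.J) i j * A i j) := by
  have h00 := s.detRatio_mul_γ 0 0
  have h01 := s.detRatio_mul_γ 0 1
  have h10 := s.detRatio_mul_γ 1 0
  have h11 := s.detRatio_mul_γ 1 1
  simp only [Fin.sum_univ_two, map_add, map_mul]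
  linear_combination lift (A 0 0) * h00 + lift (A 0 1) * h01 + lift (A 1 0) * h10 +
    lift (A 1 1) * h11

/-- Shows that `c`, and with it the tangential fields `Y` and `Z`, depends only on dh and h dK. -/
theorem detRatio_mul_c (k : Fin 2) : s.detRatio * s.c k =
    (1 - t ^ 2 * lift s.K) * lift (𝐝 k s.h) + t ^ 2 * lift s.h * lift (𝐝 k s.K) := by
  rw [c, detRatio_mul_sum_γ s fun i j => s.C i j k]
  rw [sum_J_C, sum_SJ_C, map_sub, map_mul]
  ring

theorem sum_J_II : ∑ i, ∑ j, s.J i j * s.II i j = s.h := by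
  simp only [h, S, Matrix.mul_apply, Fin.sum_univ_two, s.II_symm 1 0]

theorem sum_SJ_II : ∑ i, ∑ j, (s.S * s.J) i j * s.II i j = s.h ^ 2 - 2 * s.K := by
  have h1 : ∀ i, ∑ j, (s.S * s.J) i j * s.II i j = (s.S * s.S) i i := by
    intro i
    nth_rw 3 [S]
    rw [← Matrix.mul_assoc, Matrix.mul_apply]
    exact Finset.sum_congr rfl fun j _ => by rw [s.II_symm]
  simp only [h1, S_mul_S_apply, Fin.sum_univ_two, Matrix.one_apply_eq]
  rw [h]; ring

theorem detRatio_mul_P : s.detRatio * s.P = lift s.h * (1 + t ^ 2 * lift s.K) := by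
  rw [P, detRatio_mul_sum_γ s fun i j => s.II i j, sum_J_II, sum_SJ_II]
  simp only [map_sub, map_pow, map_mul, map_ofNat]
  ring

theorem slice_detRatio : slice s.detRatio = 1 := by simp [detRatio]

theorem slice_detRatioInv : slice s.detRatioInv = 1 := by
  have h := congrArg slice s.detRatio_mul_inv
  rwa [map_mul, slice_detRatio, one_mul, map_one] at h

theorem slice_γ (i j : Fin 2) : slice (s.γ i j) = s.J i j := by
  simp [γ, slice_detRatioInv]

theorem slice_P : slice s.P = s.h := by
  simp only [P, map_sum, map_mul, slice_γ, slice_lift, sum_J_II]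

theorem slice_c (k : Fin 2) : slice (s.c k) = 𝐝 k s.h := by
  simp only [c, map_sum, map_mul, slice_γ, slice_lift, sum_J_C]

/-- The natural immersion of the normal bundle is tangentially biharmonic. -/
def IsTangentiallyBiharmonic : Prop :=
  ∀ a : Fin 3, ⟪s.lap (s.lap s.bundleMap), 𝐃 a s.bundleMap⟫ = 0

/-- The second component of the tension field is -t Y: its part along N cancels by
`lapS_fibreCoord`. -/
theorem lap_lap_snd : mapField (WithLp.sndL 2 ℝ E3 E3) (s.lap (s.lap s.bundleMap)) =
    -s.lap (t • s.Y) := by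
  rw [lap, mapField_lapField, ← lap, lap_bundleMap_snd, lap_fibreCoord_N, s.lap_X_and_lap_N.2,
    lapS_fibreCoord]
  have : t • (-s.Y - s.trIII • N̂) + (t * s.trIII) • N̂ = (-1 : SmoothScalar (cylinder U)) • t • s.Y
  · module
  rw [this, lap_smul]
  have h0 : s.lapS (-1) = 0 := by simp [lapS, lapScalar]
  simp [h0]

theorem lap_lap_fst : mapField (WithLp.fstL 2 ℝ E3 E3) (s.lap (s.lap s.bundleMap)) =
    s.lap (s.P • N̂) + s.lap (t ^ 2 • s.Z) := by
  rw [lap, mapField_lapField, ← lap, lap_bundleMap_fst, s.lap_X_and_lap_N.1]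
  simp only [lap, lapField, map_add, smul_add, Finset.sum_add_distrib]
  abel

/-- Applying the Laplacian to ⟨Y, N⟩ = 0 rewrites ⟨ΔY, N⟩ through first derivatives. The vertical
component is then t times a function, and t can be cancelled. -/
theorem vertical_condition_iff : ⟪s.lap (s.lap s.bundleMap), 𝐃 2 s.bundleMap⟫ = 0 ↔
    2 * ∑ i : Fin 2, ∑ j : Fin 2, s.γ i j * ⟪𝐃 i.castSucc s.Y, liftField (𝐃 j s.N)⟫ =
      ⟪s.Y, s.Y⟫ := by
  have h1 : ⟪𝐃 2 s.Y, N̂⟫ = 0 := by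
    have h := congrArg (𝐝 2) s.inner_Y_N
    rwa [pderiv_innerField, pderivField_two_liftField, map_zero, map_zero, add_zero] at h
  have h2 := s.lapS_inner s.Y N̂
  rw [inner_Y_N, lapS_zero, s.lap_X_and_lap_N.2] at h2
  simp only [map_sub, map_neg, map_smul, inner_Y_N, smul_zero, sub_zero, pderivField_liftField,
    pderivField_two_liftField, map_zero, add_zero] at h2
  have h3 : ⟪s.lap (s.lap s.bundleMap), 𝐃 2 s.bundleMap⟫ = t * (2 * ∑ i : Fin 2, ∑ j : Fin 2,
      s.γ i j * ⟪𝐃 i.castSucc s.Y, liftField (𝐃 j s.N)⟫ - ⟪s.Y, s.Y⟫) := by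
    rw [innerField_bundle_two, lap_lap_snd, lap_t_smul]
    simp only [map_neg, map_add, map_smul, LinearMap.neg_apply, LinearMap.add_apply,
      LinearMap.smul_apply, smul_eq_mul, inner_Y_N, h1]
    linear_combination t * h2
  rw [h3]
  constructor
  · intro h
    exact sub_eq_zero.1 (eq_zero_of_fibreCoord_mul h)
  · intro h
    rw [h, sub_self, mul_zero]

theorem inner_lap_P_smul_N (k : Fin 2) : ⟪s.lap (s.P • N̂), liftField (𝐃 k s.X)⟫ =
    2 * ∑ i : Fin 2, ∑ j : Fin 2, s.γ i j * 𝐝 i.castSucc s.P *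
      ⟪liftField (𝐃 j s.N), liftField (𝐃 k s.X)⟫ - s.P * ⟪s.Y, liftField (𝐃 k s.X)⟫ := by
  rw [lap_smul, s.lap_X_and_lap_N.2]
  simp only [pderivField_liftField, pderivField_two_liftField, map_add, map_sub, map_neg, map_smul,
    map_sum, LinearMap.add_apply, LinearMap.sub_apply, LinearMap.neg_apply, LinearMap.smul_apply,
    LinearMap.sum_apply, smul_eq_mul, lift_inner_N_DX, map_zero, LinearMap.zero_apply]
  ring

/-- Arranged so that everything in the last bracket carries a factor t and disappears on the zero
section. -/
theorem horizontal_condition (k : Fin 2) :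
    ⟪s.lap (s.lap s.bundleMap), 𝐃 k.castSucc s.bundleMap⟫ =
      2 * ∑ i : Fin 2, ∑ j : Fin 2, s.γ i j * 𝐝 i.castSucc s.P *
        ⟪liftField (𝐃 j s.N), liftField (𝐃 k s.X)⟫ - s.P * ⟪s.Y, liftField (𝐃 k s.X)⟫ +
      2 * ⟪s.Z, liftField (𝐃 k s.X)⟫ +
      t * (t * ⟪s.lap s.Z, liftField (𝐃 k s.X)⟫ + 2 * t * s.trIII * ⟪s.Z, liftField (𝐃 k s.X)⟫ +
        4 * ⟪𝐃 2 s.Z, liftField (𝐃 k s.X)⟫ - t * ⟪s.lap s.Y, liftField (𝐃 k s.N)⟫ -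
        t * s.trIII * ⟪s.Y, liftField (𝐃 k s.N)⟫ - 2 * ⟪𝐃 2 s.Y, liftField (𝐃 k s.N)⟫) := by
  rw [innerField_bundle_castSucc, lap_lap_fst, lap_lap_snd, lap_t_smul, lap_t_sq_smul,
    map_add (innerField : SmoothField (cylinder U) E3 →ₗ[_] _), LinearMap.add_apply,
    inner_lap_P_smul_N]
  simp only [map_add, map_neg, map_smul, LinearMap.add_apply, LinearMap.neg_apply,
    LinearMap.smul_apply, smul_eq_mul]
  ring

theorem detRatioInv_mul_detRatio_mul (f : SmoothScalar (cylinder U)) :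
    s.detRatioInv * (s.detRatio * f) = f := by
  rw [← mul_assoc, mul_comm s.detRatioInv, detRatio_mul_inv, one_mul]

/-- Under these hypotheses c = 0, hence Y = Z = 0, and P is constant along the surface directions
because P, like h, annihilates dK. Every term of both conditions then vanishes. -/
theorem isTangentiallyBiharmonic_of_const (hh : ∀ i, 𝐝 i s.h = 0) (hK : ∀ i, s.h * 𝐝 i s.K = 0) :
    s.IsTangentiallyBiharmonic := by
  have hhK : ∀ i, lift s.h * lift (𝐝 i s.K) = 0 := fun i => by rw [← map_mul, hK, map_zero]
  have hc : ∀ k, s.c k = 0 := by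
    intro k
    rw [← s.detRatioInv_mul_detRatio_mul (s.c k), detRatio_mul_c, hh, map_zero]
    linear_combination (s.detRatioInv * t ^ 2) * hhK k
  have hy : ∀ l, s.y l = 0 := fun l => by simp [y, hc]
  have hY : s.Y = 0 := by simp [Y, hy]
  have hZ : s.Z = 0 := by simp [Z, hy]
  have hP : ∀ i : Fin 2, 𝐝 i.castSucc s.P = 0 := by
    intro i
    have hPK : s.P * lift (𝐝 i s.K) = 0 := by
      rw [← s.detRatioInv_mul_detRatio_mul s.P, detRatio_mul_P]
      linear_combination s.detRatioInv * (1 + t ^ 2 * lift s.K) * hhK i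
    have h := congrArg (𝐝 i.castSucc) s.detRatio_mul_P
    rw [← s.detRatioInv_mul_detRatio_mul (𝐝 i.castSucc s.P)]
    simp only [detRatio, pow_two, Derivation.leibniz, map_add, map_sub, pderiv_lift,
      pderiv_castSucc_fibreCoord, hh, smul_eq_mul, map_zero, Derivation.map_one_eq_zero,
      mul_zero] at h ⊢
    linear_combination s.detRatioInv * h + s.detRatioInv * t ^ 2 * hhK i +
      2 * s.detRatioInv * t ^ 2 * (1 - t ^ 2 * lift s.K) * hPK
  intro a
  induction a using Fin.lastCases with
  | last =>
    refine s.vertical_condition_iff.2 ?_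
    simp [hY]
  | cast k =>
    rw [horizontal_condition]
    simp [hY, hZ, hP, lap_zero]

/-- The gradient of a function on the surface, in coordinates. -/
def grad (f : SmoothScalar U) (l : Fin 2) : SmoothScalar U := ∑ k, s.J l k * 𝐝 k f

/-- The gradient of a function on the surface, as a vector field in `E³`. -/
def gradX (f : SmoothScalar U) : SmoothField U E3 := ∑ l, s.grad f l • 𝐃 l s.X

/-- The derivative of the normal in the direction of the gradient. -/
def gradN (f : SmoothScalar U) : SmoothField U E3 := ∑ l, s.grad f l • 𝐃 l s.N

theorem slice_y (l : Fin 2) : slice (s.y l) = s.grad s.h l := by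
  simp [y, grad, slice_γ, slice_c]

theorem sliceField_Y : sliceField s.Y = s.gradX s.h := by
  simp [Y, gradX, slice_y]

theorem sliceField_Z : sliceField s.Z = s.gradN s.h := by
  simp [Z, gradN, slice_y]

theorem inner_gradX_DX (f : SmoothScalar U) (k : Fin 2) : ⟪s.gradX f, 𝐃 k s.X⟫ = 𝐝 k f := by
  have h0 := s.J_gram_apply 0 k
  have h1 := s.J_gram_apply 1 k
  simp only [gradX, grad, Fin.sum_univ_two, map_add, map_smul, LinearMap.add_apply,
    LinearMap.smul_apply, smul_eq_mul, ← gram_apply, s.J_symm 1 0] at *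
  fin_cases k
  · simp at h0 h1 ⊢
    linear_combination 𝐝 0 f * h0 + 𝐝 1 f * h1
  · simp at h0 h1 ⊢
    linear_combination 𝐝 0 f * h0 + 𝐝 1 f * h1

theorem inner_gradN_DX (f : SmoothScalar U) (k : Fin 2) :
    ⟪s.gradN f, 𝐃 k s.X⟫ = ⟪s.gradX f, 𝐃 k s.N⟫ := by
  simp only [gradN, gradX, map_sum, map_smul, LinearMap.sum_apply, LinearMap.smul_apply,
    inner_DN_DX, innerField_comm (𝐃 _ s.X), s.II_symm k]

theorem inner_gradX_N (f : SmoothScalar U) : ⟪s.gradX f, s.N⟫ = 0 := by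
  simp [gradX, inner_X_N]

theorem inner_gradN_N (f : SmoothScalar U) : ⟪s.gradN f, s.N⟫ = 0 := by
  simp [gradN, inner_DN_N]

theorem sum_J_pderiv_inner (f : SmoothScalar U) (k : Fin 2) :
    ∑ i : Fin 2, ∑ j : Fin 2, s.J i j * 𝐝 i f * ⟪𝐃 j s.N, 𝐃 k s.X⟫ = ⟪s.gradN f, 𝐃 k s.X⟫ := by
  simp only [gradN, grad, Fin.sum_univ_two, map_add, map_smul, LinearMap.add_apply,
    LinearMap.smul_apply, smul_eq_mul, s.J_symm 1 0]
  ring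

/-- The shape operator has eigenvalue `-h / 4` in the direction of the gradient of `h`. -/
theorem four_smul_gradN (hs : s.IsTangentiallyBiharmonic) :
    (4 : SmoothScalar U) • s.gradN s.h = s.h • s.gradX s.h := by
  refine s.eq_of_inner (fun k => ?_) (by simp [inner_gradN_N, inner_gradX_N])
  -- At t = 0 the functions P, Y, Z restrict to h, grad h and dN(grad h). The derivative of P and
  -- the term 2Z contribute 2 dN(grad h) each, which gives the factor 4.
  have h := congrArg slice (s.horizontal_condition k)
  rw [hs] at h
  simp only [map_add, map_sub, map_mul, map_sum, map_ofNat, map_zero, slice_γ, slice_pderiv,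
    slice_P, slice_inner, sliceField_liftField, sliceField_Y, sliceField_Z, slice_fibreCoord,
    zero_mul, add_zero, sum_J_pderiv_inner, inner_gradX_DX] at h
  simp only [map_smul, LinearMap.smul_apply, smul_eq_mul, inner_gradX_DX]
  linear_combination -h

/-- The vertical condition on the zero section. It survives there only because the factor t was
cancelled first. -/
theorem two_mul_sum_J_inner (hs : s.IsTangentiallyBiharmonic) :
    2 * ∑ i, ∑ j, s.J i j * ⟪𝐃 i (s.gradX s.h), 𝐃 j s.N⟫ = ⟪s.gradX s.h, s.gradX s.h⟫ := by
  have h := congrArg slice (s.vertical_condition_iff.1 (hs 2))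
  simpa only [map_mul, map_sum, map_ofNat, slice_γ, slice_inner, sliceField_pderivField,
    sliceField_Y, sliceField_liftField] using h

end OrientedPatch

end

/-! ### Constant h: the t² coefficient of the horizontal condition. -/

section

namespace OrientedPatch

variable {U : Opens (EuclideanSpace ℝ (Fin 2))} (s : OrientedPatch U)

local notation "t" => fibreCoord U
local notation "X̂" => liftField (OrientedPatch.X s)
local notation "N̂" => liftField (OrientedPatch.N s)

/-- If `h` is constant, the shape operator has eigenvalue `-h / 12` in the direction of the gradient
of the Gauss curvature. -/
theorem twelve_mul_h_smul_gradN (hs : s.IsTangentiallyBiharmonic) (hh : ∀ i, 𝐝 i s.h = 0) :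
    (12 * s.h) • s.gradN s.K = (s.h ^ 2) • s.gradX s.K := by
  refine s.eq_of_inner (fun k => ?_) (by simp [inner_gradN_N, inner_gradX_N])
  -- With dh = 0 the quantities c, y, Y, Z and the horizontal derivatives of P are all divisible by
  -- t²; the primed letters and `p` are the quotients.
  let c' : Fin 2 → SmoothScalar (cylinder U) :=
    fun k => s.detRatioInv * (lift s.h * lift (𝐝 k s.K))
  let y' : Fin 2 → SmoothScalar (cylinder U) := fun l => ∑ k, s.γ l k * c' k
  let Y' : SmoothField (cylinder U) E3 := ∑ l, y' l • liftField (𝐃 l s.X)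
  let Z' : SmoothField (cylinder U) E3 := ∑ l, y' l • liftField (𝐃 l s.N)
  let p : Fin 2 → SmoothScalar (cylinder U) := fun i => s.detRatioInv *
    (lift s.h * lift (𝐝 i s.K) + 2 * (1 - t ^ 2 * lift s.K) * lift (𝐝 i s.K) * s.P)
  have hc : ∀ k, s.c k = t ^ 2 * c' k := by
    intro k
    rw [← s.detRatioInv_mul_detRatio_mul (s.c k), detRatio_mul_c, hh, map_zero]
    ring
  have hy : ∀ l, s.y l = t ^ 2 * y' l := by
    intro l
    simp only [y, y', hc, Finset.mul_sum]
    exact Finset.sum_congr rfl fun k _ => by ring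
  have hY : s.Y = t ^ 2 • Y' := by simp only [Y, Y', hy, mul_smul, Finset.smul_sum]
  have hZ : s.Z = t ^ 2 • Z' := by simp only [Z, Z', hy, mul_smul, Finset.smul_sum]
  have hP : ∀ i : Fin 2, 𝐝 i.castSucc s.P = t ^ 2 * p i := by
    intro i
    have h := congrArg (𝐝 i.castSucc) s.detRatio_mul_P
    rw [← s.detRatioInv_mul_detRatio_mul (𝐝 i.castSucc s.P)]
    simp only [detRatio, pow_two, Derivation.leibniz, map_add, map_sub, pderiv_lift,
      pderiv_castSucc_fibreCoord, hh, smul_eq_mul, map_zero, Derivation.map_one_eq_zero,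
      mul_zero, p] at h ⊢
    linear_combination s.detRatioInv * h
  have sc : ∀ k, slice (c' k) = s.h * 𝐝 k s.K := by
    intro k
    simp only [c', map_mul, slice_detRatioInv, slice_lift, one_mul]
  have sy : ∀ l, slice (y' l) = s.h * s.grad s.K l := by
    intro l
    simp only [y', map_sum, map_mul, slice_γ, sc, grad, Finset.mul_sum]
    exact Finset.sum_congr rfl fun k _ => by ring
  have sY : sliceField Y' = s.h • s.gradX s.K := by
    simp only [Y', map_sum, sliceField_smul, sliceField_liftField, sy, gradX, Finset.smul_sum,
      mul_smul]
  have sZ : sliceField Z' = s.h • s.gradN s.K := by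
    simp only [Z', map_sum, sliceField_smul, sliceField_liftField, sy, gradN, Finset.smul_sum,
      mul_smul]
  have sp : ∀ i, slice (p i) = 3 * (s.h * 𝐝 i s.K) := by
    intro i
    simp only [p, map_mul, map_add, map_sub, map_pow, map_one, map_ofNat, slice_detRatioInv,
      slice_lift, slice_fibreCoord, slice_P]
    ring
  have h := s.horizontal_condition k
  rw [hs] at h
  have hsum : ∑ i : Fin 2, ∑ j : Fin 2, s.γ i j * (t ^ 2 * p i) *
      ⟪liftField (𝐃 j s.N), liftField (𝐃 k s.X)⟫ = t ^ 2 * ∑ i : Fin 2, ∑ j : Fin 2, s.γ i j * p i *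
      ⟪liftField (𝐃 j s.N), liftField (𝐃 k s.X)⟫ := by
    simp only [Finset.mul_sum]
    exact Finset.sum_congr rfl fun i _ => Finset.sum_congr rfl fun j _ => by ring
  simp only [hP, hY, hZ, hsum, lap_t_sq_smul, D_two_t_sq_smul, map_add, map_smul,
    LinearMap.add_apply, LinearMap.smul_apply, smul_eq_mul] at h
  set a := ∑ i : Fin 2, ∑ j : Fin 2, s.γ i j * p i *
    ⟪liftField (𝐃 j s.N), liftField (𝐃 k s.X)⟫ with ha
  -- The coefficient 12 = 2 + 2 + 8 collects 2Z, the term 2Z' of Δ(t²Z'), and 4t ∂ₜ(t²Z'). Similarly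
  -- 6 = 2 + 4. The function b absorbs all higher-order terms and is lost on the zero section.
  obtain ⟨b, hb⟩ : ∃ b, t * (t * (2 * a - s.P * ⟪Y', liftField (𝐃 k s.X)⟫ +
      12 * ⟪Z', liftField (𝐃 k s.X)⟫ - 6 * ⟪Y', liftField (𝐃 k s.N)⟫ + t * b)) = 0 := by
    refine ⟨t * ⟪s.lap Z', liftField (𝐃 k s.X)⟫ + 8 * ⟪𝐃 2 Z', liftField (𝐃 k s.X)⟫ +
      4 * t * s.trIII * ⟪Z', liftField (𝐃 k s.X)⟫ - t * ⟪s.lap Y', liftField (𝐃 k s.N)⟫ -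
      3 * t * s.trIII * ⟪Y', liftField (𝐃 k s.N)⟫ - 6 * ⟪𝐃 2 Y', liftField (𝐃 k s.N)⟫, ?_⟩
    linear_combination -h
  have h' := congrArg slice (eq_zero_of_fibreCoord_mul (eq_zero_of_fibreCoord_mul hb))
  have sa : slice a = 3 * s.h * ⟪s.gradN s.K, 𝐃 k s.X⟫ := by
    rw [← sum_J_pderiv_inner, ha]
    simp only [map_sum, map_mul, slice_γ, sp, slice_inner, sliceField_liftField, Finset.mul_sum]
    exact Finset.sum_congr rfl fun i _ => Finset.sum_congr rfl fun j _ => by ring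
  simp only [map_add, map_sub, map_mul, map_ofNat, map_zero, slice_P, sa, slice_inner,
    sliceField_liftField, sY, sZ, slice_fibreCoord, zero_mul, add_zero, map_smul,
    LinearMap.smul_apply, smul_eq_mul, ← inner_gradN_DX] at h'
  simp only [map_smul, LinearMap.smul_apply, smul_eq_mul]
  linear_combination h'

/-- The shape operator maps the gradient of `f` to `a` times itself. -/
theorem S_mul_grad {f a b : SmoothScalar U} (h : a • s.gradN f = b • s.gradX f) (l : Fin 2) :
    a * (s.S l 0 * s.grad f 0 + s.S l 1 * s.grad f 1) = -(b * s.grad f l) := by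
  have h' : ∀ k, (gram s.X * s.S) k 0 * (a * s.grad f 0) + (gram s.X * s.S) k 1 * (a * s.grad f 1) =
      -(b * (gram s.X k 0 * s.grad f 0 + gram s.X k 1 * s.grad f 1)) := by
    intro k
    have e := congrArg (fun φ => ⟪φ, 𝐃 k s.X⟫) h
    simp only [gradN, gradX, Fin.sum_univ_two, map_smul, map_add, LinearMap.smul_apply,
      LinearMap.add_apply, smul_eq_mul, inner_DN_DX, ← gram_apply] at e
    rw [gram_mul_S, s.II_symm k 0, s.II_symm k 1, s.gram_symm k 0, s.gram_symm k 1]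
    linear_combination -e
  have h0 := h' 0
  have h1 := h' 1
  simp only [Matrix.mul_apply, Fin.sum_univ_two] at h0 h1
  have j0 := s.J_gram_apply l 0
  have j1 := s.J_gram_apply l 1
  fin_cases l
  · simp at j0 j1 ⊢
    linear_combination s.J 0 0 * h0 + s.J 0 1 * h1 -
      (a * (s.S 0 0 * s.grad f 0 + s.S 0 1 * s.grad f 1) + b * s.grad f 0) * j0 -
      (a * (s.S 1 0 * s.grad f 0 + s.S 1 1 * s.grad f 1) + b * s.grad f 1) * j1
  · simp at j0 j1 ⊢
    linear_combination s.J 1 0 * h0 + s.J 1 1 * h1 -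
      (a * (s.S 0 0 * s.grad f 0 + s.S 0 1 * s.grad f 1) + b * s.grad f 0) * j0 -
      (a * (s.S 1 0 * s.grad f 0 + s.S 1 1 * s.grad f 1) + b * s.grad f 1) * j1

theorem pderiv_eq_sum_grad (f : SmoothScalar U) (k : Fin 2) :
    𝐝 k f = gram s.X k 0 * s.grad f 0 + gram s.X k 1 * s.grad f 1 := by
  rw [← s.inner_gradX_DX f k, gradX]
  simp only [Fin.sum_univ_two, map_smul, map_add, LinearMap.smul_apply, LinearMap.add_apply,
    smul_eq_mul, ← gram_apply, s.gram_symm k]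
  ring

/-- The hypothesis says that -b/a is an eigenvalue of `S` on grad f; the factor is a² times the
characteristic polynomial at that value, so no division by a is needed. -/
theorem charpoly_mul_pderiv {f a b : SmoothScalar U} (h : a • s.gradN f = b • s.gradX f)
    (k : Fin 2) : (b ^ 2 + a * b * s.h + a ^ 2 * s.K) * 𝐝 k f = 0 := by
  have h0 := s.S_mul_grad h 0
  have h1 := s.S_mul_grad h 1
  have e0 : (b ^ 2 + a * b * s.h + a ^ 2 * s.K) * s.grad f 0 = 0 := by
    simp only [OrientedPatch.h, K]
    linear_combination (b + a * s.S 1 1) * h0 - a * s.S 0 1 * h1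
  have e1 : (b ^ 2 + a * b * s.h + a ^ 2 * s.K) * s.grad f 1 = 0 := by
    simp only [OrientedPatch.h, K]
    linear_combination (b + a * s.S 0 0) * h1 - a * s.S 1 0 * h0
  rw [pderiv_eq_sum_grad]
  linear_combination gram s.X k 0 * e0 + gram s.X k 1 * e1

theorem _root_.NormalBundleSurface.SmoothScalar.eq_zero_of_pow {m : ℕ} {W : Opens (EuclideanSpace ℝ (Fin m))} {f : SmoothScalar W}
    {n : ℕ} (h : f ^ n = 0) : f = 0 := by
  ext w
  have := congrArg (fun f => SmoothScalar.toFun f w) h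
  exact eq_zero_of_pow_eq_zero this

/-- If the mean curvature is constant, then so is the Gauss curvature, up to a factor `h`. -/
theorem h_mul_pderiv_K (hs : s.IsTangentiallyBiharmonic) (hh : ∀ i, 𝐝 i s.h = 0) (k : Fin 2) :
    s.h * 𝐝 k s.K = 0 := by
  have h1 := s.charpoly_mul_pderiv (s.twelve_mul_h_smul_gradN hs hh) k
  have h2 := congrArg (𝐝 k) h1
  have e12 : 𝐝 k (12 : SmoothScalar U) = 0 := Derivation.map_natCast (𝐝 k) 12
  simp only [pow_succ, pow_zero, one_mul, Derivation.leibniz, map_add, hh, smul_eq_mul, map_zero,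
    mul_zero, e12, add_zero, zero_add] at h2
  -- Here `h1` reads (13h⁴ + 144h²K) ∂ₖK = 0. Its derivative times h ∂ₖK has a second-derivative
  -- term that is a multiple of `h1`, leaving 144 (h ∂ₖK)³ = 0.
  have e144 : IsUnit (144 : SmoothScalar U) := SmoothScalar.isUnit_of_ne_zero fun w => by simp
  have h3 : (144 : SmoothScalar U) * (s.h * 𝐝 k s.K) ^ 3 = 0 := by
    linear_combination s.h * 𝐝 k s.K * h2 - s.h * 𝐝 k (𝐝 k s.K) * h1
  exact SmoothScalar.eq_zero_of_pow (e144.mul_right_eq_zero.1 h3)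

end OrientedPatch

end

/-! ### The shape operator where grad h does not vanish. -/

section

namespace OrientedPatch

variable {U : Opens (EuclideanSpace ℝ (Fin 2))} (s : OrientedPatch U)

theorem inner_gradX_gradX (f : SmoothScalar U) :
    ⟪s.gradX f, s.gradX f⟫ = s.grad f 0 * 𝐝 0 f + s.grad f 1 * 𝐝 1 f := by
  nth_rw 2 [gradX]
  simp only [Fin.sum_univ_two, map_add, map_smul, smul_eq_mul, inner_gradX_DX]

/-- Division by df: if df ∧ A = 0 then A = Q df, where Q is the contraction of A with grad f divided
by |grad f|². -/
theorem exists_eq_pderiv_smul {f : SmoothScalar U} (hq : IsUnit ⟪s.gradX f, s.gradX f⟫)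
    {V : Type*} [AddCommGroup V] [Module (SmoothScalar U) V] {A : Fin 2 → V}
    (h : 𝐝 0 f • A 1 = 𝐝 1 f • A 0) : ∃ Q : V, ∀ i, A i = 𝐝 i f • Q := by
  obtain ⟨r, hr⟩ := hq.exists_left_inv
  rw [inner_gradX_gradX] at hr
  refine ⟨r • (s.grad f 0 • A 0 + s.grad f 1 • A 1), fun i => ?_⟩
  fin_cases i
  · have e : A 0 = (r * (s.grad f 0 * 𝐝 0 f + s.grad f 1 * 𝐝 1 f)) • A 0 := by rw [hr, one_smul]
    have e' : (r * s.grad f 1) • (𝐝 0 f • A 1) = (r * s.grad f 1) • (𝐝 1 f • A 0) := by rw [h]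
    simp only [Fin.zero_eta] at *
    linear_combination (norm := module) e - e'
  · have e : A 1 = (r * (s.grad f 0 * 𝐝 0 f + s.grad f 1 * 𝐝 1 f)) • A 1 := by rw [hr, one_smul]
    have e' : (r * s.grad f 0) • (𝐝 0 f • A 1) = (r * s.grad f 0) • (𝐝 1 f • A 0) := by rw [h]
    simp only [Fin.mk_one] at *
    linear_combination (norm := module) e + e'

theorem eq_zero_of_pderiv_mul {f : SmoothScalar U} (hq : IsUnit ⟪s.gradX f, s.gradX f⟫)
    {a : SmoothScalar U} (h : ∀ i, 𝐝 i f * a = 0) : a = 0 := by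
  rw [← hq.mul_right_eq_zero, inner_gradX_gradX]
  linear_combination s.grad f 0 * h 0 + s.grad f 1 * h 1

/-- A 2×2 matrix that kills the vector g, is killed by the covector d, and has trace zero must
vanish once d(g) is a unit: its only possible entry, in the complementary direction, is its trace.
-/
theorem eq_zero_of_mul_vec_eq_zero {R : Type*} [CommRing R] {q g0 g1 d0 d1 M00 M01 M10 M11 : R}
    (hq : IsUnit q) (hqd : q = g0 * d0 + g1 * d1) (r0 : M00 * g0 + M01 * g1 = 0)
    (r1 : M10 * g0 + M11 * g1 = 0) (k0 : d0 * M00 + d1 * M10 = 0) (k1 : d0 * M01 + d1 * M11 = 0)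
    (tr : M00 + M11 = 0) : M00 = 0 ∧ M01 = 0 ∧ M10 = 0 ∧ M11 = 0 := by
  refine ⟨hq.mul_right_eq_zero.1 ?_, hq.mul_right_eq_zero.1 ?_, hq.mul_right_eq_zero.1 ?_,
    hq.mul_right_eq_zero.1 ?_⟩
  · linear_combination M00 * hqd + g0 * k0 - d1 * r1 + d1 * g1 * tr
  · linear_combination M01 * hqd + g0 * k1 + d1 * r0 - d1 * g0 * tr
  · linear_combination M10 * hqd + g1 * k0 + d0 * r1 - d0 * g1 * tr
  · linear_combination M11 * hqd + g1 * k1 - d0 * r0 + d0 * g0 * tr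

/-- The shape operator where the gradient of `h` does not vanish. -/
theorem four_mul_smul_DN (hs : s.IsTangentiallyBiharmonic)
    (hq : IsUnit ⟪s.gradX s.h, s.gradX s.h⟫) (i : Fin 2) :
    (4 * ⟪s.gradX s.h, s.gradX s.h⟫) • 𝐃 i s.N =
      (-5 * s.h * ⟪s.gradX s.h, s.gradX s.h⟫) • 𝐃 i s.X + (6 * s.h * 𝐝 i s.h) • s.gradX s.h := by
  have hv := s.S_mul_grad (s.four_smul_gradN hs)
  have hsym := s.gram_mul_S_symm 0 1
  have p0 := s.pderiv_eq_sum_grad s.h 0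
  have p1 := s.pderiv_eq_sum_grad s.h 1
  have hqd := s.inner_gradX_gradX s.h
  have v0 := hv 0
  have v1 := hv 1
  have hV : s.gradX s.h = s.grad s.h 0 • 𝐃 0 s.X + s.grad s.h 1 • 𝐃 1 s.X := by
    rw [gradX, Fin.sum_univ_two]
  simp only [Matrix.mul_apply, Fin.sum_univ_two, s.gram_symm 1 0] at hsym p1
  have tr : s.h = s.S 0 0 + s.S 1 1 := rfl
  have hN : 𝐃 i s.N = -(s.S 0 i • 𝐃 0 s.X + s.S 1 i • 𝐃 1 s.X) := by
    rw [DN_eq, Fin.sum_univ_two]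
  rw [hN]
  set q := ⟪s.gradX s.h, s.gradX s.h⟫
  rw [hV]
  have v0' : 4 * (s.S 0 0 * s.grad s.h 0 + s.S 0 1 * s.grad s.h 1) = -(s.h * s.grad s.h 0) := v0
  have v1' : 4 * (s.S 1 0 * s.grad s.h 0 + s.S 1 1 * s.grad s.h 1) = -(s.h * s.grad s.h 1) := v1
  have c0 : 4 * (𝐝 0 s.h * s.S 0 0 + 𝐝 1 s.h * s.S 1 0) = -(s.h * 𝐝 0 s.h) := by
    rw [p0, p1]
    linear_combination gram s.X 0 0 * v0' + gram s.X 0 1 * v1' - 4 * s.grad s.h 1 * hsym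
  have c1 : 4 * (𝐝 0 s.h * s.S 0 1 + 𝐝 1 s.h * s.S 1 1) = -(s.h * 𝐝 1 s.h) := by
    rw [p0, p1]
    linear_combination gram s.X 0 1 * v0' + gram s.X 1 1 * v1' + 4 * s.grad s.h 0 * hsym
  clear p0 p1 hsym hv v0 v1 hN
  generalize s.h = a at *
  -- As tr S = h and S has eigenvalue -h/4 on grad h, the other eigenvalue is 5h/4. The matrix is 4q
  -- times the difference of S and the operator with these eigenvalues; 6 = 5 + 1.
  obtain ⟨e00, e01, e10, e11⟩ := eq_zero_of_mul_vec_eq_zero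
    (M00 := 4 * q * s.S 0 0 - 5 * a * q + 6 * a * s.grad a 0 * 𝐝 0 a)
    (M01 := 4 * q * s.S 0 1 + 6 * a * s.grad a 0 * 𝐝 1 a)
    (M10 := 4 * q * s.S 1 0 + 6 * a * s.grad a 1 * 𝐝 0 a)
    (M11 := 4 * q * s.S 1 1 - 5 * a * q + 6 * a * s.grad a 1 * 𝐝 1 a) hq hqd
    (by linear_combination q * v0' - 6 * a * s.grad a 0 * hqd)
    (by linear_combination q * v1' - 6 * a * s.grad a 1 * hqd)
    (by linear_combination q * c0 - 6 * a * 𝐝 0 a * hqd)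
    (by linear_combination q * c1 - 6 * a * 𝐝 1 a * hqd)
    (by linear_combination -4 * q * tr - 6 * a * hqd)
  fin_cases i
  · simp only [Fin.zero_eta]
    linear_combination (norm := module) (-e00) • 𝐃 0 s.X - e10 • 𝐃 1 s.X
  · simp only [Fin.mk_one]
    linear_combination (norm := module) (-e01) • 𝐃 0 s.X - e11 • 𝐃 1 s.X

end OrientedPatch

end

/-! ### No open set carries nonvanishing h and grad h. -/

section

theorem pderiv_comm {m : ℕ} {W : Opens (EuclideanSpace ℝ (Fin m))} (i j : Fin m)
    (f : SmoothScalar W) : pderiv i (pderiv j f) = pderiv j (pderiv i f) := by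
  have h := pderivField_comm i j (⟨f.1, f.2⟩ : SmoothField W ℝ)
  exact SmoothScalar.ext fun w => congrArg (fun F : SmoothField W ℝ => F w) h

theorem pderiv_ofNat {m : ℕ} {W : Opens (EuclideanSpace ℝ (Fin m))} (i : Fin m) (n : ℕ)
    [n.AtLeastTwo] : pderiv i (ofNat(n) : SmoothScalar W) = 0 :=
  (pderiv i).map_natCast n

theorem SmoothScalar.isUnit_ofNat {m : ℕ} {W : Opens (EuclideanSpace ℝ (Fin m))} (n : ℕ)
    [n.AtLeastTwo] : IsUnit (OfNat.ofNat n : SmoothScalar W) := by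
  have h : IsUnit (algebraMap ℝ (SmoothScalar W) (OfNat.ofNat n)) :=
    (IsUnit.mk0 _ (OfNat.ofNat_ne_zero n)).map _
  rwa [map_ofNat] at h

theorem SmoothScalar.eq_zero_of_ofNat_mul {m : ℕ} {W : Opens (EuclideanSpace ℝ (Fin m))} (n : ℕ)
    [n.AtLeastTwo] {a : SmoothScalar W} (h : ofNat(n) * a = 0) : a = 0 :=
  (SmoothScalar.isUnit_ofNat n).mul_right_eq_zero.1 h

namespace OrientedPatch

variable {U : Opens (EuclideanSpace ℝ (Fin 2))} (s : OrientedPatch U)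

theorem eq_zero_of_smul_smul_DX {k a b : SmoothScalar U}
    (h : (k * a) • 𝐃 1 s.X = (k * b) • 𝐃 0 s.X) : k * a = 0 ∧ k * b = 0 := by
  have h0 := congrArg (fun v => ⟪v, 𝐃 0 s.X⟫) h
  have h1 := congrArg (fun v => ⟪v, 𝐃 1 s.X⟫) h
  simp only [map_smul, LinearMap.smul_apply, smul_eq_mul, ← gram_apply] at h0 h1
  have j00 := s.J_gram_apply 0 0
  have j01 := s.J_gram_apply 0 1
  have j10 := s.J_gram_apply 1 0
  have j11 := s.J_gram_apply 1 1
  simp only [if_true, if_false, zero_ne_one, one_ne_zero, s.gram_symm 1 0] at *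
  constructor
  · linear_combination s.J 1 0 * h0 + s.J 1 1 * h1 - k * a * j11 + k * b * j10
  · linear_combination -s.J 0 0 * h0 - s.J 0 1 * h1 - k * b * j00 + k * a * j01

theorem sum_J_gram : ∑ i, ∑ j, s.J i j * gram s.X i j = 2 := by
  have j00 := s.J_gram_apply 0 0
  have j11 := s.J_gram_apply 1 1
  simp only [Fin.sum_univ_two, if_true, s.gram_symm 1 0] at *
  linear_combination j00 + j11

theorem sum_J_pderiv_pderiv (f : SmoothScalar U) :
    ∑ i, ∑ j, s.J i j * (𝐝 i f * 𝐝 j f) = ⟪s.gradX f, s.gradX f⟫ := by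
  rw [inner_gradX_gradX, grad, grad]
  simp only [Fin.sum_univ_two]
  ring

/-- The gradient of the mean curvature of a surface with tangentially biharmonic normal bundle
cannot be nonzero where the mean curvature is nonzero. -/
theorem one_eq_zero_of_isUnit (hs : s.IsTangentiallyBiharmonic) (hh : IsUnit s.h)
    (hq : IsUnit ⟪s.gradX s.h, s.gradX s.h⟫) : (1 : SmoothScalar U) = 0 := by
  set V := s.gradX s.h with hV
  set q := ⟪V, V⟫ with hq'
  -- σ = 3h/(2q) normalises the gradient so that the Weingarten equations take the form 4 dN = -5h
  -- dX + 4 dh T with T = σ grad h.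
  obtain ⟨σ, hσ⟩ : ∃ σ, 2 * σ * q = 3 * s.h := by
    obtain ⟨r, hr⟩ := ((SmoothScalar.isUnit_ofNat 2).mul hq).exists_left_inv
    exact ⟨3 * s.h * r, by linear_combination 3 * s.h * hr⟩
  have hVX : ∀ i, ⟪V, 𝐃 i s.X⟫ = 𝐝 i s.h := s.inner_gradX_DX s.h
  have hVN : ⟪V, s.N⟫ = 0 := s.inner_gradX_N s.h
  set T : SmoothField U E3 := σ • V with hT
  have hTX : ∀ i, ⟪T, 𝐃 i s.X⟫ = σ * 𝐝 i s.h := fun i => by simp [hT, hVX]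
  have hTV : 2 * ⟪T, V⟫ = 3 * s.h := by
    rw [hT, map_smul, LinearMap.smul_apply, ← hq', smul_eq_mul, ← hσ]; ring
  have hTN : ⟪T, s.N⟫ = 0 := by simp [hT, hVN]
  have hTT : 2 * ⟪T, T⟫ = 3 * s.h * σ := by
    nth_rw 2 [hT]
    rw [map_smul, smul_eq_mul]
    linear_combination σ * hTV
  have E1 : ∀ i, (4 : SmoothScalar U) • 𝐃 i s.N =
      (-5 * s.h) • 𝐃 i s.X + (4 * 𝐝 i s.h) • T := by
    intro i
    refine hq.smul_left_cancel.1 ?_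
    have := s.four_mul_smul_DN hs hq i
    rw [← hV, ← hq'] at this
    linear_combination (norm := module) this - (2 * 𝐝 i s.h) • congrArg (· • V) hσ
  have hTDN : ∀ i, 4 * ⟪T, 𝐃 i s.N⟫ = s.h * σ * 𝐝 i s.h := by
    intro i
    have := congrArg (fun v => ⟪T, v⟫) (E1 i)
    simp only [map_add, map_smul, smul_eq_mul, hTX] at this
    linear_combination this + 2 * 𝐝 i s.h * hTT
  have hVDN : ∀ i, 4 * ⟪V, 𝐃 i s.N⟫ = s.h * 𝐝 i s.h := by
    intro i
    have := congrArg (fun v => ⟪V, v⟫) (E1 i)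
    simp only [map_add, map_smul, smul_eq_mul, hVX, innerField_comm V T] at this
    linear_combination this + 2 * 𝐝 i s.h * hTV
  -- Equality of the mixed derivatives of N in `E1` says dh ∧ (4 dT + 5 dX) = 0.
  obtain ⟨Q, hQ⟩ := s.exists_eq_pderiv_smul hq
    (A := fun i => (4 : SmoothScalar U) • 𝐃 i T + (5 : SmoothScalar U) • 𝐃 i s.X) (by
      have h0 := congrArg (𝐃 1) (E1 0)
      have h1 := congrArg (𝐃 0) (E1 1)
      simp only [pderivField_smul, map_add, map_neg, Derivation.leibniz, pderiv_ofNat, smul_eq_mul,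
        pderivField_comm 1 0 s.N, pderivField_comm 1 0 s.X, pderiv_comm 1 0 s.h] at h0 h1
      linear_combination (norm := module) h1 - h0)
  have E2 : ∀ i, (4 : SmoothScalar U) • 𝐃 i T = (-5 : SmoothScalar U) • 𝐃 i s.X + 𝐝 i s.h • Q :=
    fun i => by linear_combination (norm := module) hQ i
  have hQN : ⟪Q, s.N⟫ = -(s.h * σ) := by
    refine eq_neg_of_add_eq_zero_left (s.eq_zero_of_pderiv_mul hq fun i => ?_)
    have h0 := congrArg (𝐝 i) hTN
    rw [pderiv_innerField, map_zero] at h0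
    have h1 := congrArg (fun v => ⟪v, s.N⟫) (E2 i)
    simp only [map_add, map_smul, LinearMap.smul_apply, LinearMap.add_apply, smul_eq_mul,
      inner_X_N] at h1
    linear_combination 4 * h0 - h1 - hTDN i
  have key : ∀ i, 3 * s.h * 𝐝 i σ = 𝐝 i s.h * (-8 * σ + ⟪Q, T⟫) := by
    intro i
    have h0 := congrArg (𝐝 i) hTT
    have h1 := congrArg (fun v => ⟪v, T⟫) (E2 i)
    simp only [map_add, map_smul, LinearMap.smul_apply, LinearMap.add_apply, smul_eq_mul,
      innerField_comm (𝐃 _ s.X) T, hTX] at h1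
    simp only [Derivation.leibniz, pderiv_innerField, smul_eq_mul, innerField_comm T (𝐃 _ T),
      pderiv_ofNat] at h0
    linear_combination h1 - h0
  -- By `key` dσ is a multiple of dh; σ' plays the role of dσ/dh.
  obtain ⟨σ', hσ'⟩ : ∃ σ', ∀ i, 𝐝 i σ = 𝐝 i s.h • σ' := by
    refine s.exists_eq_pderiv_smul hq (A := fun i => 𝐝 i σ) ?_
    refine ((SmoothScalar.isUnit_ofNat 3).mul hh).mul_left_cancel ?_
    simp only [smul_eq_mul]
    linear_combination 𝐝 0 s.h * key 1 - 𝐝 1 s.h * key 0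
  simp only [smul_eq_mul] at hσ'
  have hσQ : 3 * s.h * σ' = -8 * σ + ⟪Q, T⟫ := by
    refine sub_eq_zero.1 (s.eq_zero_of_pderiv_mul hq fun i => ?_)
    linear_combination key i - 3 * s.h * hσ' i
  -- The form ⟨T, dX⟩ = σ dh is closed because dσ is parallel to dh; with `E2` this gives dh ∧ ⟨Q,
  -- dX⟩ = 0.
  obtain ⟨μ, hμ⟩ : ∃ μ, ∀ i, ⟪Q, 𝐃 i s.X⟫ = 𝐝 i s.h • μ := by
    refine s.exists_eq_pderiv_smul hq (A := fun i => ⟪Q, 𝐃 i s.X⟫) ?_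
    have h0 := congrArg (𝐝 0) (hTX 1)
    have h1 := congrArg (𝐝 1) (hTX 0)
    have e0 := congrArg (fun v => ⟪v, 𝐃 1 s.X⟫) (E2 0)
    have e1 := congrArg (fun v => ⟪v, 𝐃 0 s.X⟫) (E2 1)
    simp only [map_add, map_smul, LinearMap.smul_apply, LinearMap.add_apply, smul_eq_mul,
      pderiv_innerField, Derivation.leibniz, hσ', pderivField_comm 1 0, pderiv_comm 1 0,
      innerField_comm (𝐃 1 s.X) (𝐃 0 s.X)] at *
    linear_combination 4 * h0 - 4 * h1 - e0 + e1
  simp only [smul_eq_mul] at hμ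
  have hQ' : Q = μ • V - (s.h * σ) • s.N := by
    refine s.eq_of_inner (fun i => ?_) ?_
    · simp only [map_sub, map_smul, LinearMap.smul_apply, LinearMap.sub_apply, smul_eq_mul, hVX,
        s.inner_N_X, hμ]
      ring
    · simp only [map_sub, map_smul, LinearMap.smul_apply, LinearMap.sub_apply, smul_eq_mul, hVN,
        s.inner_N_N, hQN]
      ring
  have hQT : 2 * ⟪Q, T⟫ = 3 * s.h * μ := by
    rw [hQ']
    simp only [map_sub, map_smul, LinearMap.smul_apply, LinearMap.sub_apply, smul_eq_mul,
      innerField_comm s.N T, hTN, innerField_comm V T]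
    linear_combination μ * hTV
  -- The vertical condition on the zero section, with the derivatives of grad h replaced through
  -- `E1` and `E2`. Together with `hσQ` and `hQT` it determines hμ and hσ' as multiples of σ.
  have E4 : 16 * σ + 3 * s.h * μ - 12 * s.h * σ' = 0 := by
    have hb := s.two_mul_sum_J_inner hs
    have hterm : ∀ i j, 16 * σ * ⟪𝐃 i V, 𝐃 j s.N⟫ = 25 * s.h * gram s.X i j +
        (-20 * σ + s.h * μ - 4 * s.h * σ') * (𝐝 i s.h * 𝐝 j s.h) := by
      intro i j
      have hD : 𝐃 i T = 𝐝 i σ • V + σ • 𝐃 i V := by rw [hT, pderivField_smul]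
      have h1 : 4 * (4 * ⟪𝐃 i T, 𝐃 j s.N⟫) = ⟪(4 : SmoothScalar U) • 𝐃 i T,
          (4 : SmoothScalar U) • 𝐃 j s.N⟫ := by simp
      rw [E1, E2] at h1
      have h2 := congrArg (fun v => ⟪v, 𝐃 j s.N⟫) hD
      simp only [map_add, map_smul, LinearMap.smul_apply, LinearMap.add_apply, smul_eq_mul,
        innerField_comm (𝐃 _ s.X) T, hTX, hμ, ← gram_apply, hσ'] at h1 h2
      linear_combination -16 * h2 + h1 - 4 * 𝐝 i s.h * σ' * hVDN j + 2 * 𝐝 i s.h * 𝐝 j s.h * hQT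
    have hsum : 16 * σ * ∑ i, ∑ j, s.J i j * ⟪𝐃 i V, 𝐃 j s.N⟫ = 50 * s.h +
        (-20 * σ + s.h * μ - 4 * s.h * σ') * q := by
      rw [hq', hV, ← s.sum_J_pderiv_pderiv]
      have hg := s.sum_J_gram
      simp only [Fin.sum_univ_two] at hg ⊢
      rw [← hV]
      linear_combination s.J 0 0 * hterm 0 0 + s.J 0 1 * hterm 0 1 + s.J 1 0 * hterm 1 0 +
        s.J 1 1 * hterm 1 1 + 25 * s.h * hg
    rw [← hV, ← hq'] at hb
    refine SmoothScalar.eq_zero_of_ofNat_mul 2 (hq.mul_right_eq_zero.1 ?_)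
    linear_combination 48 * σ * hb - 6 * hsum + 100 * hσ
  have hhμ : s.h * μ = 16 * σ := by
    refine sub_eq_zero.1 (SmoothScalar.eq_zero_of_ofNat_mul 3 ?_)
    linear_combination -E4 - 4 * hσQ - 2 * hQT
  have hhσ : 3 * s.h * σ' = 16 * σ := by
    refine sub_eq_zero.1 (SmoothScalar.eq_zero_of_ofNat_mul 2 ?_)
    linear_combination 2 * hσQ + hQT + 3 * hhμ
  have hhQ : s.h • Q = (16 : SmoothScalar U) • T - (s.h * s.h * σ) • s.N := by
    rw [hQ']
    linear_combination (norm := module) congrArg (· • V) hhμ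
  -- Integrability once more: equality of the mixed derivatives of T in `E2`.
  have hDQ : 𝐝 0 s.h • 𝐃 1 Q = 𝐝 1 s.h • 𝐃 0 Q := by
    have h0 := congrArg (𝐃 1) (E2 0)
    have h1 := congrArg (𝐃 0) (E2 1)
    simp only [pderivField_smul, map_add, map_neg, pderiv_ofNat, pderivField_comm 1 0 T,
      pderivField_comm 1 0 s.X, pderiv_comm 1 0 s.h] at h0 h1
    linear_combination (norm := module) h1 - h0
  -- Inserting `hhQ` into `hDQ` leaves (5h³σ - 80) dh ∧ dX = 0, so h³σ = 16.
  have hk : 5 * (s.h * s.h * s.h * σ) - 80 = 0 := by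
    have h0 := congrArg (𝐃 0) hhQ
    have h1 := congrArg (𝐃 1) hhQ
    simp only [pderivField_smul, map_sub, pderiv_ofNat, Derivation.leibniz, hσ', smul_eq_mul]
      at h0 h1
    obtain ⟨k1, k2⟩ := s.eq_zero_of_smul_smul_DX (k := 5 * (s.h * s.h * s.h * σ) - 80)
      (a := 𝐝 0 s.h) (b := 𝐝 1 s.h) (by
        linear_combination (norm := module) (-4 * 𝐝 0 s.h) • h1 + (4 * 𝐝 1 s.h) • h0 +
          (4 * s.h) • hDQ - (16 * 𝐝 0 s.h) • E2 1 + (16 * 𝐝 1 s.h) • E2 0 +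
          (s.h * s.h * σ * 𝐝 0 s.h) • E1 1 - (s.h * s.h * σ * 𝐝 1 s.h) • E1 0)
    refine s.eq_zero_of_pderiv_mul hq fun i => ?_
    rw [mul_comm]
    fin_cases i <;> assumption
  -- Differentiating h³σ = 16 gives 3h²σ + h³σ' = 0, while 3hσ' = 16σ; hence 25h²σ = 0,
  -- contradicting 2σq = 3h.
  have h25 : s.h * s.h * (25 * σ) = 0 := by
    refine s.eq_zero_of_pderiv_mul hq fun i => SmoothScalar.eq_zero_of_ofNat_mul 5 ?_
    have h0 := congrArg (𝐝 i) hk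
    simp only [Derivation.leibniz, map_sub, pderiv_ofNat, smul_eq_mul, map_zero, hσ'] at h0
    linear_combination 3 * h0 - 5 * s.h * s.h * 𝐝 i s.h * hhσ
  have h0 := SmoothScalar.eq_zero_of_ofNat_mul 25 ((hh.mul hh).mul_right_eq_zero.1 h25)
  refine SmoothScalar.eq_zero_of_ofNat_mul 3 (hh.mul_right_eq_zero.1 ?_)
  linear_combination -hσ + 2 * q * h0

end OrientedPatch

end

/-! ### Restriction to smaller domains, and the characterisation by dh = 0 and h dK = 0. -/

section

section Restriction

variable {m : ℕ} {U V : Opens (EuclideanSpace ℝ (Fin m))} (hV : V ≤ U)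
  {E : Type*} [NormedAddCommGroup E] [InnerProductSpace ℝ E]

/-- Restriction of smooth functions to a smaller open set. -/
def restrict : SmoothScalar U →+* SmoothScalar V :=
  pullback (ContinuousLinearMap.id ℝ _) fun _ hy => hV hy

/-- Restriction of smooth vector-valued functions to a smaller open set. -/
def restrictField : SmoothField U E →+ SmoothField V E :=
  pullbackField (ContinuousLinearMap.id ℝ _) fun _ hy => hV hy

theorem restrict_apply (f : SmoothScalar U) (v : V) : restrict hV f v = f ⟨v, hV v.2⟩ :=
  pullback_apply _ _ _ _

theorem restrictField_apply (f : SmoothField U E) (v : V) :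
    restrictField hV f v = f ⟨v, hV v.2⟩ :=
  pullbackField_apply _ _ _ _

theorem pderiv_restrict (i : Fin m) (f : SmoothScalar U) :
    𝐝 i (restrict hV f) = restrict hV (𝐝 i f) :=
  pderiv_pullback _ _ rfl f

theorem pderivField_restrictField (i : Fin m) (f : SmoothField U E) :
    𝐃 i (restrictField hV f) = restrictField hV (𝐃 i f) :=
  pderivField_pullbackField _ _ rfl f

theorem restrict_innerField (f g : SmoothField U E) :
    restrict hV ⟪f, g⟫ = ⟪restrictField hV f, restrictField hV g⟫ :=
  pullback_innerField _ _ _ _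

theorem restrictField_smul (f : SmoothScalar U) (g : SmoothField U E) :
    restrictField hV (f • g) = restrict hV f • restrictField hV g :=
  pullbackField_smul _ _ _ _

end Restriction

namespace OrientedPatch

variable {U V : Opens (EuclideanSpace ℝ (Fin 2))} (s : OrientedPatch U) (hV : V ≤ U)

/-- Restriction of a patch to a smaller domain. -/
def restrict : OrientedPatch V where
  X := restrictField hV s.X
  N := restrictField hV s.N
  linearIndependent u := by
    simp only [pderivField_restrictField, restrictField_apply]
    exact s.linearIndependent ⟨u, hV u.2⟩
  inner_N_N := by rw [← restrict_innerField, s.inner_N_N, map_one]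
  inner_N_X i := by rw [pderivField_restrictField, ← restrict_innerField, s.inner_N_X, map_zero]

theorem gram_restrict_X :
    gram (s.restrict hV).X = (gram s.X).map (NormalBundleSurface.restrict hV) := by
  ext i j : 2
  simp only [gram_apply, Matrix.map_apply, restrict_innerField, ← pderivField_restrictField]
  rfl

theorem J_restrict : (s.restrict hV).J = s.J.map (NormalBundleSurface.restrict hV) := by
  refine Matrix.inv_eq_right_inv ?_
  rw [gram_restrict_X, ← Matrix.map_mul, s.gram_mul_J]
  exact Matrix.map_one _ (map_zero _) (map_one _)

theorem II_restrict : (s.restrict hV).II = s.II.map (NormalBundleSurface.restrict hV) := by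
  ext i j : 2
  simp only [II, Matrix.of_apply, Matrix.map_apply, restrict_innerField,
    ← pderivField_restrictField]
  rfl

theorem S_restrict : (s.restrict hV).S = s.S.map (NormalBundleSurface.restrict hV) := by
  rw [S, J_restrict, II_restrict, ← Matrix.map_mul]; rfl

theorem h_restrict : (s.restrict hV).h = NormalBundleSurface.restrict hV s.h := by
  rw [h, S_restrict, h, map_add]; rfl

theorem K_restrict : (s.restrict hV).K = NormalBundleSurface.restrict hV s.K := by
  rw [K, S_restrict, K, map_sub, map_mul, map_mul]; rfl

theorem gradX_restrict (f : SmoothScalar U) :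
    (s.restrict hV).gradX (NormalBundleSurface.restrict hV f) = restrictField hV (s.gradX f) := by
  simp only [gradX, grad, J_restrict, map_sum, restrictField_smul, map_mul, Matrix.map_apply,
    pderiv_restrict, ← pderivField_restrictField]
  rfl

theorem isTangentiallyBiharmonic_iff {F : EuclideanSpace ℝ (Fin 3) → E6}
    (hF : ∀ w : cylinder U, F w = s.bundleMap w) :
    s.IsTangentiallyBiharmonic ↔ ∀ w : cylinder U, tangentialBitension F w = 0 := by
  have key : ∀ (w : cylinder U) k, inner ℝ (bitension F w) (partialD k F w) =
      ⟪s.lap (s.lap s.bundleMap), 𝐃 k s.bundleMap⟫ w := by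
    intro w k
    rw [bitension_eq hF s.isUnit_det_gram_bundleMap, ← pderivField_eq_partialD k hF,
      innerField_apply, gram_bundleMap_inv]
    rfl
  simp only [tangentialBitension_eq_zero_iff, key]
  constructor
  · intro h w k
    rw [h k]; rfl
  · intro h k
    ext w
    exact h w k

/-- Goes through the pointwise criterion for a map on all of ℝ³, for which restriction changes
nothing; no operator of the normal bundle has to be restricted. -/
theorem IsTangentiallyBiharmonic.restrict {s : OrientedPatch U} (hs : s.IsTangentiallyBiharmonic) :
    (s.restrict hV).IsTangentiallyBiharmonic := by
  have hF : ∀ w : cylinder V, extendZero s.bundleMap w = (s.restrict hV).bundleMap w := by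
    intro w
    have hw : (w : EuclideanSpace ℝ (Fin 3)) ∈ cylinder U := hV (mem_cylinder.1 w.2)
    rw [extendZero_of_mem _ hw]
    simp only [bundleMap, SmoothField.of_apply, extendZero_of_mem _ (mem_cylinder.1 hw),
      extendZero_of_mem _ (mem_cylinder.1 w.2)]
    simp only [OrientedPatch.restrict]
    rw [restrictField_apply, restrictField_apply]
  rw [isTangentiallyBiharmonic_iff _ hF]
  have h := (s.isTangentiallyBiharmonic_iff fun w => extendZero_apply s.bundleMap w).1 hs
  exact fun w => h ⟨w, hV (mem_cylinder.1 w.2)⟩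

/-- The mean curvature of a surface with tangentially biharmonic normal bundle is constant. -/
theorem pderiv_h_eq_zero (hs : s.IsTangentiallyBiharmonic) (i : Fin 2) : 𝐝 i s.h = 0 := by
  set f := s.h * ⟪s.gradX s.h, s.gradX s.h⟫ with hf
  -- The open set where h and grad h are both nonzero. On it 1 = 0 holds in the ring of functions,
  -- so it is empty.
  let V : Opens (EuclideanSpace ℝ (Fin 2)) := ⟨U ∩ extendZero f ⁻¹' {0}ᶜ,
    f.contDiffOn.continuousOn.isOpen_inter_preimage U.isOpen isOpen_compl_singleton⟩
  have hV : V ≤ U := fun y hy => hy.1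
  have hfV : IsUnit (NormalBundleSurface.restrict hV f) := by
    refine SmoothScalar.isUnit_of_ne_zero fun v => ?_
    rw [restrict_apply, ← extendZero_apply (f : U → ℝ)]
    exact v.2.2
  rw [hf, map_mul, IsUnit.mul_iff, restrict_innerField, ← gradX_restrict, ← h_restrict] at hfV
  have h10 := (s.restrict hV).one_eq_zero_of_isUnit (hs.restrict hV) hfV.1 hfV.2
  have hf0 : f = 0 := by
    ext u
    by_contra hu
    have h := congrArg (SmoothScalar.eval (⟨u, u.2, by
      rw [Set.mem_preimage, extendZero_apply]; exact hu⟩ : V)) h10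
    simp at h
  have hV0 : s.h • s.gradX s.h = 0 := by
    refine SmoothField.ext fun u => ?_
    have h := congrArg (SmoothScalar.eval u) hf0
    simp only [hf, SmoothScalar.eval_apply, SmoothScalar.mul_apply, innerField_apply,
      SmoothScalar.zero_apply, mul_eq_zero, inner_self_eq_zero] at h
    rw [SmoothField.smul_apply]
    rcases h with h | h <;> rw [h] <;> simp
  have h1 : s.h * 𝐝 i s.h = 0 := by
    rw [← s.inner_gradX_DX, ← smul_eq_mul, ← LinearMap.smul_apply, ← map_smul, hV0, map_zero,
      LinearMap.zero_apply]
  -- From h ∂ᵢh = 0 one gets (∂ᵢh)² + h ∂ᵢ∂ᵢh = 0; multiplication by ∂ᵢh leaves (∂ᵢh)³ = 0.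
  have h2 := congrArg (𝐝 i) h1
  rw [Derivation.leibniz, map_zero] at h2
  simp only [smul_eq_mul] at h2
  refine SmoothScalar.eq_zero_of_pow (n := 3) ?_
  linear_combination 𝐝 i s.h * h2 - 𝐝 i (𝐝 i s.h) * h1

theorem isTangentiallyBiharmonic_iff_pderiv : s.IsTangentiallyBiharmonic ↔
    (∀ i, 𝐝 i s.h = 0) ∧ ∀ i, s.h * 𝐝 i s.K = 0 :=
  ⟨fun hs => ⟨s.pderiv_h_eq_zero hs, s.h_mul_pderiv_K hs (s.pderiv_h_eq_zero hs)⟩,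
    fun h => s.isTangentiallyBiharmonic_of_const h.1 h.2⟩

end OrientedPatch

end

/-! ### Distinct constant principal curvatures force K = 0. -/

section

namespace OrientedPatch

variable {U : Opens (EuclideanSpace ℝ (Fin 2))} (s : OrientedPatch U)

/-- The parallel field `N + a X`. -/
def parallel (a : SmoothScalar U) : SmoothField U E3 := s.N + a • s.X

variable {s} {a b : SmoothScalar U}

theorem D_parallel (ha : ∀ i, 𝐝 i a = 0) (i : Fin 2) :
    𝐃 i (s.parallel a) = 𝐃 i s.N + a • 𝐃 i s.X := by
  rw [parallel, map_add, pderivField_smul, ha, zero_smul, zero_add]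

theorem inner_D_parallel_N (ha : ∀ i, 𝐝 i a = 0) (i : Fin 2) : ⟪𝐃 i (s.parallel a), s.N⟫ = 0 := by
  simp [D_parallel ha, inner_DN_N, inner_X_N]

/-- The differential of N + bX is b - S, and (S - a)(S - b) = 0: its image is a principal direction,
on which S acts by a. -/
theorem sum_S_smul_D_parallel (hb : ∀ i, 𝐝 i b = 0) (hh : s.h = a + b)
    (hK : s.K = a * b) (j : Fin 2) : s.S 0 j • 𝐃 0 (s.parallel b) + s.S 1 j • 𝐃 1 (s.parallel b) =
      a • 𝐃 j (s.parallel b) := by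
  rw [h] at hh
  rw [K] at hK
  simp only [D_parallel hb, DN_eq, Fin.sum_univ_two]
  fin_cases j
  · simp only [Fin.zero_eta]
    linear_combination (norm := module) (-s.S 0 0 • congrArg (· • 𝐃 0 s.X) hh) -
      s.S 1 0 • congrArg (· • 𝐃 1 s.X) hh + congrArg (· • 𝐃 0 s.X) hK
  · simp only [Fin.mk_one]
    linear_combination (norm := module) (-s.S 0 1 • congrArg (· • 𝐃 0 s.X) hh) -
      s.S 1 1 • congrArg (· • 𝐃 1 s.X) hh + congrArg (· • 𝐃 1 s.X) hK

/-- The product is that of (a - S) and (b - S) under a self-adjoint S, which is zero by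
Cayley-Hamilton. No distinctness is needed. -/
theorem inner_D_parallel_D_parallel (ha : ∀ i, 𝐝 i a = 0) (hb : ∀ i, 𝐝 i b = 0)
    (hh : s.h = a + b) (hK : s.K = a * b) (i j : Fin 2) :
    ⟪𝐃 i (s.parallel a), 𝐃 j (s.parallel b)⟫ = 0 := by
  have hII : ∀ k, ⟪𝐃 k (s.parallel b), 𝐃 i s.N⟫ =
      -(s.S 0 i * ⟪𝐃 k (s.parallel b), 𝐃 0 s.X⟫ + s.S 1 i * ⟪𝐃 k (s.parallel b), 𝐃 1 s.X⟫) := by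
    intro k
    rw [s.DN_eq i]
    simp only [Fin.sum_univ_two, map_neg, map_add, map_smul, smul_eq_mul]
  have hsymm : ∀ k l, ⟪𝐃 k (s.parallel b), 𝐃 l s.X⟫ = ⟪𝐃 l (s.parallel b), 𝐃 k s.X⟫ := by
    intro k l
    simp only [D_parallel hb, map_add, map_smul, LinearMap.add_apply, LinearMap.smul_apply,
      inner_DN_DX, s.II_symm k l, innerField_comm (𝐃 k s.X)]
  have h0 := congrArg (fun v => ⟪v, 𝐃 j s.X⟫) (sum_S_smul_D_parallel hb hh hK i)
  simp only [map_add, map_smul, LinearMap.add_apply, LinearMap.smul_apply, smul_eq_mul] at h0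
  rw [innerField_comm, D_parallel ha]
  simp only [map_add, map_smul, smul_eq_mul, hII]
  rw [hsymm j 0, hsymm j 1, hsymm j i]
  linear_combination -h0

/-- The expression is totally symmetric in its indices: in i, k by commuting derivatives, in i, j by
differentiating the orthogonality of dA and dB. Contraction with S acts as a in the slot of B and as
b in the slot of A, so b - a annihilates it. -/
theorem inner_DD_parallel_D_parallel (ha : ∀ i, 𝐝 i a = 0) (hb : ∀ i, 𝐝 i b = 0)
    (hab : IsUnit (b - a)) (hh : s.h = a + b) (hK : s.K = a * b) (i k j : Fin 2) :
    ⟪𝐃 i (𝐃 k (s.parallel a)), 𝐃 j (s.parallel b)⟫ = 0 := by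
  set A := s.parallel a with hA
  set B := s.parallel b with hB
  have horth := inner_D_parallel_D_parallel ha hb hh hK
  have h1 : ∀ i k j, ⟪𝐃 i (𝐃 k A), 𝐃 j B⟫ = -⟪𝐃 k A, 𝐃 i (𝐃 j B)⟫ := by
    intro i k j
    have := congrArg (𝐝 i) (horth k j)
    rw [pderiv_innerField, map_zero] at this
    exact eq_neg_of_add_eq_zero_left this
  have hs1 : ∀ i k j, ⟪𝐃 i (𝐃 k A), 𝐃 j B⟫ = ⟪𝐃 k (𝐃 i A), 𝐃 j B⟫ := fun i k j => by
    rw [pderivField_comm]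
  have hs2 : ∀ i k j, ⟪𝐃 i (𝐃 k A), 𝐃 j B⟫ = ⟪𝐃 j (𝐃 k A), 𝐃 i B⟫ := fun i k j => by
    rw [h1, h1, pderivField_comm]
  have e1 : ∀ i k j, s.S 0 j * ⟪𝐃 i (𝐃 k A), 𝐃 0 B⟫ + s.S 1 j * ⟪𝐃 i (𝐃 k A), 𝐃 1 B⟫ =
      a * ⟪𝐃 i (𝐃 k A), 𝐃 j B⟫ := by
    intro i k j
    have := congrArg (fun v => ⟪𝐃 i (𝐃 k A), v⟫) (sum_S_smul_D_parallel hb hh hK j)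
    simpa only [map_add, map_smul, smul_eq_mul] using this
  have e2 : ∀ i k j, s.S 0 k * ⟪𝐃 i (𝐃 0 A), 𝐃 j B⟫ + s.S 1 k * ⟪𝐃 i (𝐃 1 A), 𝐃 j B⟫ =
      b * ⟪𝐃 i (𝐃 k A), 𝐃 j B⟫ := by
    intro i k j
    have := congrArg (fun v => ⟪v, 𝐃 i (𝐃 j B)⟫) (sum_S_smul_D_parallel ha
      (hh.trans (add_comm _ _)) (hK.trans (mul_comm _ _)) k)
    simp only [map_add, map_smul, LinearMap.add_apply, LinearMap.smul_apply, smul_eq_mul] at this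
    simp only [h1]
    linear_combination -this
  refine hab.mul_right_eq_zero.1 ?_
  have f1 := e1 i k j
  have f2 := e2 i j k
  rw [hs1 i j k, hs1 i 0 k, hs1 i 1 k, hs2 j i k, hs2 0 i k, hs2 1 i k, hs1 k i j, hs1 k i 0,
    hs1 k i 1] at f2
  linear_combination f1 - f2

theorem exists_eq_frame (s : OrientedPatch U) (P : SmoothField U E3) : ∃ p : Fin 2 → SmoothScalar U,
    P = ⟪P, s.N⟫ • s.N + (p 0 • 𝐃 0 s.X + p 1 • 𝐃 1 s.X) := by
  refine ⟨fun m => s.J 0 m * ⟪P, 𝐃 0 s.X⟫ + s.J 1 m * ⟪P, 𝐃 1 s.X⟫, s.eq_of_inner (fun k => ?_) ?_⟩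
  · have j0 := s.J_gram_apply 0 k
    have j1 := s.J_gram_apply 1 k
    simp only [map_add, map_smul, LinearMap.add_apply, LinearMap.smul_apply, smul_eq_mul,
      s.inner_N_X, ← gram_apply]
    fin_cases k
    · simp only [Fin.zero_eta, if_true, if_false, one_ne_zero] at *
      linear_combination -⟪P, 𝐃 0 s.X⟫ * j0 - ⟪P, 𝐃 1 s.X⟫ * j1
    · simp only [Fin.mk_one, if_true, if_false, zero_ne_one] at *
      linear_combination -⟪P, 𝐃 0 s.X⟫ * j0 - ⟪P, 𝐃 1 s.X⟫ * j1
  · simp [inner_N_N, inner_X_N]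

/-- Tangentially, second derivatives of A stay orthogonal to dB and those of B to dA, so in the
product only the normal parts meet. -/
theorem inner_DD_parallel_DD_parallel (ha : ∀ i, 𝐝 i a = 0) (hb : ∀ i, 𝐝 i b = 0)
    (hab : IsUnit (b - a)) (hh : s.h = a + b) (hK : s.K = a * b) (i j k l : Fin 2) :
    ⟪𝐃 i (𝐃 j (s.parallel a)), 𝐃 k (𝐃 l (s.parallel b))⟫ =
      ⟪𝐃 i (𝐃 j (s.parallel a)), s.N⟫ * ⟪𝐃 k (𝐃 l (s.parallel b)), s.N⟫ := by
  set A := s.parallel a with hA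
  set B := s.parallel b with hB
  have horth : ∀ i j, ⟪𝐃 i A, 𝐃 j B⟫ = 0 := inner_D_parallel_D_parallel ha hb hh hK
  have hAB : ∀ i k j, ⟪𝐃 i (𝐃 k A), 𝐃 j B⟫ = 0 := inner_DD_parallel_D_parallel ha hb hab hh hK
  have hBA : ∀ i j k, ⟪𝐃 i (𝐃 j B), 𝐃 k A⟫ = 0 := by
    intro i j k
    have := congrArg (𝐝 i) (horth k j)
    rwa [pderiv_innerField, map_zero, hAB, zero_add, innerField_comm] at this
  have hBN : ∀ m, ⟪𝐃 m B, s.N⟫ = 0 := inner_D_parallel_N hb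
  set P := 𝐃 i (𝐃 j A)
  have hX : ∀ m, (b - a) • 𝐃 m s.X = 𝐃 m B - 𝐃 m A := fun m => by
    rw [hA, hB, D_parallel ha, D_parallel hb]; module
  obtain ⟨p, hp⟩ := s.exists_eq_frame P
  -- The image under dB of the tangential coordinates of P: it is orthogonal to dB by the previous
  -- lemma and to dA because dA and dB are orthogonal.
  have hQ : p 0 • 𝐃 0 B + p 1 • 𝐃 1 B = 0 := by
    have hQB : ∀ m, ⟪p 0 • 𝐃 0 B + p 1 • 𝐃 1 B, 𝐃 m B⟫ = 0 := by
      intro m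
      have h1 := congrArg (fun v => (b - a) * ⟪v, 𝐃 m B⟫) hp
      have h2 : ∀ n, (b - a) * ⟪𝐃 n s.X, 𝐃 m B⟫ = ⟪𝐃 n B, 𝐃 m B⟫ := fun n => by
        rw [← smul_eq_mul, ← LinearMap.smul_apply, ← map_smul, hX, map_sub, LinearMap.sub_apply,
          horth, sub_zero]
      simp only [P, hAB, map_add, map_smul, LinearMap.add_apply, LinearMap.smul_apply, smul_eq_mul,
        innerField_comm s.N, hBN] at h1
      simp only [map_add, map_smul, LinearMap.add_apply, LinearMap.smul_apply, smul_eq_mul, ← h2]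
      linear_combination -h1
    refine s.eq_zero (fun m => hab.mul_right_eq_zero.1 ?_) ?_
    · rw [← smul_eq_mul, ← map_smul, hX, map_sub, hQB]
      simp only [map_add, map_smul, LinearMap.add_apply, LinearMap.smul_apply, smul_eq_mul,
        innerField_comm (𝐃 _ B) (𝐃 m A), horth]
      ring
    · simp [hBN]
  have h1 := congrArg (fun v => (b - a) * ⟪v, 𝐃 k (𝐃 l B)⟫) hp
  have h2 : ∀ n, (b - a) * ⟪𝐃 n s.X, 𝐃 k (𝐃 l B)⟫ = ⟪𝐃 n B, 𝐃 k (𝐃 l B)⟫ := fun n => by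
    rw [← smul_eq_mul, ← LinearMap.smul_apply, ← map_smul, hX, map_sub, LinearMap.sub_apply,
      innerField_comm (𝐃 n A), hBA, sub_zero]
  have h3 := congrArg (fun v => ⟪v, 𝐃 k (𝐃 l B)⟫) hQ
  simp only [map_add, map_smul, LinearMap.add_apply, LinearMap.smul_apply, smul_eq_mul, map_zero,
    LinearMap.zero_apply, innerField_comm s.N] at h1 h3
  refine hab.mul_left_cancel ?_
  linear_combination h1 + h3 + p 0 * h2 0 + p 1 * h2 1

/-- An isoparametric surface with distinct principal curvatures is flat. -/
theorem mul_eq_zero_of_isUnit_sub (ha : ∀ i, 𝐝 i a = 0) (hb : ∀ i, 𝐝 i b = 0)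
    (hab : IsUnit (b - a)) (hh : s.h = a + b) (hK : s.K = a * b) : a * b = 0 := by
  set A := s.parallel a with hA
  set B := s.parallel b with hB
  have hAB : ∀ i k j, ⟪𝐃 i (𝐃 k A), 𝐃 j B⟫ = 0 := inner_DD_parallel_D_parallel ha hb hab hh hK
  have hX : ∀ m, (b - a) • 𝐃 m s.X = 𝐃 m B - 𝐃 m A := fun m => by
    rw [hA, hB, D_parallel ha, D_parallel hb]; module
  have hN : ∀ m, (b - a) • 𝐃 m s.N = b • 𝐃 m A - a • 𝐃 m B := fun m => by
    rw [hA, hB, D_parallel ha, D_parallel hb]; module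
  have horth : ∀ i j, ⟪𝐃 i A, 𝐃 j B⟫ = 0 := inner_D_parallel_D_parallel ha hb hh hK
  have hAN : ∀ i j, (b - a) * ⟪𝐃 i (𝐃 j A), s.N⟫ = -(b * ⟪𝐃 j A, 𝐃 i A⟫) := by
    intro i j
    have h1 := congrArg (𝐝 i) (inner_D_parallel_N (s := s) ha j)
    rw [pderiv_innerField, map_zero, ← hA] at h1
    have h2 := congrArg (fun v => ⟪𝐃 j A, v⟫) (hN i)
    simp only [map_sub, map_smul, smul_eq_mul, horth] at h2
    linear_combination (b - a) * h1 - h2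
  have hBN : ∀ i j, (b - a) * ⟪𝐃 i (𝐃 j B), s.N⟫ = a * ⟪𝐃 i B, 𝐃 j B⟫ := by
    intro i j
    have h1 := congrArg (𝐝 i) (inner_D_parallel_N (s := s) hb j)
    rw [pderiv_innerField, map_zero, ← hB] at h1
    have h2 := congrArg (fun v => ⟪v, 𝐃 j B⟫) (hN i)
    simp only [map_sub, map_smul, LinearMap.sub_apply, LinearMap.smul_apply, smul_eq_mul,
      horth] at h2
    rw [innerField_comm (𝐃 j B)] at h1
    linear_combination (b - a) * h1 - h2
  -- Differentiate `hAB` and antisymmetrise in j and k: the third derivatives cancel, and products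
  -- of normal components remain. This is the Gauss equation in disguise.
  have hGauss : ∀ i j k l, a * b * (⟪𝐃 i A, 𝐃 j A⟫ * ⟪𝐃 k B, 𝐃 l B⟫) =
      a * b * (⟪𝐃 i A, 𝐃 k A⟫ * ⟪𝐃 j B, 𝐃 l B⟫) := by
    intro i j k l
    have h1 := congrArg (𝐝 k) (hAB j i l)
    have h2 := congrArg (𝐝 j) (hAB k i l)
    rw [pderiv_innerField, map_zero, inner_DD_parallel_DD_parallel ha hb hab hh hK] at h1 h2
    rw [pderivField_comm k j] at h1
    rw [← hA, ← hB] at h1 h2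
    linear_combination (-(b - a) ^ 2 * h1 + (b - a) ^ 2 * h2 +
      (b - a) * ⟪𝐃 k (𝐃 l B), s.N⟫ * hAN j i - b * ⟪𝐃 i A, 𝐃 j A⟫ * hBN k l -
      (b - a) * ⟪𝐃 j (𝐃 l B), s.N⟫ * hAN k i + b * ⟪𝐃 i A, 𝐃 k A⟫ * hBN j l)
  -- Contract the index j of `hGauss` with S: on the left it hits A and gives b, on the right it
  -- hits B and gives a.
  have hzero : ∀ i j k l, a * b * (⟪𝐃 i A, 𝐃 j A⟫ * ⟪𝐃 k B, 𝐃 l B⟫) = 0 := by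
    intro i j k l
    have h1 := congrArg (fun v => ⟪𝐃 i A, v⟫) (sum_S_smul_D_parallel ha
      (hh.trans (add_comm _ _)) (hK.trans (mul_comm _ _)) j)
    have h2 := congrArg (fun v => ⟪v, 𝐃 l B⟫) (sum_S_smul_D_parallel hb hh hK j)
    simp only [map_add, map_smul, LinearMap.add_apply, LinearMap.smul_apply, smul_eq_mul, ← hA,
      ← hB] at h1 h2
    refine hab.mul_right_eq_zero.1 ?_
    linear_combination -a * b * ⟪𝐃 k B, 𝐃 l B⟫ * h1 + a * b * ⟪𝐃 i A, 𝐃 k A⟫ * h2 +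
      s.S 0 j * hGauss i 0 k l + s.S 1 j * hGauss i 1 k l - a * hGauss i j k l
  have htr : ∀ c, ∑ i, ∑ j, s.J i j * (c * gram s.X i j - s.II i j) = 2 * c - s.h := by
    intro c
    have h1 := s.sum_J_gram
    have h2 := s.sum_J_II
    simp only [Fin.sum_univ_two] at h1 h2 ⊢
    linear_combination c * h1 - h2
  have hα : ∑ i, ∑ j, s.J i j * ⟪𝐃 i A, 𝐃 j A⟫ = (b - a) ^ 2 := by
    have h1 := htr a
    have h2 : ∀ i j, ⟪𝐃 i A, 𝐃 j A⟫ = -((b - a) * (a * gram s.X i j - s.II i j)) := by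
      intro i j
      have h3 := congrArg (fun v => ⟪𝐃 i A, v⟫) (hX j)
      simp only [map_sub, map_smul, smul_eq_mul, horth] at h3
      have h4 : ⟪𝐃 i A, 𝐃 j s.X⟫ = a * gram s.X i j - s.II i j := by
        simp only [hA, D_parallel ha, map_add, map_smul, LinearMap.add_apply,
          LinearMap.smul_apply, smul_eq_mul, inner_DN_DX, gram_apply]
        ring
      linear_combination h3 - (b - a) * h4
    simp only [h2]
    simp only [Fin.sum_univ_two] at h1 ⊢
    linear_combination -(b - a) * h1 + (b - a) * hh
  have hβ : ∑ i, ∑ j, s.J i j * ⟪𝐃 i B, 𝐃 j B⟫ = (b - a) ^ 2 := by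
    have h1 := htr b
    have h2 : ∀ i j, ⟪𝐃 i B, 𝐃 j B⟫ = (b - a) * (b * gram s.X i j - s.II i j) := by
      intro i j
      have h3 := congrArg (fun v => ⟪𝐃 i B, v⟫) (hX j)
      simp only [map_sub, map_smul, smul_eq_mul, innerField_comm (𝐃 i B) (𝐃 j A), horth] at h3
      have h4 : ⟪𝐃 i B, 𝐃 j s.X⟫ = b * gram s.X i j - s.II i j := by
        simp only [hB, D_parallel hb, map_add, map_smul, LinearMap.add_apply,
          LinearMap.smul_apply, smul_eq_mul, inner_DN_DX, gram_apply]
        ring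
      linear_combination -h3 + (b - a) * h4
    simp only [h2]
    simp only [Fin.sum_univ_two] at h1 ⊢
    linear_combination (b - a) * h1 - (b - a) * hh
  -- Both metric traces `hα` and `hβ` equal (b - a)², so tracing `hzero` gives ab(b - a)⁴ = 0.
  refine (hab.pow 4).mul_right_eq_zero.1 ?_
  have hfin : a * b * ((∑ i, ∑ j, s.J i j * ⟪𝐃 i A, 𝐃 j A⟫) *
      ∑ k, ∑ l, s.J k l * ⟪𝐃 k B, 𝐃 l B⟫) = 0 := by
    simp only [Finset.sum_mul, Finset.mul_sum]
    refine Finset.sum_eq_zero fun i _ => Finset.sum_eq_zero fun j _ => Finset.sum_eq_zero fun k _ =>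
      Finset.sum_eq_zero fun l _ => ?_
    linear_combination s.J k l * s.J i j * hzero k l i j
  rw [hα, hβ] at hfin
  linear_combination hfin

end OrientedPatch

end

/-! ### Constancy from vanishing derivatives; umbilic patches and flat patches. -/

section

section Constants

variable {m : ℕ} {U : Opens (EuclideanSpace ℝ (Fin m))}
  {E : Type*} [NormedAddCommGroup E] [InnerProductSpace ℝ E]

theorem fderiv_eq_zero_of_partialD {ψ : EuclideanSpace ℝ (Fin m) → E} {y : EuclideanSpace ℝ (Fin m)}
    (h : ∀ i, partialD i ψ y = 0) : fderiv ℝ ψ y = 0 := by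
  refine ContinuousLinearMap.coe_injective
    ((EuclideanSpace.basisFun (Fin m) ℝ).toBasis.ext fun i => ?_)
  simpa [partialD] using h i

theorem SmoothField.apply_eq_of_pderivField_eq_zero (hU : IsPreconnected (U : Set (EuclideanSpace ℝ (Fin m))))
    {ψ : SmoothField U E} (h : ∀ i, 𝐃 i ψ = 0) (u v : U) : ψ u = ψ v := by
  have hd : DifferentiableOn ℝ (extendZero ψ) U := ψ.contDiffOn.differentiableOn (by simp)
  have hz : (U : Set (EuclideanSpace ℝ (Fin m))).EqOn (fderiv ℝ (extendZero ψ)) 0 := fun y hy =>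
    fderiv_eq_zero_of_partialD fun i => congrArg (fun F : SmoothField U E => F ⟨y, hy⟩) (h i)
  have := U.isOpen.is_const_of_fderiv_eq_zero hU hd hz u.2 v.2
  rwa [extendZero_apply, extendZero_apply] at this

theorem SmoothScalar.apply_eq_of_pderiv_eq_zero (hU : IsPreconnected (U : Set (EuclideanSpace ℝ (Fin m))))
    {f : SmoothScalar U} (h : ∀ i, 𝐝 i f = 0) (u v : U) : f u = f v :=
  SmoothField.apply_eq_of_pderivField_eq_zero hU (ψ := (⟨f.1, f.2⟩ : SmoothField U ℝ))
    (fun i => SmoothField.ext fun w => congrArg (fun F : SmoothScalar U => F w) (h i)) u v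

/-- A constant vector field. -/
def constField (v : E) : SmoothField U E := .of (fun _ => v) contDiffOn_const

@[simp] theorem constField_apply (v : E) (u : U) : constField v u = v := rfl

@[simp] theorem pderivField_constField (i : Fin m) (v : E) :
    𝐃 i (constField v : SmoothField U E) = 0 :=
  SmoothField.ext fun w => by
    rw [pderivField_eq_partialD i (g := fun _ => v) (fun _ => rfl)]
    simp [partialD]

end Constants

namespace OrientedPatch

variable {U : Opens (EuclideanSpace ℝ (Fin 2))} {s : OrientedPatch U}

theorem parallel_zero : s.parallel 0 = s.N := by simp [parallel]

/-- Equality in 4K ≤ h² makes S equal to h/2 times the identity. For h ≠ 0 the constant field is h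
times the centre of the sphere. -/
theorem pderivField_two_smul_N_add (hh : ∀ i, 𝐝 i s.h = 0) (hK : 4 * s.K = s.h ^ 2) (i : Fin 2) :
    𝐃 i ((2 : SmoothScalar U) • s.N + s.h • s.X) = 0 := by
  have hu : ∀ u, s.S 0 1 u = 0 ∧ s.S 1 0 u = 0 ∧ s.S 0 0 u = s.S 1 1 u := fun u =>
    (s.four_mul_K_le u).2 (by
      simpa [SmoothScalar.eval_apply] using congrArg (SmoothScalar.eval u) hK)
  have h01 : s.S 0 1 = 0 := by ext u; exact (hu u).1
  have h10 : s.S 1 0 = 0 := by ext u; exact (hu u).2.1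
  have h00 : s.S 0 0 = s.S 1 1 := by ext u; exact (hu u).2.2
  rw [map_add, pderivField_smul, pderivField_smul, hh, pderiv_ofNat, DN_eq, Fin.sum_univ_two, h]
  fin_cases i
  · simp only [Fin.zero_eta, h10, h00]; module
  · simp only [Fin.mk_one, h01, h00]; module

/-- The principal curvatures are 0 and h, so N + hX has differential h - S of rank one: its partial
derivatives are parallel. Pairing with x expresses this without choosing a direction. -/
theorem inner_smul_D_parallel (hh : ∀ i, 𝐝 i s.h = 0) (hu : IsUnit s.h) (hK : s.K = 0)
    (j k : Fin 2) (x : SmoothField U E3) :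
    ⟪𝐃 j (s.parallel s.h), x⟫ • 𝐃 k (s.parallel s.h) =
      ⟪𝐃 k (s.parallel s.h), x⟫ • 𝐃 j (s.parallel s.h) := by
  have hB := sum_S_smul_D_parallel (s := s) (a := 0) hh (by rw [zero_add]) (by rw [hK, zero_mul])
  have key : ⟪𝐃 0 (s.parallel s.h), x⟫ • 𝐃 1 (s.parallel s.h) =
      ⟪𝐃 1 (s.parallel s.h), x⟫ • 𝐃 0 (s.parallel s.h) := by
    refine hu.smul_left_cancel.1 ?_
    have b0 := hB 0
    have b1 := hB 1
    have hS : s.h = s.S 0 0 + s.S 1 1 := rfl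
    have c0 := congrArg (fun v => ⟪v, x⟫) b0
    have c1 := congrArg (fun v => ⟪v, x⟫) b1
    simp only [map_add, map_smul, LinearMap.add_apply, LinearMap.smul_apply, smul_eq_mul] at c0 c1
    generalize 𝐃 0 (s.parallel s.h) = B0, 𝐃 1 (s.parallel s.h) = B1 at *
    rw [hS]
    linear_combination (norm := module) (congrArg (· • B1) c0) - (congrArg (· • B0) c1) +
      ⟪B0, x⟫ • b1 - ⟪B1, x⟫ • b0
  fin_cases j <;> fin_cases k
  · rfl
  · exact key
  · exact key.symm
  · rfl

/-- Second derivatives of N + hX are also parallel to its first ones: they are orthogonal to N and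
to dN, which span the complement of the ruling. Hence the direction of the ruling is constant. -/
theorem inner_smul_DD_parallel (hh : ∀ i, 𝐝 i s.h = 0) (hu : IsUnit s.h) (hK : s.K = 0)
    (i j k : Fin 2) (x : SmoothField U E3) :
    ⟪𝐃 i (s.parallel s.h), x⟫ • 𝐃 j (𝐃 k (s.parallel s.h)) =
      ⟪𝐃 j (𝐃 k (s.parallel s.h)), x⟫ • 𝐃 i (s.parallel s.h) := by
  have hpar := fun j k => inner_smul_D_parallel hh hu hK j k x
  have h0 : ∀ i, 𝐝 i (0 : SmoothScalar U) = 0 := fun i => map_zero _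
  have hha : s.h = 0 + s.h := (zero_add _).symm
  have hKa : s.K = 0 * s.h := by rw [hK, zero_mul]
  have hu' : IsUnit (s.h - 0) := by rwa [sub_zero]
  set B := s.parallel s.h with hB
  have horth : ∀ i j, ⟪𝐃 i s.N, 𝐃 j B⟫ = 0 := fun i j => by
    have := inner_D_parallel_D_parallel h0 hh hha hKa i j
    rwa [parallel_zero] at this
  have hNB : ∀ i k j, ⟪𝐃 i (𝐃 k s.N), 𝐃 j B⟫ = 0 := fun i k j => by
    have := inner_DD_parallel_D_parallel h0 hh hu' hha hKa i k j
    rwa [parallel_zero] at this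
  have hBN : ∀ i, ⟪𝐃 i B, s.N⟫ = 0 := inner_D_parallel_N hh
  have hDB : ∀ i, 𝐃 i B = 𝐃 i s.N + s.h • 𝐃 i s.X := D_parallel hh
  have hP1 : ∀ m, ⟪𝐃 j (𝐃 k B), 𝐃 m s.N⟫ = 0 := by
    intro m
    have := congrArg (𝐝 j) (horth m k)
    rwa [pderiv_innerField, map_zero, hNB, zero_add, innerField_comm] at this
  have hP2 : ⟪𝐃 j (𝐃 k B), s.N⟫ = 0 := by
    have := congrArg (𝐝 j) (hBN k)
    rwa [pderiv_innerField, map_zero, innerField_comm _ (𝐃 j s.N), horth, add_zero] at this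
  set P := 𝐃 j (𝐃 k B)
  obtain ⟨p, hp⟩ := s.exists_eq_frame P
  rw [hP2, zero_smul, zero_add] at hp
  have hR : p 0 • 𝐃 0 s.N + p 1 • 𝐃 1 s.N = 0 := by
    have hRN : ∀ m, ⟪p 0 • 𝐃 0 s.N + p 1 • 𝐃 1 s.N, 𝐃 m s.N⟫ = 0 := by
      intro m
      have h1 := hP1 m
      have h2 := horth m
      rw [hp] at h1
      simp only [hDB, map_add, map_smul, LinearMap.add_apply, LinearMap.smul_apply, smul_eq_mul,
        innerField_comm (𝐃 m s.N)] at h1 h2 ⊢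
      linear_combination p 0 * h2 0 + p 1 * h2 1 - s.h * h1
    refine s.eq_zero (fun m => hu.mul_right_eq_zero.1 ?_) ?_
    · have h1 : s.h • 𝐃 m s.X = 𝐃 m B - 𝐃 m s.N := by rw [hDB]; module
      rw [← smul_eq_mul, ← map_smul, h1, map_sub, hRN]
      simp only [map_add, map_smul, LinearMap.add_apply, LinearMap.smul_apply, smul_eq_mul, horth]
      ring
    · simp [inner_DN_N]
  have hPB : s.h • P = p 0 • 𝐃 0 B + p 1 • 𝐃 1 B := by
    rw [hDB, hDB]
    nth_rw 1 [hp]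
    linear_combination (norm := module) -hR
  refine hu.smul_left_cancel.1 ?_
  have h1 := congrArg (fun v => ⟪v, x⟫) hPB
  simp only [map_add, map_smul, LinearMap.add_apply, LinearMap.smul_apply, smul_eq_mul] at h1
  linear_combination (norm := module) ⟪𝐃 i B, x⟫ • hPB - congrArg (· • 𝐃 i B) h1 +
    p 0 • hpar i 0 + p 1 • hpar i 1

/-- A flat surface with constant nonzero mean curvature is contained in a circular cylinder. -/
theorem exists_line (hU : IsPreconnected (U : Set (EuclideanSpace ℝ (Fin 2))))
    (hh : ∀ i, 𝐝 i s.h = 0) (hu : IsUnit s.h) (hK : s.K = 0) (i : Fin 2) (v : E3)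
    (hv : IsUnit ⟪𝐃 i (s.parallel s.h), constField v⟫) (u₀ : U) :
    ∃ w : E3, ‖w‖ = 1 ∧ (∀ u, inner ℝ (s.N u) w = 0) ∧
      ∀ u, s.parallel s.h u - s.parallel s.h u₀ ∈ Submodule.span ℝ {w} := by
  set B := s.parallel s.h with hB
  -- The multiple of ∂ᵢB whose pairing with v is 1 has zero derivative, and its constant value is
  -- the direction of the axis.
  obtain ⟨r, hr⟩ := hv.exists_left_inv
  set g := ⟪𝐃 i B, constField v⟫ with hg
  have hψ : ∀ k, 𝐃 k (r • 𝐃 i B) = 0 := by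
    intro k
    have h1 := congrArg (𝐝 k) hr
    have h2 := inner_smul_DD_parallel hh hu hK i k i (constField v)
    have h3 : 𝐝 k g = ⟪𝐃 k (𝐃 i B), constField v⟫ := by
      rw [hg, pderiv_innerField, pderivField_constField, map_zero, add_zero]
    rw [← hB, ← h3, ← hg] at h2
    rw [Derivation.leibniz, Derivation.map_one_eq_zero, smul_eq_mul, smul_eq_mul] at h1
    rw [pderivField_smul]
    refine hv.smul_left_cancel.1 ?_
    linear_combination (norm := module) congrArg (· • 𝐃 i B) h1 + r • h2
  have hconst := SmoothField.apply_eq_of_pderivField_eq_zero hU hψ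
  set w := (r • 𝐃 i B) u₀ with hw
  have hwu : ∀ u, r u • 𝐃 i B u = w := fun u => hconst u u₀
  have hw0 : w ≠ 0 := by
    intro h0
    have h1 := congrArg (SmoothScalar.eval u₀) hr
    simp only [SmoothScalar.eval_apply, SmoothScalar.mul_apply, hg, innerField_apply,
      constField_apply, SmoothScalar.one_apply] at h1
    rw [← real_inner_smul_left, hwu, h0, inner_zero_left] at h1
    exact zero_ne_one h1
  have hspan : Submodule.span ℝ {‖w‖⁻¹ • w} = Submodule.span ℝ {w} :=
    Submodule.span_singleton_smul_eq (IsUnit.mk0 _ (inv_ne_zero (norm_ne_zero_iff.2 hw0))) w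
  refine ⟨‖w‖⁻¹ • w, by rw [norm_smul, norm_inv, norm_norm, inv_mul_cancel₀ (norm_ne_zero_iff.2 hw0)],
    fun u => ?_, fun u => ?_⟩
  · have h1 := congrArg (SmoothScalar.eval u) (inner_D_parallel_N hh i (s := s))
    simp only [SmoothScalar.eval_apply, innerField_apply, SmoothScalar.zero_apply, ← hB] at h1
    rw [inner_smul_right, ← hwu u, inner_smul_right, real_inner_comm, h1, mul_zero, mul_zero]
  · rw [hspan]
    -- All derivatives of B are multiples of w, so the projection of B away from w is constant.
    have hT : ∀ k, 𝐃 k (mapField (Submodule.span ℝ {w})ᗮ.starProjection B) = 0 := by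
      intro k
      refine SmoothField.ext fun u => ?_
      rw [pderivField_mapField, mapField_apply]
      refine (Submodule.starProjection_apply_eq_zero_iff _).2 ?_
      refine Submodule.le_orthogonal_orthogonal _ (Submodule.mem_span_singleton.2 ?_)
      have h1 := congrArg (fun F : SmoothField U E3 => F u)
        (inner_smul_D_parallel hh hu hK i k (constField v))
      have h2 := congrArg (SmoothScalar.eval u) hr
      simp only [SmoothField.smul_apply, ← hB, ← hg] at h1
      simp only [SmoothScalar.eval_apply, SmoothScalar.mul_apply, SmoothScalar.one_apply] at h2
      refine ⟨⟪𝐃 k B, constField v⟫ u, ?_⟩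
      rw [← hwu u, smul_comm, ← h1, smul_smul, h2, one_smul]
    have h1 := SmoothField.apply_eq_of_pderivField_eq_zero hU hT u u₀
    rw [mapField_apply, mapField_apply, ← sub_eq_zero, ← map_sub,
      Submodule.starProjection_apply_eq_zero_iff, Submodule.orthogonal_orthogonal] at h1
    exact h1

end OrientedPatch

end

/-! ### Local classification; spheres and cylinders satisfy the condition. -/

section

namespace OrientedPatch

variable {U : Opens (EuclideanSpace ℝ (Fin 2))} {s : OrientedPatch U}

theorem DN_apply (s : OrientedPatch U) (i : Fin 2) (u : U) :
    𝐃 i s.N u = -(s.S 0 i u • 𝐃 0 s.X u + s.S 1 i u • 𝐃 1 s.X u) := by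
  rw [DN_eq, Fin.sum_univ_two]; rfl

theorem S_apply_eq {u : U} {i : Fin 2} {c₀ c₁ : ℝ}
    (h : 𝐃 i s.N u = -(c₀ • 𝐃 0 s.X u + c₁ • 𝐃 1 s.X u)) : s.S 0 i u = c₀ ∧ s.S 1 i u = c₁ := by
  rw [DN_apply, neg_inj] at h
  have := LinearIndependent.pair_iff.1 (s.linearIndependent u) (s.S 0 i u - c₀) (s.S 1 i u - c₁)
    (by rw [sub_smul, sub_smul]; linear_combination (norm := module) h)
  exact ⟨sub_eq_zero.1 this.1, sub_eq_zero.1 this.2⟩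

theorem S_eq {i : Fin 2} {c₀ c₁ : SmoothScalar U}
    (h : 𝐃 i s.N = -(c₀ • 𝐃 0 s.X + c₁ • 𝐃 1 s.X)) : s.S 0 i = c₀ ∧ s.S 1 i = c₁ := by
  have hu : ∀ u, s.S 0 i u = c₀ u ∧ s.S 1 i u = c₁ u := fun u =>
    S_apply_eq (congrArg (fun F : SmoothField U E3 => F u) h)
  exact ⟨SmoothScalar.ext fun u => (hu u).1, SmoothScalar.ext fun u => (hu u).2⟩

theorem h_apply_eq_of_umbilic {u : U} {c : ℝ} (h : ∀ i, 𝐃 i s.N u = -(c • 𝐃 i s.X u)) :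
    s.h u = 2 * c := by
  have h0 := S_apply_eq (s := s) (u := u) (i := 0) (c₀ := c) (c₁ := 0) (by rw [h]; simp)
  have h1 := S_apply_eq (s := s) (u := u) (i := 1) (c₀ := 0) (c₁ := c) (by rw [h]; simp)
  rw [OrientedPatch.h, SmoothScalar.add_apply, h0.1, h1.2, two_mul]

theorem K_eq_zero_of_ne (hU : IsPreconnected (U : Set (EuclideanSpace ℝ (Fin 2)))) (u₀ : U)
    (hh : ∀ i, 𝐝 i s.h = 0) (hK : ∀ i, 𝐝 i s.K = 0) (hne : 4 * s.K u₀ ≠ s.h u₀ ^ 2) : s.K = 0 := by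
  have hhc := SmoothScalar.apply_eq_of_pderiv_eq_zero hU hh
  have hKc := SmoothScalar.apply_eq_of_pderiv_eq_zero hU hK
  -- The principal curvatures are (h ± d)/2. Evaluating at u₀ makes them real constants, whose
  -- derivatives vanish trivially.
  set d := √(s.h u₀ ^ 2 - 4 * s.K u₀) with hd
  have hlt : 0 < s.h u₀ ^ 2 - 4 * s.K u₀ :=
    sub_pos.2 (lt_of_le_of_ne (s.four_mul_K_le u₀).1 hne)
  have hd2 : d ^ 2 = s.h u₀ ^ 2 - 4 * s.K u₀ := Real.sq_sqrt hlt.le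
  have hd0 : d ≠ 0 := (Real.sqrt_pos.2 hlt).ne'
  have hK' : s.K = algebraMap ℝ _ ((s.h u₀ - d) / 2) * algebraMap ℝ _ ((s.h u₀ + d) / 2) := by
    ext u
    rw [SmoothScalar.mul_apply, SmoothScalar.algebraMap_apply, SmoothScalar.algebraMap_apply,
      hKc u u₀]
    linear_combination hd2 / 4
  rw [hK']
  refine mul_eq_zero_of_isUnit_sub (s := s) (fun i => Derivation.map_algebraMap _ _)
    (fun i => Derivation.map_algebraMap _ _) ?_ ?_ hK'
  · rw [← map_sub]
    refine IsUnit.map _ (IsUnit.mk0 _ ?_)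
    intro h
    exact hd0 (by linear_combination h)
  · ext u
    rw [SmoothScalar.add_apply, SmoothScalar.algebraMap_apply, SmoothScalar.algebraMap_apply,
      hhc u u₀]
    ring

/-- A surface with tangentially biharmonic normal bundle and nonvanishing mean curvature is locally
umbilic or flat. -/
theorem IsTangentiallyBiharmonic.umbilic_or_flat
    (hU : IsPreconnected (U : Set (EuclideanSpace ℝ (Fin 2)))) (u₀ : U)
    (hs : s.IsTangentiallyBiharmonic) (hu : IsUnit s.h) :
    (∀ i, 𝐃 i ((2 : SmoothScalar U) • s.N + s.h • s.X) = 0) ∨ s.K = 0 := by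
  obtain ⟨hh, hhK⟩ := s.isTangentiallyBiharmonic_iff_pderiv.1 hs
  have hK : ∀ i, 𝐝 i s.K = 0 := fun i => hu.mul_right_eq_zero.1 (hhK i)
  by_cases hne : 4 * s.K u₀ = s.h u₀ ^ 2
  · refine Or.inl (pderivField_two_smul_N_add hh ?_)
    ext u
    have h1 := SmoothScalar.apply_eq_of_pderiv_eq_zero hU hh u u₀
    have h2 := SmoothScalar.apply_eq_of_pderiv_eq_zero hU hK u u₀
    simp [h1, h2, hne]
  · exact Or.inr (K_eq_zero_of_ne hU u₀ hh hK hne)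

theorem pderiv_eq_zero_of_mul_eq_one {m : ℕ} {W : Opens (EuclideanSpace ℝ (Fin m))}
    {ρ ν : SmoothScalar W} (h : ρ * ν = 1) {i : Fin m} (hν : 𝐝 i ν = 0) : 𝐝 i ρ = 0 := by
  have h1 := congrArg (𝐝 i) h
  rw [Derivation.leibniz, hν, smul_zero, zero_add, Derivation.map_one_eq_zero, smul_eq_mul] at h1
  linear_combination ρ * h1 - 𝐝 i ρ * h

theorem eq_inner_smul_N {Y : SmoothField U E3} (hY : ∀ i, ⟪Y, 𝐃 i s.X⟫ = 0) :
    Y = ⟪Y, s.N⟫ • s.N :=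
  s.eq_of_inner (fun i => by simp [hY, inner_N_X]) (by simp [inner_N_N])

theorem inner_pderivField_of_sq {Y : SmoothField U E3} {r : ℝ} (hY : ∀ u, ‖Y u‖ = r) (i : Fin 2) :
    ⟪Y, 𝐃 i Y⟫ = 0 := by
  have h1 : ⟪Y, Y⟫ = algebraMap ℝ _ (r ^ 2) := by
    ext u
    rw [innerField_apply, real_inner_self_eq_norm_sq, hY, SmoothScalar.algebraMap_apply]
  have h2 := congrArg (𝐝 i) h1
  rw [pderiv_innerField, Derivation.map_algebraMap, innerField_comm (𝐃 i Y)] at h2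
  exact SmoothScalar.eq_zero_of_ofNat_mul 2 (by linear_combination h2)

theorem isUnit_of_eq_smul_N {Y : SmoothField U E3} {r : ℝ} (hr : 0 < r) (hY : ∀ u, ‖Y u‖ = r)
    {ν : SmoothScalar U} (h : Y = ν • s.N) : IsUnit ν := by
  refine SmoothScalar.isUnit_of_ne_zero fun u hu => ?_
  have := hY u
  rw [h, SmoothField.smul_apply, hu, zero_smul, norm_zero] at this
  exact hr.ne this

/-- The radius vector is normal, X - c = νN with ν constant and nonzero, so S is a constant multiple
of the identity. -/
theorem isTangentiallyBiharmonic_of_sphere {c : E3} {r : ℝ} (hr : 0 < r)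
    (hX : ∀ u, ‖s.X u - c‖ = r) : s.IsTangentiallyBiharmonic := by
  set Y := s.X - constField c with hYdef
  have hY : ∀ u, ‖Y u‖ = r := hX
  have hDY : ∀ i, 𝐃 i Y = 𝐃 i s.X := fun i => by
    rw [hYdef, map_sub, pderivField_constField, sub_zero]
  have hYN := eq_inner_smul_N (s := s) (Y := Y) fun i => by
    rw [← hDY, inner_pderivField_of_sq hY]
  set ν := ⟪Y, s.N⟫ with hν
  obtain ⟨ρ, hρ⟩ := (isUnit_of_eq_smul_N hr hY hYN).exists_left_inv
  have hDν : ∀ i, 𝐝 i ν = 0 := fun i => by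
    rw [hν, pderiv_innerField, hDY, inner_X_N, zero_add, hYN, map_smul, LinearMap.smul_apply,
      innerField_comm, inner_DN_N, smul_zero]
  have hDρ : ∀ i, 𝐝 i ρ = 0 := fun i => pderiv_eq_zero_of_mul_eq_one hρ (hDν i)
  have hDN : ∀ i, 𝐃 i s.N = ρ • 𝐃 i s.X := fun i => by
    rw [← hDY, hYN, pderivField_smul, hDν, zero_smul, zero_add, smul_smul, hρ, one_smul]
  obtain ⟨h00, h10⟩ := S_eq (s := s) (i := 0) (c₀ := -ρ) (c₁ := 0) (by rw [hDN]; module)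
  obtain ⟨h01, h11⟩ := S_eq (s := s) (i := 1) (c₀ := 0) (c₁ := -ρ) (by rw [hDN]; module)
  refine s.isTangentiallyBiharmonic_of_const (fun i => ?_) (fun i => ?_)
  · simp [h, h00, h11, hDρ]
  · simp [K, h00, h11, h10, h01, hDρ]

/-- The radial part Y of X - c is normal, Y = νN with ν constant, so dN = ν⁻¹(dX - ⟨dX, w⟩w). As w
is tangent, S has eigenvalues 0 and -ν⁻¹. -/
theorem isTangentiallyBiharmonic_of_cylinder {c w : E3} {r : ℝ} (hw : ‖w‖ = 1) (hr : 0 < r)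
    (hX : ∀ u, ‖(s.X u - c) - (inner ℝ (s.X u - c) w) • w‖ = r) : s.IsTangentiallyBiharmonic := by
  set Z := s.X - constField c with hZ
  set Y := Z - ⟪Z, constField w⟫ • constField w with hYdef
  have hY : ∀ u, ‖Y u‖ = r := fun u => by
    rw [← hX u, hYdef, hZ, SmoothField.sub_apply, SmoothField.smul_apply, innerField_apply]
    rfl
  have hww : ⟪(constField w : SmoothField U E3), constField w⟫ = 1 := by
    ext u
    simp [innerField_apply, hw]
  have hDZ : ∀ i, 𝐃 i Z = 𝐃 i s.X := fun i => by
    rw [hZ, map_sub, pderivField_constField, sub_zero]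
  have hDY : ∀ i, 𝐃 i Y = 𝐃 i s.X - ⟪𝐃 i s.X, constField w⟫ • constField w := fun i => by
    rw [hYdef, map_sub, pderivField_smul, pderivField_constField, hDZ, pderiv_innerField, hDZ,
      pderivField_constField, map_zero, add_zero, smul_zero, add_zero]
  have hYw : ⟪Y, constField w⟫ = 0 := by
    rw [hYdef]
    simp [hww]
  have hYX : ∀ i, ⟪Y, 𝐃 i s.X⟫ = 0 := fun i => by
    have := inner_pderivField_of_sq hY i
    rwa [hDY, map_sub, map_smul, hYw, smul_zero, sub_zero] at this
  have hYN := eq_inner_smul_N hYX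
  have hu := isUnit_of_eq_smul_N hr hY hYN
  set ν := ⟪Y, s.N⟫ with hν
  obtain ⟨ρ, hρ⟩ := hu.exists_left_inv
  have hNw : ⟪s.N, constField w⟫ = 0 := by
    rw [hYN, map_smul, LinearMap.smul_apply, smul_eq_mul] at hYw
    exact hu.mul_right_eq_zero.1 hYw
  have hDν : ∀ i, 𝐝 i ν = 0 := fun i => by
    have h1 : ⟪Y, 𝐃 i s.N⟫ = 0 := by
      rw [hYN, map_smul, LinearMap.smul_apply, innerField_comm, inner_DN_N, smul_zero]
    rw [hν, pderiv_innerField, h1, hDY, map_sub, map_smul, LinearMap.sub_apply,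
      LinearMap.smul_apply, inner_X_N, innerField_comm (constField w), hNw, smul_zero, sub_zero,
      add_zero]
  have hDρ : ∀ i, 𝐝 i ρ = 0 := fun i => pderiv_eq_zero_of_mul_eq_one hρ (hDν i)
  have hDN : ∀ i, 𝐃 i s.N = ρ • (𝐃 i s.X - ⟪𝐃 i s.X, constField w⟫ • constField w) := fun i => by
    rw [← hDY, hYN, pderivField_smul, hDν, zero_smul, zero_add, smul_smul, hρ, one_smul]
  obtain ⟨p, hp⟩ := s.exists_eq_frame (constField w)
  rw [innerField_comm, hNw, zero_smul, zero_add] at hp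
  have hpw : p 0 * ⟪𝐃 0 s.X, constField w⟫ + p 1 * ⟪𝐃 1 s.X, constField w⟫ = 1 := by
    have := congrArg (fun v => ⟪v, constField w⟫) hp
    simp only [hww, map_add, map_smul, LinearMap.add_apply, LinearMap.smul_apply,
      smul_eq_mul] at this
    exact this.symm
  set α := fun i => ⟪𝐃 i s.X, constField w⟫ with hα
  have hDN' : ∀ i, 𝐃 i s.N = ρ • (𝐃 i s.X - α i • (p 0 • 𝐃 0 s.X + p 1 • 𝐃 1 s.X)) := fun i => by
    rw [← hp]; exact hDN i
  have hpα : p 0 * α 0 + p 1 * α 1 = 1 := hpw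
  obtain ⟨h00, h10⟩ := S_eq (s := s) (i := 0) (c₀ := -ρ * (1 - p 0 * α 0)) (c₁ := ρ * (p 1 * α 0))
    (by rw [hDN']; module)
  obtain ⟨h01, h11⟩ := S_eq (s := s) (i := 1) (c₀ := ρ * (p 0 * α 1)) (c₁ := -ρ * (1 - p 1 * α 1))
    (by rw [hDN']; module)
  have hh : s.h = -ρ := by
    rw [h, h00, h11]
    linear_combination ρ * hpα
  have hK : s.K = 0 := by
    rw [K, h00, h01, h10, h11]
    linear_combination -ρ ^ 2 * hpα
  refine s.isTangentiallyBiharmonic_of_const (fun i => ?_) (fun i => ?_)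
  · rw [hh, map_neg, hDρ, neg_zero]
  · rw [hK, map_zero, mul_zero]

end OrientedPatch

end

/-! ### Mean curvature of a patch, unit normals, and patches given by charts. -/

section

section MeanCurvature

variable {U : Opens (EuclideanSpace ℝ (Fin 2))} (s : OrientedPatch U)

theorem OrientedPatch.secondFundamentalForm_eq {F : EuclideanSpace ℝ (Fin 2) → E3}
    (hF : ∀ u : U, F u = s.X u) (i j : Fin 2) (u : U) :
    secondFundamentalForm F i j u = s.II i j u • s.N u := by
  have hX : ∀ k, (tangentPlane F u)ᗮ.starProjection (𝐃 k s.X u) = 0 := by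
    intro k
    rw [Submodule.starProjection_apply_eq_zero_iff]
    refine Submodule.le_orthogonal_orthogonal _ ?_
    rw [pderivField_eq_partialD k hF]
    exact ⟨_, rfl⟩
  have hN : (tangentPlane F u)ᗮ.starProjection (s.N u) = s.N u := by
    rw [Submodule.starProjection_eq_self_iff, mem_tangentPlane_orthogonal_iff]
    intro k
    rw [← pderivField_eq_partialD k hF, ← innerField_apply, s.inner_N_X]
    rfl
  obtain ⟨p, hp⟩ := s.exists_eq_frame (𝐃 i (𝐃 j s.X))
  have := congrArg (fun P : SmoothField U E3 => P u) hp
  simp only [SmoothField.add_apply, SmoothField.smul_apply] at this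
  rw [secondFundamentalForm, partialD_partialD_eq hF, this]
  simp only [map_add, map_smul, hX, hN, smul_zero, add_zero]
  rfl

theorem OrientedPatch.meanCurvature_eq {F : EuclideanSpace ℝ (Fin 2) → E3}
    (hF : ∀ u : U, F u = s.X u) (u : U) : meanCurvature F u = (s.h u / 2) • s.N u := by
  have h1 := congrArg (SmoothScalar.eval u) s.sum_J_II
  simp only [SmoothScalar.eval_apply, SmoothScalar.sum_apply, SmoothScalar.mul_apply] at h1
  rw [← h1, meanCurvature]
  simp only [s.secondFundamentalForm_eq hF, metric_eq hF, ← eval_inv_apply s.isUnit_det_gram,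
    smul_smul, ← Finset.sum_smul]
  congr 1
  rw [Nat.cast_ofNat, one_div, inv_mul_eq_div]
  rfl

end MeanCurvature

section CrossProduct

/-- The cross product in Euclidean 3-space. -/
def cross (a b : E3) : E3 :=
  !₂[a 1 * b 2 - a 2 * b 1, a 2 * b 0 - a 0 * b 2, a 0 * b 1 - a 1 * b 0]

theorem inner_cross_left (a b : E3) : inner ℝ a (cross a b) = 0 := by
  simp [cross, PiLp.inner_apply, Fin.sum_univ_three]; ring

theorem inner_cross_right (a b : E3) : inner ℝ b (cross a b) = 0 := by
  simp [cross, PiLp.inner_apply, Fin.sum_univ_three]; ring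

theorem cross_ne_zero {a b : E3} (h : LinearIndependent ℝ ![a, b]) : cross a b ≠ 0 := by
  intro h0
  have e := fun i => congrFun (congrArg WithLp.ofLp h0) i
  have e0 := e 0
  have e1 := e 1
  have e2 := e 2
  simp only [cross, PiLp.zero_apply, Matrix.cons_val_zero, Matrix.cons_val_one,
    Matrix.cons_val] at e0 e1 e2
  have hab := LinearIndependent.pair_iff.1 h
  have hb : ∀ i, b i = 0 := fun i => by
    have := (hab (b i) (-a i) (by
      ext j
      fin_cases i <;> fin_cases j <;>
        simp only [PiLp.add_apply, PiLp.smul_apply, smul_eq_mul, PiLp.zero_apply, Fin.zero_eta,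
          Fin.mk_one, Fin.reduceFinMk] <;> linarith)).1
    exact this
  have := (hab 0 1 (by ext j; simp [hb])).2
  exact one_ne_zero this

theorem contDiffOn_cross {W : Set (EuclideanSpace ℝ (Fin 2))} {f g : EuclideanSpace ℝ (Fin 2) → E3}
    (hf : ContDiffOn ℝ ∞ f W) (hg : ContDiffOn ℝ ∞ g W) :
    ContDiffOn ℝ ∞ (fun u => cross (f u) (g u)) W := by
  have hf' := fun i => contDiffOn_euclidean.1 hf i
  have hg' := fun i => contDiffOn_euclidean.1 hg i
  refine contDiffOn_euclidean.2 fun i => ?_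
  fin_cases i
  · exact ((hf' 1).mul (hg' 2)).sub ((hf' 2).mul (hg' 1))
  · exact ((hf' 2).mul (hg' 0)).sub ((hf' 0).mul (hg' 2))
  · exact ((hf' 0).mul (hg' 1)).sub ((hf' 1).mul (hg' 0))

end CrossProduct

section Charts

variable {M : Type*} [TopologicalSpace M] [ChartedSpace (EuclideanSpace ℝ (Fin 2)) M]
  {φ : OpenPartialHomeomorph M (EuclideanSpace ℝ (Fin 2))}

theorem mdifferentiable_of_mem_maximalAtlas (hφ : φ ∈ IsManifold.maximalAtlas (𝓡 2) ∞ M) :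
    φ.MDifferentiable (𝓡 2) (𝓡 2) :=
  ⟨(contMDiffOn_of_mem_maximalAtlas hφ).mdifferentiableOn (by simp),
    (contMDiffOn_symm_of_mem_maximalAtlas hφ).mdifferentiableOn (by simp)⟩

/-- The derivative of an inverse chart. -/
def symmDeriv (φ : OpenPartialHomeomorph M (EuclideanSpace ℝ (Fin 2)))
    (u : EuclideanSpace ℝ (Fin 2)) : EuclideanSpace ℝ (Fin 2) →L[ℝ] EuclideanSpace ℝ (Fin 2) :=
  mfderiv (𝓡 2) (𝓡 2) φ.symm u

theorem symmDeriv_bijective [IsManifold (𝓡 2) ∞ M] (hφ : φ ∈ IsManifold.maximalAtlas (𝓡 2) ∞ M)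
    {u : EuclideanSpace ℝ (Fin 2)} (hu : u ∈ φ.target) : Function.Bijective (symmDeriv φ u) :=
  (mdifferentiable_of_mem_maximalAtlas hφ).symm.mfderiv_bijective hu

variable {E : Type*} [NormedAddCommGroup E] [NormedSpace ℝ E]

theorem contDiffOn_comp_symm (hφ : φ ∈ IsManifold.maximalAtlas (𝓡 2) ∞ M) {f : M → E}
    (hf : ContMDiffOn (𝓡 2) 𝓘(ℝ, E) ∞ f φ.source) :
    ContDiffOn ℝ ∞ (fun u => f (φ.symm u)) φ.target :=
  contMDiffOn_iff_contDiffOn.1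
    (hf.comp (contMDiffOn_symm_of_mem_maximalAtlas hφ) fun _ hu => φ.map_target hu)

theorem fderiv_comp_symm [IsManifold (𝓡 2) ∞ M] (hφ : φ ∈ IsManifold.maximalAtlas (𝓡 2) ∞ M) {f : M → E}
    {u : EuclideanSpace ℝ (Fin 2)} (hu : u ∈ φ.target)
    (hf : MDifferentiableAt (𝓡 2) 𝓘(ℝ, E) f (φ.symm u)) (v : EuclideanSpace ℝ (Fin 2)) :
    fderiv ℝ (fun u => f (φ.symm u)) u v =
      mfderiv (𝓡 2) 𝓘(ℝ, E) f (φ.symm u) (symmDeriv φ u v) := by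
  have h := mfderiv_comp u hf ((mdifferentiable_of_mem_maximalAtlas hφ).mdifferentiableAt_symm hu)
  rw [mfderiv_eq_fderiv] at h
  exact congrArg (fun T : EuclideanSpace ℝ (Fin 2) →L[ℝ] E => T v) h

variable [IsManifold (𝓡 2) ∞ M] {x : M → E3}

theorem partialD_comp_symm (hx : IsSmoothImmersion x)
    (hφ : φ ∈ IsManifold.maximalAtlas (𝓡 2) ∞ M) {u : EuclideanSpace ℝ (Fin 2)}
    (hu : u ∈ φ.target) (i : Fin 2) : partialD i (fun v => x (φ.symm v)) u =
      differential x (φ.symm u) (symmDeriv φ u (EuclideanSpace.single i 1)) :=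
  fderiv_comp_symm hφ hu (hx.1.mdifferentiable (by simp) _) _

theorem linearIndependent_partialD (hx : IsSmoothImmersion x)
    (hφ : φ ∈ IsManifold.maximalAtlas (𝓡 2) ∞ M) {u : EuclideanSpace ℝ (Fin 2)}
    (hu : u ∈ φ.target) : LinearIndependent ℝ ![partialD 0 (fun v => x (φ.symm v)) u,
      partialD 1 (fun v => x (φ.symm v)) u] := by
  refine LinearIndependent.pair_iff.2 fun a b h => ?_
  simp only [partialD_comp_symm hx hφ hu, ← map_smul, ← map_add] at h
  have h0 := (symmDeriv_bijective hφ hu).injective ((hx.2 _ (h.trans (map_zero _).symm)).trans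
    (map_zero _).symm)
  have e := fun i => congrFun (congrArg WithLp.ofLp h0) i
  exact ⟨by simpa using e 0, by simpa using e 1⟩

theorem mem_normalBundle_iff (hx : IsSmoothImmersion x)
    (hφ : φ ∈ IsManifold.maximalAtlas (𝓡 2) ∞ M) {u : EuclideanSpace ℝ (Fin 2)}
    (hu : u ∈ φ.target) (ξ : E3) : (φ.symm u, ξ) ∈ normalBundle x ↔
      ∀ i, inner ℝ (partialD i (fun v => x (φ.symm v)) u) ξ = 0 := by
  simp only [partialD_comp_symm hx hφ hu]
  refine ⟨fun h i => h _, fun h v => ?_⟩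
  obtain ⟨w, rfl⟩ := (symmDeriv_bijective hφ hu).surjective v
  have hw : w = ∑ k, w k • EuclideanSpace.single k (1 : ℝ) := by
    ext k
    fin_cases k <;> simp
  rw [hw]
  simp only [map_sum, map_smul, sum_inner, inner_smul_left, h, mul_zero, Finset.sum_const_zero]

/-- The domain of the local parametrization given by a chart. -/
def chartDomain (φ : OpenPartialHomeomorph M (EuclideanSpace ℝ (Fin 2))) :
    Opens (EuclideanSpace ℝ (Fin 2)) := ⟨φ.target, φ.open_target⟩

variable {N : M → E3}

/-- The local parametrization of an immersed surface given by a chart. -/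
def chartPatch (hx : IsSmoothImmersion x) (hφ : φ ∈ IsManifold.maximalAtlas (𝓡 2) ∞ M)
    (hN : IsUnitNormalOn x φ.source N) : OrientedPatch (chartDomain φ) where
  X := .of (fun u => x (φ.symm u)) (contDiffOn_comp_symm hφ hx.1.contMDiffOn)
  N := .of (fun u => N (φ.symm u)) (contDiffOn_comp_symm hφ hN.1)
  linearIndependent u := by
    rw [pderivField_eq_partialD 0 (g := fun u => x (φ.symm u)) fun _ => rfl,
      pderivField_eq_partialD 1 (g := fun u => x (φ.symm u)) fun _ => rfl]
    exact linearIndependent_partialD hx hφ u.2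
  inner_N_N := by
    ext u
    have h : ‖N (φ.symm u)‖ = 1 := (hN.2 _ (φ.map_target u.2)).1
    rw [innerField_apply, real_inner_self_eq_norm_sq]
    exact (congrArg (· ^ 2) h).trans (one_pow 2)
  inner_N_X i := by
    ext u
    rw [innerField_apply, pderivField_eq_partialD i (g := fun u => x (φ.symm u)) fun _ => rfl,
      real_inner_comm]
    exact (mem_normalBundle_iff hx hφ u.2 _).1 (hN.2 _ (φ.map_target u.2)).2 i

theorem exists_isUnitNormalOn (hx : IsSmoothImmersion x)
    (hφ : φ ∈ IsManifold.maximalAtlas (𝓡 2) ∞ M) : ∃ N : M → E3, IsUnitNormalOn x φ.source N := by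
  set X := fun u => x (φ.symm u) with hX
  have hsm : ContDiffOn ℝ ∞ X φ.target := contDiffOn_comp_symm hφ hx.1.contMDiffOn
  set n := fun u => cross (partialD 0 X u) (partialD 1 X u) with hn
  have hD : ∀ i, ContDiffOn ℝ ∞ (partialD i X) φ.target := fun i =>
    contDiffOn_partialD (W := chartDomain φ) hsm i
  have hn0 : ∀ u ∈ φ.target, n u ≠ 0 := fun u hu =>
    cross_ne_zero (linearIndependent_partialD hx hφ hu)
  have hns : ContDiffOn ℝ ∞ (fun u => ‖n u‖⁻¹ • n u) φ.target :=
    have hc := contDiffOn_cross (hD 0) (hD 1)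
    ((hc.norm ℝ hn0).inv fun u hu => norm_ne_zero_iff.2 (hn0 u hu)).smul hc
  refine ⟨fun p => ‖n (φ p)‖⁻¹ • n (φ p), (contMDiffOn_iff_contDiffOn.2 hns).comp
    (contMDiffOn_of_mem_maximalAtlas hφ) fun p hp => φ.map_source hp, fun p hp => ⟨?_, ?_⟩⟩
  · have := norm_ne_zero_iff.2 (hn0 _ (φ.map_source hp))
    rw [norm_smul, norm_inv, norm_norm, inv_mul_cancel₀ this]
  · have h := mem_normalBundle_iff hx hφ (φ.map_source hp)
    rw [φ.left_inv hp] at h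
    refine (h _).2 fun i => ?_
    rw [inner_smul_right]
    fin_cases i
    · exact mul_eq_zero_of_right _ (inner_cross_left _ _)
    · exact mul_eq_zero_of_right _ (inner_cross_right _ _)

/-- The normal bundle is tangentially biharmonic if and only if it is so in every local
parametrization. -/
theorem hasTangentiallyBiharmonicNormalBundle_iff (hx : IsSmoothImmersion x) :
    HasTangentiallyBiharmonicNormalBundle x ↔
      ∀ φ, ∀ hφ : φ ∈ IsManifold.maximalAtlas (𝓡 2) ∞ M, ∀ N, ∀ hN : IsUnitNormalOn x φ.source N,
        (chartPatch hx hφ hN).IsTangentiallyBiharmonic := by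
  refine forall_congr' fun φ => forall_congr' fun hφ => forall_congr' fun N =>
    forall_congr' fun hN => ?_
  rw [(chartPatch hx hφ hN).isTangentiallyBiharmonic_iff
    (F := fun z => normalBundleMap x (normalBundleParam φ N z))]
  · exact ⟨fun h w => h w w.2, fun h y hy => h ⟨y, hy⟩⟩
  · intro w
    have hw : !₂[w.1 0, w.1 1] ∈ chartDomain φ := w.2
    simp only [OrientedPatch.bundleMap, SmoothField.of_apply, planeProj_apply, chartPatch,
      extendZero_of_mem _ hw]
    rfl

end Charts

end

/-! ### Independence of the mean curvature vector from the chart. -/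

section

variable {M : Type*} [TopologicalSpace M] [ChartedSpace (EuclideanSpace ℝ (Fin 2)) M]
  {φ : OpenPartialHomeomorph M (EuclideanSpace ℝ (Fin 2))} {x N : M → E3}

theorem IsUnitNormalOn.mono {V V' : Set M} (hN : IsUnitNormalOn x V N) (h : V' ⊆ V) :
    IsUnitNormalOn x V' N :=
  ⟨hN.1.mono h, fun p hp => hN.2 p (h hp)⟩

variable [IsManifold (𝓡 2) ∞ M]

/-- The trace of the shape operator does not depend on the chart. -/
theorem exists_shapeOperator (hx : IsSmoothImmersion x)
    (hφ : φ ∈ IsManifold.maximalAtlas (𝓡 2) ∞ M) (hN : IsUnitNormalOn x φ.source N)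
    (u : chartDomain φ) :
    ∃ L : EuclideanSpace ℝ (Fin 2) →ₗ[ℝ] EuclideanSpace ℝ (Fin 2),
      (∀ v : EuclideanSpace ℝ (Fin 2), (mfderiv (𝓡 2) 𝓘(ℝ, E3) N (φ.symm u) v : E3) =
        -differential x (φ.symm u) (L v)) ∧
      LinearMap.trace ℝ _ L = (chartPatch hx hφ hN).h u := by
  set s := chartPatch hx hφ hN
  have hu : u.1 ∈ φ.target := u.2
  let b := (EuclideanSpace.basisFun (Fin 2) ℝ).toBasis
  let T := Matrix.toLin b b (Matrix.of fun i j => s.S i j u)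
  let e := LinearEquiv.ofBijective (symmDeriv φ u).toLinearMap (symmDeriv_bijective hφ hu)
  have hNd : MDifferentiableAt (𝓡 2) 𝓘(ℝ, E3) N (φ.symm u) :=
    (hN.1.contMDiffAt (φ.open_source.mem_nhds (φ.map_target hu))).mdifferentiableAt (by simp)
  have hb : ∀ i, b i = EuclideanSpace.single i 1 := fun i => by simp [b]
  have hX : ∀ i, 𝐃 i s.X u = differential x (φ.symm u) (e (b i)) := fun i => by
    rw [pderivField_eq_partialD i (g := fun u => x (φ.symm u)) fun _ => rfl,
      partialD_comp_symm hx hφ hu, hb]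
    rfl
  have hN' : ∀ i, 𝐃 i s.N u = (mfderiv (𝓡 2) 𝓘(ℝ, E3) N (φ.symm u) (e (b i)) : E3) := fun i => by
    rw [pderivField_eq_partialD i (g := fun u => N (φ.symm u)) fun _ => rfl, partialD,
      fderiv_comp_symm hφ hu hNd, hb]
    rfl
  -- Transporting the matrix of S by the derivative of the inverse chart gives an endomorphism
  -- determined by dN and dx alone, with the same trace.
  refine ⟨e.conj T, fun v => ?_, ?_⟩
  · obtain ⟨w, rfl⟩ := e.surjective v
    rw [LinearEquiv.conj_apply_apply, LinearEquiv.symm_apply_apply]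
    let D : EuclideanSpace ℝ (Fin 2) →L[ℝ] E3 := mfderiv (𝓡 2) 𝓘(ℝ, E3) N (φ.symm u)
    have key : D.toLinearMap.comp e.toLinearMap =
        -((differential x (φ.symm u)).toLinearMap.comp (e.toLinearMap.comp T)) := by
      refine b.ext fun i => ?_
      have h := s.DN_apply i u
      rw [hX, hX, hN'] at h
      have hT : T (b i) = s.S 0 i u • b 0 + s.S 1 i u • b 1 := by
        simp only [T, Matrix.toLin_self, Fin.sum_univ_two, Matrix.of_apply]
      simp only [LinearMap.comp_apply, LinearMap.neg_apply, hT, map_add, map_smul]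
      exact h
    exact congrArg (fun F : EuclideanSpace ℝ (Fin 2) →ₗ[ℝ] E3 => F w) key
  · rw [LinearMap.trace_conj', Matrix.trace_toLin_eq, Matrix.trace_fin_two]
    rfl

/-- The mean curvature vector of the surface. -/
def meanCurvatureVector (x : M → E3) (p : M) : E3 :=
  meanCurvature (fun v => x ((chartAt (EuclideanSpace ℝ (Fin 2)) p).symm v))
    (chartAt (EuclideanSpace ℝ (Fin 2)) p p)

theorem meanCurvatureVector_symm (hx : IsSmoothImmersion x)
    (hφ : φ ∈ IsManifold.maximalAtlas (𝓡 2) ∞ M) (hN : IsUnitNormalOn x φ.source N)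
    (u : chartDomain φ) : meanCurvatureVector x (φ.symm u) =
      ((chartPatch hx hφ hN).h u / 2) • N (φ.symm u) := by
  have hu : u.1 ∈ φ.target := u.2
  set p := φ.symm u with hp
  -- The preferred chart is shrunk so that the same N is a unit normal on its domain; injectivity of
  -- dx then identifies the two shape operators.
  set ψ := (chartAt (EuclideanSpace ℝ (Fin 2)) p).restr φ.source with hψ
  have hψm : ψ ∈ IsManifold.maximalAtlas (𝓡 2) ∞ M :=
    restr_mem_maximalAtlas _ (IsManifold.chart_mem_maximalAtlas p) φ.open_source
  have hψN : IsUnitNormalOn x ψ.source N := hN.mono fun q hq => by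
    rw [hψ, OpenPartialHomeomorph.restr_source' _ _ φ.open_source] at hq
    exact hq.2
  have hpψ : p ∈ ψ.source := by
    rw [hψ, OpenPartialHomeomorph.restr_source' _ _ φ.open_source]
    exact ⟨mem_chart_source _ p, φ.map_target hu⟩
  let v : chartDomain ψ := ⟨ψ p, ψ.map_source hpψ⟩
  have hv : ψ.symm v = p := ψ.left_inv hpψ
  have h1 : meanCurvatureVector x p = ((chartPatch hx hψm hψN).h v / 2) • N p := by
    have := (chartPatch hx hψm hψN).meanCurvature_eq (F := fun v => x (ψ.symm v)) (fun _ => rfl) v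
    rw [← hv]
    nth_rw 1 [hv]
    exact this
  obtain ⟨L, hL, hLt⟩ := exists_shapeOperator hx hφ hN u
  obtain ⟨L', hL', hLt'⟩ := exists_shapeOperator hx hψm hψN v
  have hLL : L = L' := by
    refine LinearMap.ext fun w => hx.2 p (neg_injective ?_)
    rw [hv] at hL'
    exact (hL w).symm.trans (hL' w)
  rw [h1, ← hLt, ← hLt', hLL]

end

/-! ### Parametrizations around a point, constancy of |H|, and the three sufficient conditions. -/

section

variable {M : Type*} [TopologicalSpace M] [ChartedSpace (EuclideanSpace ℝ (Fin 2)) M]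
  {x : M → E3} {p : M}

/-- A local parametrization of an immersed surface around a point, defined on a ball. -/
structure SurfacePatch (x : M → E3) (p : M) where
  domain : Opens (EuclideanSpace ℝ (Fin 2))
  patch : OrientedPatch domain
  param : EuclideanSpace ℝ (Fin 2) → M
  center : domain
  map_nhds : Filter.map param (𝓝 center.1) = 𝓝 p
  param_center : param center = p
  X_apply : ∀ u : domain, patch.X u = x (param u)
  H_apply : ∀ u : domain, meanCurvatureVector x (param u) = (patch.h u / 2) • patch.N u

namespace SurfacePatch

/-- Restriction of a local parametrization to a smaller domain. -/
def restrict (P : SurfacePatch x p) {V : Opens (EuclideanSpace ℝ (Fin 2))} (hV : V ≤ P.domain)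
    (hc : P.center.1 ∈ V) : SurfacePatch x p where
  domain := V
  patch := P.patch.restrict hV
  param := P.param
  center := ⟨P.center, hc⟩
  map_nhds := P.map_nhds
  param_center := P.param_center
  X_apply u := (restrictField_apply hV P.patch.X u).trans (P.X_apply ⟨u.1, hV u.2⟩)
  H_apply u := by
    rw [OrientedPatch.h_restrict, restrict_apply]
    exact (P.H_apply ⟨u.1, hV u.2⟩).trans (congrArg _ (restrictField_apply hV P.patch.N u).symm)

theorem eventually_iff (P : SurfacePatch x p) {Q : M → Prop} :
    (∀ᶠ q in 𝓝 p, Q q) ↔ ∀ᶠ u in 𝓝 P.center.1, Q (P.param u) := by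
  rw [← P.map_nhds, Filter.eventually_map]

theorem eventually_of_forall (P : SurfacePatch x p) {Q : M → Prop}
    (h : ∀ u : P.domain, Q (P.param u)) : ∀ᶠ q in 𝓝 p, Q q :=
  P.eventually_iff.2 (Filter.eventually_of_mem (P.domain.isOpen.mem_nhds P.center.2)
    fun u hu => h ⟨u, hu⟩)

theorem exists_ball (P : SurfacePatch x p) (hP : P.patch.IsTangentiallyBiharmonic)
    {Q : EuclideanSpace ℝ (Fin 2) → Prop} (h : ∀ᶠ u in 𝓝 P.center.1, Q u) :
    ∃ (V : Opens (EuclideanSpace ℝ (Fin 2))) (hV : V ≤ P.domain) (hc : P.center.1 ∈ V),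
      (P.restrict hV hc).patch.IsTangentiallyBiharmonic ∧
      IsPreconnected (V : Set (EuclideanSpace ℝ (Fin 2))) ∧ ∀ u ∈ V, Q u := by
  obtain ⟨r, hr, hball⟩ := Metric.mem_nhds_iff.1
    (Filter.inter_mem h (P.domain.isOpen.mem_nhds P.center.2))
  exact ⟨⟨Metric.ball P.center.1 r, Metric.isOpen_ball⟩, fun u hu => (hball hu).2,
    Metric.mem_ball_self hr, hP.restrict _, (convex_ball _ _).isPreconnected,
    fun u hu => (hball hu).1⟩

theorem exists_of_eventually (P : SurfacePatch x p) (hP : P.patch.IsTangentiallyBiharmonic)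
    {Q : M → Prop} (h : ∀ᶠ q in 𝓝 p, Q q) : ∃ P' : SurfacePatch x p,
      P'.patch.IsTangentiallyBiharmonic ∧
      IsPreconnected (P'.domain : Set (EuclideanSpace ℝ (Fin 2))) ∧
      ∀ u : P'.domain, Q (P'.param u) := by
  obtain ⟨V, hV, hc, h1, h2, h3⟩ := P.exists_ball hP (P.eventually_iff.1 h)
  exact ⟨P.restrict hV hc, h1, h2, fun u => h3 u u.2⟩

theorem abs_h (P : SurfacePatch x p) (u : P.domain) :
    |P.patch.h u| = 2 * ‖meanCurvatureVector x (P.param u)‖ := by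
  rw [P.H_apply, norm_smul, P.patch.norm_N, Real.norm_eq_abs, abs_div, abs_two]
  ring

end SurfacePatch

variable [IsManifold (𝓡 2) ∞ M]

theorem exists_surfacePatch (hx : IsSmoothImmersion x)
    (hT : HasTangentiallyBiharmonicNormalBundle x) (p : M) :
    ∃ P : SurfacePatch x p, P.patch.IsTangentiallyBiharmonic := by
  have hφ := IsManifold.chart_mem_maximalAtlas (I := 𝓡 2) (n := ∞) p
  set φ := chartAt (EuclideanSpace ℝ (Fin 2)) p
  have hp : p ∈ φ.source := mem_chart_source _ p
  obtain ⟨N, hN⟩ := exists_isUnitNormalOn hx hφ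
  refine ⟨⟨chartDomain φ, chartPatch hx hφ hN, φ.symm, ⟨φ p, φ.map_source hp⟩, ?_, φ.left_inv hp,
    fun _ => rfl, fun u => meanCurvatureVector_symm hx hφ hN u⟩,
    (hasTangentiallyBiharmonicNormalBundle_iff hx).1 hT φ hφ N hN⟩
  have := φ.symm.map_nhds_eq (φ.map_source hp)
  rwa [φ.left_inv hp] at this

/-- The norm is used because h changes sign with N, which need not exist globally. -/
theorem norm_meanCurvatureVector_isLocallyConstant (hx : IsSmoothImmersion x)
    (hT : HasTangentiallyBiharmonicNormalBundle x) :
    IsLocallyConstant fun p => ‖meanCurvatureVector x p‖ := by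
  refine (IsLocallyConstant.iff_eventually_eq _).2 fun p => ?_
  obtain ⟨P₀, hP₀⟩ := exists_surfacePatch hx hT p
  obtain ⟨P, hP, hc, -⟩ := P₀.exists_of_eventually hP₀ (Filter.Eventually.of_forall fun _ => trivial)
  refine P.eventually_of_forall fun u => ?_
  have h1 := P.abs_h u
  rw [SmoothScalar.apply_eq_of_pderiv_eq_zero hc (P.patch.pderiv_h_eq_zero hP) u P.center, P.abs_h,
    P.param_center] at h1
  linarith

theorem isMinimal_of_meanCurvatureVector_eq_zero (hx : IsSmoothImmersion x)
    (h : ∀ p, meanCurvatureVector x p = 0) : IsMinimal x := by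
  intro φ hφ u hu
  obtain ⟨N, hN⟩ := exists_isUnitNormalOn hx hφ
  have h1 := (chartPatch hx hφ hN).meanCurvature_eq (F := fun v => x (φ.symm v)) (fun _ => rfl)
    ⟨u, hu⟩
  have h2 := meanCurvatureVector_symm hx hφ hN ⟨u, hu⟩
  rw [h] at h2
  exact h1.trans h2.symm

theorem IsMinimal.hasTangentiallyBiharmonicNormalBundle (hx : IsSmoothImmersion x)
    (h : IsMinimal x) : HasTangentiallyBiharmonicNormalBundle x := by
  refine (hasTangentiallyBiharmonicNormalBundle_iff hx).2 fun φ hφ N hN => ?_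
  have hh : (chartPatch hx hφ hN).h = 0 := by
    ext u
    have h1 := (chartPatch hx hφ hN).meanCurvature_eq (F := fun v => x (φ.symm v)) (fun _ => rfl) u
    rw [h φ hφ u u.2] at h1
    have h2 := congrArg norm h1
    rw [norm_smul, OrientedPatch.norm_N, norm_zero, mul_one, eq_comm, norm_eq_zero] at h2
    rw [SmoothScalar.zero_apply]
    linarith
  exact OrientedPatch.isTangentiallyBiharmonic_of_const _ (fun i => by rw [hh, map_zero])
    fun i => by rw [hh, zero_mul]

theorem IsPartOfRoundSphere.hasTangentiallyBiharmonicNormalBundle (hx : IsSmoothImmersion x)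
    (h : IsPartOfRoundSphere x) : HasTangentiallyBiharmonicNormalBundle x := by
  obtain ⟨c, r, hr, h⟩ := h
  exact (hasTangentiallyBiharmonicNormalBundle_iff hx).2 fun φ hφ N hN =>
    OrientedPatch.isTangentiallyBiharmonic_of_sphere hr fun u => mem_sphere_iff_norm.1 (h (φ.symm u))

theorem IsPartOfCircularCylinder.hasTangentiallyBiharmonicNormalBundle (hx : IsSmoothImmersion x)
    (h : IsPartOfCircularCylinder x) : HasTangentiallyBiharmonicNormalBundle x := by
  obtain ⟨c, w, r, hw, hr, h⟩ := h
  exact (hasTangentiallyBiharmonicNormalBundle_iff hx).2 fun φ hφ N hN =>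
    OrientedPatch.isTangentiallyBiharmonic_of_cylinder hw hr fun u => h (φ.symm u)

end

/-! ### Focal points and the passage from local to global. -/

section

variable {M : Type*} [TopologicalSpace M] [ChartedSpace (EuclideanSpace ℝ (Fin 2)) M]
  {x : M → E3} {p : M}

/-- The focal points `x + (k / 2‖H‖²) H`: the centre of a sphere if `k = 2`, and a point of the axis
of a circular cylinder if `k = 1`. -/
def focalPoint (x : M → E3) (k : ℝ) (p : M) : E3 :=
  x p + (k / (2 * ‖meanCurvatureVector x p‖ ^ 2)) • meanCurvatureVector x p

namespace SurfacePatch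

theorem h_ne_zero (P : SurfacePatch x p) (hH : ∀ q, meanCurvatureVector x q ≠ 0) (u : P.domain) :
    P.patch.h u ≠ 0 := by
  rw [← abs_ne_zero, P.abs_h]
  exact mul_ne_zero two_ne_zero (norm_ne_zero_iff.2 (hH _))

theorem isUnit_h (P : SurfacePatch x p) (hH : ∀ q, meanCurvatureVector x q ≠ 0) :
    IsUnit P.patch.h := SmoothScalar.isUnit_of_ne_zero (P.h_ne_zero hH)

/-- From H = (h/2)N and |H|² = h²/4, the focal point is x + (k/h)N, which is unchanged under N ↦ -N.
-/
theorem h_smul_focalPoint (P : SurfacePatch x p) (hH : ∀ q, meanCurvatureVector x q ≠ 0) (k : ℝ)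
    (u : P.domain) : P.patch.h u • focalPoint x k (P.param u) =
      k • P.patch.N u + P.patch.h u • P.patch.X u := by
  have h1 : P.patch.h u ^ 2 = 4 * ‖meanCurvatureVector x (P.param u)‖ ^ 2 := by
    rw [← sq_abs, P.abs_h]; ring
  have h0 := P.h_ne_zero hH u
  have h2 : k / (2 * ‖meanCurvatureVector x (P.param u)‖ ^ 2) = 2 * k / P.patch.h u ^ 2 := by
    rw [h1, mul_comm 2 k, show (4 : ℝ) = 2 * 2 by norm_num, mul_assoc,
      mul_comm k, mul_div_mul_left _ _ two_ne_zero]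
  rw [focalPoint, h2, ← P.X_apply, P.H_apply, smul_add, smul_smul, smul_smul, add_comm]
  congr 2
  field_simp

theorem umbilic_of_focalPoint_eq (P : SurfacePatch x p) (hP : P.patch.IsTangentiallyBiharmonic)
    (hc : IsPreconnected (P.domain : Set (EuclideanSpace ℝ (Fin 2))))
    (hH : ∀ q, meanCurvatureVector x q ≠ 0) {k : ℝ}
    (h : ∀ u : P.domain, focalPoint x k (P.param u) = focalPoint x k p) (i : Fin 2) (u : P.domain) :
    k • 𝐃 i P.patch.N u = -(P.patch.h u • 𝐃 i P.patch.X u) := by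
  set s := P.patch
  have hh := s.pderiv_h_eq_zero hP
  have h1 : algebraMap ℝ (SmoothScalar P.domain) k • s.N + s.h • s.X =
      constField (s.h P.center • focalPoint x k p) := SmoothField.ext fun u => by
    rw [constField_apply, ← h u, ← SmoothScalar.apply_eq_of_pderiv_eq_zero hc hh u,
      P.h_smul_focalPoint hH]
    rfl
  have h2 := congrArg (𝐃 i) h1
  rw [map_add, pderivField_smul, pderivField_smul, hh, Derivation.map_algebraMap,
    pderivField_constField, zero_smul, zero_add, zero_smul, zero_add] at h2
  exact eq_neg_of_add_eq_zero_left (congrArg (fun F : SmoothField P.domain E3 => F u) h2)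

/-- A constant x + N/h would make every point umbilic with both principal curvatures h, hence h =
2h. -/
theorem not_eventually_focalPoint_one_eq (P : SurfacePatch x p)
    (hP : P.patch.IsTangentiallyBiharmonic) (hH : ∀ q, meanCurvatureVector x q ≠ 0) :
    ¬∀ᶠ q in 𝓝 p, focalPoint x 1 q = focalPoint x 1 p := by
  intro h
  obtain ⟨P', hP', hc, hy⟩ := P.exists_of_eventually hP h
  have h1 := OrientedPatch.h_apply_eq_of_umbilic (s := P'.patch) (u := P'.center)
    (c := P'.patch.h P'.center) fun i => by
      rw [← P'.umbilic_of_focalPoint_eq hP' hc hH hy, one_smul]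
  exact P'.h_ne_zero hH P'.center (by linarith)

/-- The spherical and cylindrical types exclude each other: dN = -(h/2)dX turns d(N + hX) into
(h/2)dX, and an immersed surface has no tangent plane inside a line. -/
theorem not_eventually_focalPoint_mem_line (P : SurfacePatch x p)
    (hP : P.patch.IsTangentiallyBiharmonic) (hH : ∀ q, meanCurvatureVector x q ≠ 0)
    (h : ∀ᶠ q in 𝓝 p, focalPoint x 2 q = focalPoint x 2 p) (c w : E3) :
    ¬∀ᶠ q in 𝓝 p, focalPoint x 1 q - c ∈ Submodule.span ℝ {w} := by
  intro hl
  obtain ⟨P', hP', hc, hy⟩ := P.exists_of_eventually hP (h.and hl)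
  set s := P'.patch
  have hh := s.pderiv_h_eq_zero hP'
  have humb := P'.umbilic_of_focalPoint_eq hP' hc hH fun u => (hy u).1
  set T : E3 →L[ℝ] E3 := (Submodule.span ℝ {w})ᗮ.starProjection with hT
  have hT0 : ∀ v, T v = 0 ↔ v ∈ Submodule.span ℝ {w} := fun v => by
    rw [hT, Submodule.starProjection_apply_eq_zero_iff, Submodule.orthogonal_orthogonal]
  have h1 : mapField T (s.N + s.h • s.X) = constField (s.h P'.center • T c) :=
    SmoothField.ext fun u => by
      have h2 := P'.h_smul_focalPoint hH 1 u
      rw [one_smul] at h2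
      rw [mapField_apply, constField_apply,
        ← SmoothScalar.apply_eq_of_pderiv_eq_zero hc hh u, ← map_smul, ← sub_eq_zero, ← map_sub,
        hT0]
      change s.N u + s.h u • s.X u - s.h u • c ∈ _
      rw [← h2, ← smul_sub]
      exact Submodule.smul_mem _ _ (hy u).2
  have h2 : ∀ i, 𝐃 i s.X P'.center ∈ Submodule.span ℝ {w} := by
    intro i
    have h3 := congrArg (fun F : SmoothField P'.domain E3 => F P'.center) (congrArg (𝐃 i) h1)
    have h4 := humb i P'.center
    rw [pderivField_mapField, pderivField_constField, map_add, pderivField_smul, hh, zero_smul,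
      zero_add, mapField_apply] at h3
    have h5 := (hT0 _).1 h3
    have h6 : s.h P'.center • 𝐃 i s.X P'.center = (2 : ℝ) •
        (𝐃 i s.N P'.center + s.h P'.center • 𝐃 i s.X P'.center) := by
      linear_combination (norm := module) -h4
    refine (Submodule.smul_mem_iff _ (P'.h_ne_zero hH P'.center)).1 ?_
    change s.h P'.center • 𝐃 i s.X P'.center ∈ _
    rw [h6]
    exact Submodule.smul_mem _ _ h5
  obtain ⟨a, ha⟩ := Submodule.mem_span_singleton.1 (h2 0)
  obtain ⟨b, hb⟩ := Submodule.mem_span_singleton.1 (h2 1)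
  have hli := s.linearIndependent P'.center
  have h7 := LinearIndependent.pair_iff.1 hli b (-a) (by
    rw [← ha, ← hb, smul_smul, smul_smul, neg_mul, neg_smul, mul_comm, add_neg_cancel])
  refine hli.ne_zero 1 ?_
  change 𝐃 1 s.X P'.center = 0
  rw [← hb, h7.1, zero_smul]

theorem eventually_focalPoint_mem_line (P : SurfacePatch x p)
    (hP : P.patch.IsTangentiallyBiharmonic) (hH : ∀ q, meanCurvatureVector x q ≠ 0)
    (hc : IsPreconnected (P.domain : Set (EuclideanSpace ℝ (Fin 2)))) (hK : P.patch.K = 0)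
    (i : Fin 2) (v : E3) (hv : IsUnit ⟪𝐃 i (P.patch.parallel P.patch.h), constField v⟫) :
    ∃ c w : E3, ‖w‖ = 1 ∧ ∀ᶠ q in 𝓝 p,
      focalPoint x 1 q - c ∈ Submodule.span ℝ {w} ∧ inner ℝ (meanCurvatureVector x q) w = 0 := by
  have hh := P.patch.pderiv_h_eq_zero hP
  have hconst : ∀ u, P.patch.h u = P.patch.h P.center := fun u =>
    SmoothScalar.apply_eq_of_pderiv_eq_zero hc hh u P.center
  obtain ⟨w, hw, hNw, hBw⟩ := OrientedPatch.exists_line hc hh (P.isUnit_h hH) hK i v hv P.center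
  refine ⟨focalPoint x 1 p, w, hw, P.eventually_of_forall fun u => ⟨?_, ?_⟩⟩
  · have h2 := P.h_smul_focalPoint hH 1 u
    have h3 := P.h_smul_focalPoint hH 1 P.center
    have h4 := hBw u
    rw [P.param_center, one_smul] at h3
    rw [one_smul] at h2
    rw [OrientedPatch.parallel, SmoothField.add_apply, SmoothField.add_apply,
      SmoothField.smul_apply, SmoothField.smul_apply, ← h2, ← h3, hconst u, ← smul_sub] at h4
    exact (Submodule.smul_mem_iff _ (P.h_ne_zero hH _)).1 h4
  · rw [P.H_apply, inner_smul_left, hNw, mul_zero]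

theorem eventually_sphere_or_cylinder (P : SurfacePatch x p)
    (hP : P.patch.IsTangentiallyBiharmonic) (hH : ∀ q, meanCurvatureVector x q ≠ 0) :
    (∀ᶠ q in 𝓝 p, focalPoint x 2 q = focalPoint x 2 p) ∨ ∃ c w : E3, ‖w‖ = 1 ∧ ∀ᶠ q in 𝓝 p,
      focalPoint x 1 q - c ∈ Submodule.span ℝ {w} ∧ inner ℝ (meanCurvatureVector x q) w = 0 := by
  obtain ⟨P, hP, hc, -⟩ := P.exists_of_eventually hP (Filter.Eventually.of_forall fun _ => trivial)
  have hh := P.patch.pderiv_h_eq_zero hP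
  have hconst : ∀ u, P.patch.h u = P.patch.h P.center := fun u =>
    SmoothScalar.apply_eq_of_pderiv_eq_zero hc hh u P.center
  rcases hP.umbilic_or_flat hc P.center (P.isUnit_h hH) with h | hK
  · refine Or.inl (P.eventually_of_forall fun u => ?_)
    have h1 := SmoothField.apply_eq_of_pderivField_eq_zero hc h u P.center
    simp only [SmoothField.add_apply, SmoothField.smul_apply, SmoothScalar.ofNat_apply] at h1
    have h3 := P.h_smul_focalPoint hH 2 P.center
    rw [P.param_center] at h3
    rw [← P.h_smul_focalPoint hH, ← h3, hconst u] at h1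
    exact smul_right_injective _ (P.h_ne_zero hH _) h1
  · right
    -- Otherwise the centre is umbilic with both principal curvatures h, so h = 2h. The nonzero
    -- derivative at the centre serves as test vector, and the pairing with it stays nonzero on a
    -- smaller ball.
    obtain ⟨i, hi⟩ : ∃ i, 𝐃 i (P.patch.parallel P.patch.h) P.center ≠ 0 := by
      by_contra! h0
      have h1 := OrientedPatch.h_apply_eq_of_umbilic (s := P.patch) (u := P.center)
        (c := P.patch.h P.center) fun i => by
          have := h0 i
          rw [OrientedPatch.D_parallel hh] at this
          exact eq_neg_of_add_eq_zero_left this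
      exact P.h_ne_zero hH P.center (by linarith)
    set v := 𝐃 i (P.patch.parallel P.patch.h) P.center with hv
    set g := ⟪𝐃 i (P.patch.parallel P.patch.h), constField v⟫ with hg
    have hg0 : ∀ᶠ u in 𝓝 P.center.1, extendZero g u ≠ 0 := by
      refine (g.contDiffOn.continuousOn.continuousAt
        (P.domain.isOpen.mem_nhds P.center.2)).eventually_ne ?_
      rw [extendZero_apply]
      rw [hg, innerField_apply, constField_apply, ← hv]
      exact inner_self_ne_zero.2 hi
    obtain ⟨V, hV, hcV, hP', hc', hgV⟩ := P.exists_ball hP hg0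
    have hgu : IsUnit ⟪𝐃 i ((P.patch.restrict hV).parallel (P.patch.restrict hV).h),
        constField v⟫ := by
      have hB : (P.patch.restrict hV).parallel (P.patch.restrict hV).h =
          restrictField hV (P.patch.parallel P.patch.h) := by
        rw [OrientedPatch.h_restrict, OrientedPatch.parallel, OrientedPatch.parallel, map_add,
          restrictField_smul]
        rfl
      refine SmoothScalar.isUnit_of_ne_zero fun u => ?_
      rw [hB, pderivField_restrictField, innerField_apply, restrictField_apply]
      have := hgV u u.2
      rw [extendZero_of_mem _ (hV u.2)] at this
      change g ⟨u, hV u.2⟩ ≠ 0 at this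
      rwa [hg, innerField_apply] at this
    have hK' : (P.patch.restrict hV).K = 0 := by rw [OrientedPatch.K_restrict, hK, map_zero]
    exact (P.restrict hV hcV).eventually_focalPoint_mem_line hP' hH hc' hK' i v hgu

end SurfacePatch

theorem isPartOfRoundSphere_of_focalPoint_eq {c : E3} {κ : ℝ} (hκ : 0 < κ)
    (hH : ∀ p, ‖meanCurvatureVector x p‖ = κ) (h : ∀ p, focalPoint x 2 p = c) :
    IsPartOfRoundSphere x := by
  refine ⟨c, κ⁻¹, inv_pos.2 hκ, fun p => ?_⟩
  rw [mem_sphere_iff_norm, ← h p, focalPoint, sub_add_cancel_left, norm_neg, norm_smul, hH,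
    Real.norm_of_nonneg (by positivity)]
  field_simp

theorem isPartOfCircularCylinder_of_focalPoint_mem {c w : E3} {κ : ℝ} (hw : ‖w‖ = 1) (hκ : 0 < κ)
    (hH : ∀ p, ‖meanCurvatureVector x p‖ = κ)
    (h : ∀ p, focalPoint x 1 p - c ∈ Submodule.span ℝ {w} ∧
      inner ℝ (meanCurvatureVector x p) w = 0) : IsPartOfCircularCylinder x := by
  refine ⟨c, w, (2 * κ)⁻¹, hw, by positivity, fun p => ?_⟩
  obtain ⟨h1, h2⟩ := h p
  obtain ⟨a, ha⟩ := Submodule.mem_span_singleton.1 h1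
  have hx : x p - c = a • w - (1 / (2 * κ ^ 2)) • meanCurvatureVector x p := by
    rw [ha, focalPoint, hH]; module
  have hxw : inner ℝ (x p - c) w = a := by
    rw [hx, inner_sub_left, inner_smul_left, inner_smul_left, h2, real_inner_self_eq_norm_sq, hw]
    simp
  rw [hxw, hx, sub_sub_cancel_left, norm_neg, norm_smul, hH, Real.norm_of_nonneg (by positivity)]
  field_simp

variable [IsManifold (𝓡 2) ∞ M] [ConnectedSpace M]

theorem isPartOfRoundSphere_or_cylinder (hx : IsSmoothImmersion x)
    (hT : HasTangentiallyBiharmonicNormalBundle x) {κ : ℝ} (hκ : 0 < κ)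
    (hH : ∀ p, ‖meanCurvatureVector x p‖ = κ) :
    IsPartOfRoundSphere x ∨ IsPartOfCircularCylinder x := by
  have hH0 : ∀ p, meanCurvatureVector x p ≠ 0 := fun p h => by
    have := hH p
    rw [h, norm_zero] at this
    exact hκ.ne this
  choose P hP using exists_surfacePatch hx hT
  have hor := fun p => (P p).eventually_sphere_or_cylinder (hP p) hH0
  let line : E3 → E3 → M → Prop := fun c w p => ∀ᶠ q in 𝓝 p,
    focalPoint x 1 q - c ∈ Submodule.span ℝ {w} ∧ inner ℝ (meanCurvatureVector x q) w = 0
  let sph : M → Prop := fun p => ∀ᶠ q in 𝓝 p, focalPoint x 2 q = focalPoint x 2 p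
  have hline : ∀ c w p, line c w p → ∀ᶠ q in 𝓝 p, line c w q := fun c w p h =>
    eventually_eventually_nhds.2 h
  have hsph : ∀ p, sph p → ∀ᶠ q in 𝓝 p, sph q := fun p h => by
    filter_upwards [eventually_eventually_nhds.2 h] with q hq
    filter_upwards [hq] with r hr
    rw [hr, hq.self_of_nhds]
  have hdisj : ∀ c w p, line c w p → ¬sph p := fun c w p h hs =>
    (P p).not_eventually_focalPoint_mem_line (hP p) hH0 hs c w (h.mono fun _ hq => hq.1)
  -- Both types are open conditions, they cover `M`, and they are disjoint.
  have hclopen : IsClopen {p | sph p} := by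
    refine ⟨isOpen_compl_iff.1 (isOpen_iff_eventually.2 fun p hp => ?_),
      isOpen_iff_eventually.2 hsph⟩
    obtain ⟨c, w, -, h⟩ := (hor p).resolve_left hp
    exact (hline c w p h).mono fun q hq => hdisj c w q hq
  rcases isClopen_iff.1 hclopen with hempty | huniv
  · right
    have hns : ∀ p, ¬sph p := fun p hp => (Set.mem_empty_iff_false p).1 (hempty ▸ hp)
    obtain ⟨p₀⟩ : Nonempty M := inferInstance
    obtain ⟨c, w, hw, h₀⟩ := (hor p₀).resolve_left (hns p₀)
    -- The focal point is not locally constant, so near q two axes share two distinct points and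
    -- therefore coincide.
    have hsame : ∀ c' w' q, line c w q → line c' w' q →
        c' - c ∈ Submodule.span ℝ {w} ∧
          Submodule.span ℝ {w'} ≤ Submodule.span ℝ {w} ∧ w ∈ Submodule.span ℝ {w'} := by
      intro c' w' q h h'
      have hne : ∃ᶠ r in 𝓝 q, focalPoint x 1 r ≠ focalPoint x 1 q :=
        Filter.not_eventually.1 ((P q).not_eventually_focalPoint_one_eq (hP q) hH0)
      obtain ⟨r, hr, ⟨h1, -⟩, h2, -⟩ := (hne.and_eventually (h.and h')).exists
      have h3 := h.self_of_nhds.1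
      have h4 := h'.self_of_nhds.1
      have hd : ∀ c w : E3, focalPoint x 1 r - c ∈ Submodule.span ℝ {w} →
          focalPoint x 1 q - c ∈ Submodule.span ℝ {w} → ∃ a : ℝ, a ≠ 0 ∧
            a • w = focalPoint x 1 r - focalPoint x 1 q := fun c w hr' hq' => by
        obtain ⟨a, ha⟩ := Submodule.mem_span_singleton.1 (Submodule.sub_mem _ hr' hq')
        rw [sub_sub_sub_cancel_right] at ha
        refine ⟨a, fun ha0 => hr (sub_eq_zero.1 ?_), ha⟩
        rw [← ha, ha0, zero_smul]
      obtain ⟨a, ha0, ha⟩ := hd c w h1 h3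
      obtain ⟨b, hb0, hb⟩ := hd c' w' h2 h4
      have hw1 : w' ∈ Submodule.span ℝ {w} := by
        rw [← Submodule.smul_mem_iff _ hb0, hb, ← ha]
        exact Submodule.smul_mem _ _ (Submodule.mem_span_singleton_self w)
      have hw2 : w ∈ Submodule.span ℝ {w'} := by
        rw [← Submodule.smul_mem_iff _ ha0, ha, ← hb]
        exact Submodule.smul_mem _ _ (Submodule.mem_span_singleton_self w')
      have hle : Submodule.span ℝ {w'} ≤ Submodule.span ℝ {w} :=
        Submodule.span_le.2 (Set.singleton_subset_iff.2 hw1)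
      refine ⟨?_, hle, hw2⟩
      rw [← sub_sub_sub_cancel_left _ _ (focalPoint x 1 q)]
      exact Submodule.sub_mem _ h3 (hle h4)
    -- For closedness: if p has another axis, that axis serves all nearby points, and sharing one of
    -- them with (c, w) would make the axes equal and put p back in the set.
    have hclopen' : IsClopen {p | line c w p} := by
      refine ⟨isOpen_compl_iff.1 (isOpen_iff_eventually.2 fun p hp => ?_),
        isOpen_iff_eventually.2 (hline c w)⟩
      obtain ⟨c', w', -, h'⟩ := (hor p).resolve_left (hns p)
      refine (hline c' w' p h').mono fun q hq hq' => hp ?_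
      obtain ⟨hc, hle, hw2⟩ := hsame c' w' q hq' hq
      obtain ⟨a, ha⟩ := Submodule.mem_span_singleton.1 hw2
      refine h'.mono fun r hr => ⟨?_, ?_⟩
      · rw [← sub_add_sub_cancel _ c' c]
        exact Submodule.add_mem _ (hle hr.1) hc
      · rw [← ha, inner_smul_right, hr.2, mul_zero]
    have hall := hclopen'.eq_univ ⟨p₀, h₀⟩
    refine isPartOfCircularCylinder_of_focalPoint_mem (c := c) hw hκ hH fun p => ?_
    have hp : line c w p := Set.eq_univ_iff_forall.1 hall p
    exact hp.self_of_nhds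
  · left
    have hlc : IsLocallyConstant (focalPoint x 2) :=
      (IsLocallyConstant.iff_eventually_eq _).2 fun p => by
        have hp : sph p := Set.eq_univ_iff_forall.1 huniv p
        exact hp
    obtain ⟨p₀⟩ : Nonempty M := inferInstance
    exact isPartOfRoundSphere_of_focalPoint_eq hκ hH fun p =>
      hlc.apply_eq_of_preconnectedSpace p p₀

end

end NormalBundleSurface

end

/-! ### The classification. -/

theorem theorem3 {M : Type*} [TopologicalSpace M] [ConnectedSpace M]
    [ChartedSpace (EuclideanSpace ℝ (Fin 2)) M] [IsManifold (𝓡 2) ∞ M]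
    (x : M → NormalBundleSurface.E3) (hx : NormalBundleSurface.IsSmoothImmersion x) :
    NormalBundleSurface.HasTangentiallyBiharmonicNormalBundle x ↔
      (NormalBundleSurface.IsMinimal x ∨ NormalBundleSurface.IsPartOfRoundSphere x ∨
        NormalBundleSurface.IsPartOfCircularCylinder x) := by
  constructor
  · intro hT
    have hlc := NormalBundleSurface.norm_meanCurvatureVector_isLocallyConstant hx hT
    obtain ⟨p₀⟩ : Nonempty M := inferInstance
    have hconst := fun p => hlc.apply_eq_of_preconnectedSpace p p₀
    by_cases h0 : NormalBundleSurface.meanCurvatureVector x p₀ = 0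
    · refine Or.inl (NormalBundleSurface.isMinimal_of_meanCurvatureVector_eq_zero hx fun p => ?_)
      have := hconst p
      rwa [h0, norm_zero, norm_eq_zero] at this
    · exact Or.inr (NormalBundleSurface.isPartOfRoundSphere_or_cylinder hx hT
        (norm_pos_iff.2 h0) hconst)
  · rintro (h | h | h)
    · exact h.hasTangentiallyBiharmonicNormalBundle hx
    · exact h.hasTangentiallyBiharmonicNormalBundle hx
    · exact h.hasTangentiallyBiharmonicNormalBundle hx
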